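/- **Formulas, sequents, proofs.** Fix a set of literals with an involution $a\mapsto\bar a$, $\bar a\ne a$. Formulas are generated from literals by the binary connectives $\otimes,⅋,\&,\oplus$ (the last two are *additive*); a sequent is a finite list of formulas, identified with its parse forest (leaves labelled by literals, internal vertices by connectives). Proofs (cut-free, unit-free MALL) are generated by the rules: axiom $P,\bar P$; permutation, from $\Gamma$ infer $\sigma\Gamma$; $⅋$, from $\Gamma,A,B$ infer $\Gamma,A⅋B$; $\oplus_i$, from $\Gamma,A_i$ infer $\Gamma,A_0\oplus A_1$; $\otimes$, from $\Gamma,A$ and $B,\Delta$ infer $\Gamma,A\otimes B,\Delta$; $\&$, from $\Gamma,A$ and $\Gamma,B$ infer $\Gamma,A\,\&\,B$. **Linkings.** A coherence space is a set of tokens with a symmetric irreflexive relation $\frown$ (strict coherence); distinct tokens that are not strictly coherent *conflict*, written $\#$. A linking $\lambda:L\to\Gamma$ is a binary relation from a finite coherence space $L$ (whose tokens are called links) to the leaves of $\Gamma$ such that the direct image of each link is a pair of leaves with dual labels, and distinct links that share a leaf conflict. The translation of a proof is defined by induction: an axiom gives the single link on $P,\bar P$; the rules perm, $⅋$, $\oplus_i$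 keep the linking (along the inclusion of the leaves of the premise into those of the conclusion); $\otimes$ and $\&$ take the union of the linkings of the two premises, the links of different premises being strictly coherent for $\otimes$ and in conflict for $\&$. A linking is *sequentializable* if it is, up to renaming of links, the translation of a proof. **Slicings.** A map $X\to Y$ of coherence spaces is a relation $R$ between their tokens such that, if $x_1Ry_1$ and $x_2Ry_2$, then $x_1\frown x_2$ implies $y_1\frown y_2$, and $y_1\# y_2$ implies $x_1\# x_2$. A coherence space is contractible if it is finite and $x_1\#x_2\#x_3\#x_4$ with distinct $x_i$ implies $x_1\#x_3$, $x_2\#x_4$ or $x_1\#x_4$. The coherence space of $\Gamma$ has the leaves of $\Gamma$ as tokens, with $x\#y$ iff $x\neq y$ and the smallest subformula containing both exists and is additive. A linking $\lambda:L\to\Gamma$ is a *slicing* if $L$ is contractible and $\lambda$ is an inclusion-maximal map from $L$ to the coherence space of $\Gamma$. **Erasure.** The conflict graph $\lambda^{\#}$ of a linking has as vertices the vertices of $\Gamma$ and the links, and as edges those of the parse forest, the pairs of conflicting links, and the pairs $\{l,x\}$ with $(l,x)\in\lambda$. The linking is *connected* if $L\ne\emptyset$ and $\lambda^{\#}$ is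 connected. A *piece* of $\lambda$ is its restriction to a connected component of the graph $(L,\frown)$. A set of links *touches* an argument $A_j$ of a formula $A_0\square A_1$ of $\Gamma$ if some leaf of $A_j$ is in its image, and *chooses* $A_j$ if it touches $A_j$ and does not touch $A_{1-j}$. The root $r$ of a formula $A_0\square A_1$ of $\Gamma$ is *ready* in a connected slicing $\lambda$, and erasing it gives the set $\lambda\setminus r$, as follows. - $\square=\otimes$: ready if $r$ lies on no cycle of $\lambda^{\#}$; $\lambda\setminus r=\{\lambda_0,\lambda_1\}$, the parts of $\lambda$ in the two connected components of $\lambda^{\#}$ with $r$ deleted. - $\square=⅋$: always ready; $\lambda\setminus r=\{\lambda_0\}$, where $\lambda_0$ is $\lambda$ with $r$ deleted (the formula is replaced by $A_0,A_1$). - $\square=\oplus$: ready if $\lambda$ chooses some $A_j$; $\lambda\setminus r=\{\lambda_j\}$, where $\lambda_j$ is $\lambda$ with $r$ and $A_{1-j}$ deleted. - $\square=\&$: ready if every piece of $\lambda$ chooses one of $A_0,A_1$; $\lambda\setminus r=\{\lambda_0,\lambda_1\}$, where $\lambda_i$ is the union of the pieces that choose $A_i$, on $\Gamma$ with $A_0\,\&\,A_1$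 replaced by $A_i$. A cluster is a set of slicings (each on its own sequent) or an error symbol $\mathsf E$. The relation $\leadsto$ on clusters is given by: $Y\leadsto\mathsf E$ if $Y$ contains a slicing that is not connected; and, if $\mu\notin X$ and every slicing in $X$ is connected, $X\cup\{\mu\}\leadsto X\cup(\mu\setminus r)$ for $r$ a ready root of $\mu$, and $X\cup\{\mu\}\leadsto X$ if $\mu$ is a single link on $P,\bar P$ for a literal $P$. A slicing $\lambda$ is *erasable* if $\{\lambda\}\leadsto^*\emptyset$, where $\leadsto^*$ is the reflexive transitive closure. A *conflict net* is an erasable slicing. **Theorem (Sequentialization).** For every sequent $\Gamma$, a linking on $\Gamma$ is a conflict net if and only if it is sequentializable. -/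

import Mathlib

namespace MALL

universe u v w

/-- A set of literals with a fixed-point free involutive duality. -/
class Literals (𝒜 : Type v) where
  dual : 𝒜 → 𝒜
  dual_ne : ∀ a, dual a ≠ a
  dual_dual : ∀ a, dual (dual a) = a

/-- Unit-free MALL formulas: tensor, par, with (`&`) and plus (`⊕`). -/
inductive Formula (𝒜 : Type v) : Type v where
  | lit (a : 𝒜)
  | tensor (A B : Formula 𝒜)
  | par (A B : Formula 𝒜)
  | amp (A B : Formula 𝒜)
  | plus (A B : Formula 𝒜)

abbrev Sequent (𝒜 : Type v) := List (Formula 𝒜)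

/-- An address in a sequent: the index of a formula (from `0`), and a path from the root of that
formula, where `false` descends into the left argument and `true` into the right one. -/
abbrev Pos := ℕ × List Bool

/-- The formula `A`, `B` (left and right argument) selected by a Boolean. -/
def pick {α : Type w} (A B : α) : Bool → α
  | false => A
  | true => B

/-- The subformula at the end of a path. -/
def Formula.subAt {𝒜 : Type v} : Formula 𝒜 → List Bool → Option (Formula 𝒜)
  | A, [] => some A
  | .lit _, _ :: _ => none
  | .tensor A B, b :: p => (pick A B b).subAt p
  | .par A B, b :: p => (pick A B b).subAt p
  | .amp A B, b :: p => (pick A B b).subAt p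
  | .plus A B, b :: p => (pick A B b).subAt p
termination_by structural _ p => p

/-- The subformula occurrence of a sequent at an address. -/
def subAt {𝒜 : Type v} (Γ : Sequent 𝒜) (x : Pos) : Option (Formula 𝒜) :=
  Γ[x.1]?.bind fun A => A.subAt x.2

/-- The vertices of the parse forest of `Γ`. -/
def Vertex {𝒜 : Type v} (Γ : Sequent 𝒜) : Type := {x : Pos // ∃ A, subAt Γ x = some A}

/-- The leaves of the parse forest of `Γ`. -/
def Leaf {𝒜 : Type v} (Γ : Sequent 𝒜) : Type := {x : Pos // ∃ a, subAt Γ x = some (.lit a)}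

/-- Two leaves are dual if their literal labels are. -/
def DualLeaves {𝒜 : Type v} [Literals 𝒜] {Γ : Sequent 𝒜} (x y : Leaf Γ) : Prop :=
  ∃ a, subAt Γ x.1 = some (.lit a) ∧ subAt Γ y.1 = some (.lit (Literals.dual a))

/-! ### Coherence spaces

A coherence space with web `X` is a `SimpleGraph X`, whose adjacency is strict coherence `⌢`;
strict incoherence (conflict, `#`) is then adjacency in the complementary graph. -/

/-- Maps of coherence spaces: relations that preserve strict coherence and reflect conflict. -/
def IsMap {X : Type u} {Y : Type w} (G : SimpleGraph X) (H : SimpleGraph Y)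
    (R : X → Y → Prop) : Prop :=
  (∀ x₁ x₂ y₁ y₂, R x₁ y₁ → R x₂ y₂ → G.Adj x₁ x₂ → H.Adj y₁ y₂) ∧
  (∀ x₁ x₂ y₁ y₂, R x₁ y₁ → R x₂ y₂ → Hᶜ.Adj y₁ y₂ → Gᶜ.Adj x₁ x₂)

/-- The sum of two coherence spaces: disjoint union, with conflict between tokens of `G` and
tokens of `H`. -/
def cohSum {X : Type u} {Y : Type w} (G : SimpleGraph X) (H : SimpleGraph Y) :
    SimpleGraph (X ⊕ Y) := G.sum H

/-- The product of two coherence spaces: disjoint union, with strict coherence between tokens of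
`G` and tokens of `H`. -/
def cohProd {X : Type u} {Y : Type w} (G : SimpleGraph X) (H : SimpleGraph Y) :
    SimpleGraph (X ⊕ Y) := (Gᶜ.sum Hᶜ)ᶜ

/-- A coherence space is contractible if its web is finite and its conflict graph has no induced
path on four vertices. -/
def Contractible {X : Type u} (G : SimpleGraph X) : Prop :=
  Finite X ∧
  ∀ x₁ x₂ x₃ x₄ : X, [x₁, x₂, x₃, x₄].Nodup →
    Gᶜ.Adj x₁ x₂ → Gᶜ.Adj x₂ x₃ → Gᶜ.Adj x₃ x₄ →
    Gᶜ.Adj x₁ x₃ ∨ Gᶜ.Adj x₂ x₄ ∨ Gᶜ.Adj x₁ x₄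

/-- The addresses `x` and `y` branch apart at an additive vertex: the smallest subformula
containing both is a `&` or a `⊕`. -/
def AdditiveSplit {𝒜 : Type v} (Γ : Sequent 𝒜) (x y : Pos) : Prop :=
  ∃ (i : ℕ) (s p q : List Bool) (b : Bool) (A B : Formula 𝒜),
    x = (i, s ++ b :: p) ∧ y = (i, s ++ (!b) :: q) ∧
    (subAt Γ (i, s) = some (.amp A B) ∨ subAt Γ (i, s) = some (.plus A B))

theorem AdditiveSplit.symm {𝒜 : Type v} {Γ : Sequent 𝒜} {x y : Pos}
    (h : AdditiveSplit Γ x y) : AdditiveSplit Γ y x := by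
  obtain ⟨i, s, p, q, b, A, B, hx, hy, hs⟩ := h
  exact ⟨i, s, q, p, !b, A, B, hy, by simpa using hx, hs⟩

/-- The coherence space of a sequent: distinct leaves conflict iff the smallest subformula
containing both is additive, and are strictly coherent otherwise. -/
def coh {𝒜 : Type v} (Γ : Sequent 𝒜) : SimpleGraph (Leaf Γ) where
  Adj x y := x ≠ y ∧ ¬ AdditiveSplit Γ x.1 y.1
  symm := ⟨fun _ _ h => ⟨h.1.symm, fun h' => h.2 h'.symm⟩⟩
  loopless := ⟨fun _ h => h.1 rfl⟩

/-! ### Linkings -/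

/-- A binary relation from (the web of) a finite coherence space to the leaves of `Γ`. -/
structure Prelinking {𝒜 : Type v} (Γ : Sequent 𝒜) where
  Link : Type u
  finite : Finite Link
  space : SimpleGraph Link
  rel : Link → Leaf Γ → Prop

/-- A linking: each link is related to exactly the two leaves of a dual pair, and distinct links
that share a leaf are in conflict. -/
structure Linking {𝒜 : Type v} [Literals 𝒜] (Γ : Sequent 𝒜) extends Prelinking.{u} Γ where
  dual_pair : ∀ l, ∃ x y, DualLeaves x y ∧ {z | rel l z} = {x, y}
  overlap : ∀ l l' x, rel l x → rel l' x → l ≠ l' → spaceᶜ.Adj l l'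

/-- Equality of (pre)linkings up to renaming of links. -/
def Prelinking.Iso {𝒜 : Type v} {Γ : Sequent 𝒜} (K : Prelinking.{u} Γ) (M : Prelinking.{w} Γ) :
    Prop :=
  ∃ e : K.Link ≃ M.Link,
    (∀ l l', M.space.Adj (e l) (e l') ↔ K.space.Adj l l') ∧
    (∀ l x, M.rel (e l) x ↔ K.rel l x)

/-- A slicing is a linking that is a maximal map (with respect to inclusion) from a contractible
coherence space to the coherence space of the sequent. -/
def Linking.IsSlicing {𝒜 : Type v} [Literals 𝒜] {Γ : Sequent 𝒜} (K : Linking.{u} Γ) : Prop :=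
  Contractible K.space ∧ Maximal (IsMap K.space (coh Γ)) K.rel

/-! ### Proofs and their translation -/

/-- The sequent `σΓ`, whose `i`-th formula is the `σ i`-th formula of `Γ`. -/
def permute {𝒜 : Type v} (Γ : Sequent 𝒜) (σ : Equiv.Perm (Fin Γ.length)) : Sequent 𝒜 :=
  List.ofFn fun i => Γ.get (σ i)

/-- Cut-free, unit-free MALL proofs. -/
inductive Proof {𝒜 : Type v} [Literals 𝒜] : Sequent 𝒜 → Type v where
  | ax (P : 𝒜) : Proof [.lit P, .lit (Literals.dual P)]
  | perm {Γ : Sequent 𝒜} (σ : Equiv.Perm (Fin Γ.length)) (π : Proof Γ) : Proof (permute Γ σ)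
  | par {Γ : Sequent 𝒜} {A B : Formula 𝒜} (π : Proof (Γ ++ [A, B])) : Proof (Γ ++ [.par A B])
  | plus {Γ : Sequent 𝒜} {A B : Formula 𝒜} (i : Bool) (π : Proof (Γ ++ [pick A B i])) :
      Proof (Γ ++ [.plus A B])
  | tensor {Γ Δ : Sequent 𝒜} {A B : Formula 𝒜} (π : Proof (Γ ++ [A])) (ρ : Proof (B :: Δ)) :
      Proof (Γ ++ .tensor A B :: Δ)
  | amp {Γ : Sequent 𝒜} {A B : Formula 𝒜} (π : Proof (Γ ++ [A])) (ρ : Proof (Γ ++ [B])) :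
      Proof (Γ ++ [.amp A B])

/-- If the formulas of one sequent are, in order, the subformula occurrences of another sequent
at the addresses `vs`, then `At vs x y` says that the vertex `x` of the former is the vertex `y`
of the latter. -/
def At (vs : List Pos) (x y : Pos) : Prop :=
  ∃ v, vs[x.1]? = some v ∧ y = (v.1, v.2 ++ x.2)

/-- The first `n` roots of a sequent. -/
def roots (n : ℕ) : List Pos := (List.range n).map fun k => (k, [])

/-- Transport of a relation along the inclusion of the leaves of `Γ'` into the leaves of `Γ`
that is given by the list `vs` of addresses, in `Γ`, of the formulas of `Γ'`. -/
def push {𝒜 : Type v} {Γ' : Sequent 𝒜} (Γ : Sequent 𝒜) (vs : List Pos) {L : Type u}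
    (R : L → Leaf Γ' → Prop) (l : L) (y : Leaf Γ) : Prop :=
  ∃ x : Leaf Γ', At vs x.1 y.1 ∧ R l x

/-- The translation of a proof to a linking: one link per axiom rule. A unary rule leaves the
coherence space of links as it is; `⊗` takes the product and `&` the sum of the coherence
spaces of the two branches. -/
def Proof.translation {𝒜 : Type v} [Literals 𝒜] {Γ : Sequent 𝒜} : Proof Γ → Prelinking.{0} Γ
  | .ax _ => ⟨Unit, inferInstance, ⊥, fun _ _ => True⟩
  | .perm (Γ := Γ) σ π =>
      let K := π.translation
      ⟨K.Link, K.finite, K.space,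
        push _ (List.ofFn fun k : Fin Γ.length => ((σ.symm k : ℕ), [])) K.rel⟩
  | .par (Γ := Γ) π =>
      let K := π.translation
      ⟨K.Link, K.finite, K.space,
        push _ (roots Γ.length ++ [(Γ.length, [false]), (Γ.length, [true])]) K.rel⟩
  | .plus (Γ := Γ) i π =>
      let K := π.translation
      ⟨K.Link, K.finite, K.space, push _ (roots Γ.length ++ [(Γ.length, [i])]) K.rel⟩
  | .tensor (Γ := Γ) (Δ := Δ) π ρ =>
      let K := π.translation
      let M := ρ.translation
      ⟨K.Link ⊕ M.Link, have := K.finite; have := M.finite; inferInstance,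
        cohProd K.space M.space,
        Sum.elim
          (push _ (roots Γ.length ++ [(Γ.length, [false])]) K.rel)
          (push _ ((Γ.length, [true]) ::
            (List.range Δ.length).map fun k => (Γ.length + 1 + k, [])) M.rel)⟩
  | .amp (Γ := Γ) π ρ =>
      let K := π.translation
      let M := ρ.translation
      ⟨K.Link ⊕ M.Link, have := K.finite; have := M.finite; inferInstance,
        cohSum K.space M.space,
        Sum.elim
          (push _ (roots Γ.length ++ [(Γ.length, [false])]) K.rel)
          (push _ (roots Γ.length ++ [(Γ.length, [true])]) M.rel)⟩

/-- A linking is sequentializable if it is (up to renaming of links) the translation of a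
proof. -/
def Linking.Sequentializable {𝒜 : Type v} [Literals 𝒜] {Γ : Sequent 𝒜} (K : Linking.{u} Γ) :
    Prop :=
  ∃ π : Proof Γ, K.toPrelinking.Iso π.translation

/-! ### Erasure -/

namespace Prelinking

variable {𝒜 : Type v} {Γ : Sequent 𝒜}

/-- The conflict graph: the parse forest of `Γ`, the conflict edges between links, and an edge
between a link and each of its leaves. -/
def conflictGraph (K : Prelinking.{u} Γ) : SimpleGraph (Vertex Γ ⊕ K.Link) :=
  SimpleGraph.fromRel fun s t =>
    match s, t with
    | .inl x, .inl y => ∃ b, y.1 = (x.1.1, x.1.2 ++ [b])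
    | .inr l, .inl x => ∃ z : Leaf Γ, z.1 = x.1 ∧ K.rel l z
    | .inr l, .inr m => K.spaceᶜ.Adj l m
    | .inl _, .inr _ => False

/-- Non-empty with connected conflict graph. -/
def Connected (K : Prelinking.{u} Γ) : Prop := Nonempty K.Link ∧ K.conflictGraph.Connected

/-- The links in `S` touch the left (`b = false`) or right (`b = true`) argument of the `i`-th
formula: some leaf of that argument is in their image. -/
def Touches (K : Prelinking.{u} Γ) (S : Set K.Link) (i : ℕ) (b : Bool) : Prop :=
  ∃ l ∈ S, ∃ x : Leaf Γ, K.rel l x ∧ ∃ p, x.1 = (i, b :: p)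

/-- The links in `S` touch the argument `b` of the `i`-th formula and not the other one. -/
def Chooses (K : Prelinking.{u} Γ) (S : Set K.Link) (i : ℕ) (b : Bool) : Prop :=
  K.Touches S i b ∧ ¬ K.Touches S i (!b)

/-- The links in `S` touch exactly one argument of the `i`-th formula. -/
def Unary (K : Prelinking.{u} Γ) (S : Set K.Link) (i : ℕ) : Prop := ∃ b, K.Chooses S i b

/-- The sets of links of the pieces: the connected components of the coherence graph. -/
def IsPiece (K : Prelinking.{u} Γ) (S : Set K.Link) : Prop :=
  ∃ c : K.space.ConnectedComponent, S = c.supp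

/-- The root of the `i`-th formula is ready to be erased. -/
def Ready (K : Prelinking.{u} Γ) (i : ℕ) : Prop :=
  K.Connected ∧
  match Γ[i]? with
  | some (.tensor _ _) =>
      ∀ r : Vertex Γ, r.1 = (i, []) →
        ∀ c : K.conflictGraph.Walk (.inl r) (.inl r), ¬ c.IsCycle
  | some (.par _ _) => True
  | some (.plus _ _) => K.Unary Set.univ i
  | some (.amp _ _) => ∀ S, K.IsPiece S → K.Unary S i
  | some (.lit _) => False
  | none => False

/-- The restriction of a prelinking to the links in `S` and to the sequent whose formulas are
the subformula occurrences of `Γ` at the addresses `vs`. -/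
def restrict (K : Prelinking.{u} Γ) (S : Set K.Link) (vs : List Pos) :
    Prelinking.{u} (vs.filterMap (subAt Γ)) where
  Link := S
  finite := have := K.finite; inferInstance
  space := K.space.induce S
  rel l x := ∃ y : Leaf Γ, At vs x.1 y.1 ∧ K.rel l.1 y

/-- The addresses of the roots of `Γ`, in order, with the `i`-th one replaced by those in
`mid`. -/
def replaceRoot (Γ : Sequent 𝒜) (i : ℕ) (mid : List Pos) : List Pos :=
  (List.range Γ.length).flatMap fun k => if k = i then mid else [(k, [])]

/-- `K.InComponent i b s`: upon deleting the root of the `i`-th formula from the conflict graph,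
`s` is in the connected component of the root of the argument `b` of that formula. -/
def InComponent (K : Prelinking.{u} Γ) (i : ℕ) (b : Bool) (s : Vertex Γ ⊕ K.Link) : Prop :=
  ∃ a t : {t : Vertex Γ ⊕ K.Link // ∀ r : Vertex Γ, t = .inl r → r.1 ≠ (i, [])},
    (∃ x : Vertex Γ, a.1 = .inl x ∧ x.1 = (i, [b])) ∧ t.1 = s ∧
    (K.conflictGraph.comap Subtype.val).Reachable a t

open Classical in
/-- The part of `K` in the component of the argument `b`, upon deleting the root of the `i`-th
formula from the conflict graph. -/
noncomputable def componentPart (K : Prelinking.{u} Γ) (i : ℕ) (b : Bool) :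
    (Δ : Sequent 𝒜) × Prelinking.{u} Δ :=
  ⟨_, K.restrict {l | K.InComponent i b (.inr l)}
    ((replaceRoot Γ i [(i, [false]), (i, [true])]).filter fun x =>
      ∃ y : Vertex Γ, y.1 = x ∧ K.InComponent i b (.inl y))⟩

/-- The restriction of `K` to the links in `S`, with the `i`-th formula of the sequent replaced
by its argument `b`. -/
def argumentPart (K : Prelinking.{u} Γ) (S : Set K.Link) (i : ℕ) (b : Bool) :
    (Δ : Sequent 𝒜) × Prelinking.{u} Δ :=
  ⟨_, K.restrict S (replaceRoot Γ i [(i, [b])])⟩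

/-- The union of the pieces that choose the argument `b` of the `i`-th formula. -/
def choosers (K : Prelinking.{u} Γ) (i : ℕ) (b : Bool) : Set K.Link :=
  {l | ∃ S, K.IsPiece S ∧ l ∈ S ∧ K.Chooses S i b}

/-- The result of erasing the root of the `i`-th formula (meaningful if that root is ready). -/
noncomputable def erase (K : Prelinking.{u} Γ) (i : ℕ) :
    Set ((Δ : Sequent 𝒜) × Prelinking.{u} Δ) :=
  match Γ[i]? with
  | some (.tensor _ _) => {K.componentPart i false, K.componentPart i true}
  | some (.par _ _) =>
      {⟨_, K.restrict Set.univ (replaceRoot Γ i [(i, [false]), (i, [true])])⟩}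
  | some (.plus _ _) => {T | ∃ b, K.Chooses Set.univ i b ∧ T = K.argumentPart Set.univ i b}
  | some (.amp _ _) =>
      {K.argumentPart (K.choosers i false) i false, K.argumentPart (K.choosers i true) i true}
  | some (.lit _) => ∅
  | none => ∅

/-- A single link on a sequent `P, P̄`. -/
def IsAxiom [Literals 𝒜] (K : Prelinking.{u} Γ) : Prop :=
  (∃ P : 𝒜, Γ = [.lit P, .lit (Literals.dual P)]) ∧ (∃! _l : K.Link, True) ∧ ∀ l x, K.rel l x

end Prelinking

/-- A cluster is a set of slicings (each on its own sequent) or the error symbol. The erasure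
relation makes sense without the slicing conditions, so they are not imposed here; they hold in
every set that is reached from a slicing. -/
inductive Cluster (𝒜 : Type v) where
  | set (X : Set ((Γ : Sequent 𝒜) × Prelinking.{u} Γ))
  | error

/-- The erasure rewrite on clusters. -/
inductive Erasure {𝒜 : Type v} [Literals 𝒜] : Cluster.{u} 𝒜 → Cluster.{u} 𝒜 → Prop where
  | error (Y : Set ((Γ : Sequent 𝒜) × Prelinking.{u} Γ)) (h : ∃ T ∈ Y, ¬ T.2.Connected) :
      Erasure (.set Y) .error
  | root (X : Set ((Γ : Sequent 𝒜) × Prelinking.{u} Γ)) (T : (Γ : Sequent 𝒜) × Prelinking.{u} Γ)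
      (i : ℕ) (hT : T ∉ X) (hX : ∀ U ∈ X, U.2.Connected) (hr : T.2.Ready i) :
      Erasure (.set (X ∪ {T})) (.set (X ∪ T.2.erase i))
  | ax (X : Set ((Γ : Sequent 𝒜) × Prelinking.{u} Γ)) (T : (Γ : Sequent 𝒜) × Prelinking.{u} Γ)
      (hT : T ∉ X) (hX : ∀ U ∈ X, U.2.Connected) (hA : T.2.IsAxiom) :
      Erasure (.set (X ∪ {T})) (.set X)

/-- `K` is erasable if `{K}` rewrites to the empty cluster. -/
def Linking.Erasable {𝒜 : Type v} [Literals 𝒜] {Γ : Sequent 𝒜} (K : Linking.{u} Γ) : Prop :=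
  Relation.ReflTransGen Erasure (Cluster.set {⟨Γ, K.toPrelinking⟩}) (Cluster.set ∅)

/-- A conflict net is an erasable slicing. -/
def Linking.IsConflictNet {𝒜 : Type v} [Literals 𝒜] {Γ : Sequent 𝒜} (K : Linking.{u} Γ) :
    Prop :=
  K.IsSlicing ∧ K.Erasable

end MALL

/-! Proofs and erasure sequences are compared through one description of a single rule, independent
of the order of formulas and of the names of links. `Part K M f e` presents `K` as the piece of `M`
on certain links and certain disjoint subformula occurrences. `IsUnary`, `IsSum` and `IsProd` say
that `M` is assembled from one or two such parts as in a rule ⅋ or ⊕, in a rule &, and in a rule ⊗,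
at the `i`-th formula. These relations are stable under reordering of formulas (`IsPerm`). A part is
determined up to `IsPerm` by its links and occurrences (`Part.isPerm`), and the whole by its parts
and the coherence between them (`iso_of_parts`).

Erasable implies sequentializable. Erasing a ready root exhibits the prelinking as assembled from
the results of the erasure: `isUnary_restrict`, `isSum_argumentPart` and, since deleting a root on
no cycle separates its two arguments, `isProd_componentPart`. Whatever is assembled from
translations of proofs is itself a translation: permute, apply the rule, permute back
(`IsUnary.seq_par`, `IsUnary.seq_plus`, `IsSum.seq`, `IsProd.seq`). Hence the property that all
members of a cluster are translations passes backwards along each erasure step, starting from the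
empty cluster, where it is vacuous.

Sequentializable implies conflict net. By induction on the proof, a translation is a connected
slicing (`Proof.sound`). The induction carries one more invariant, totality: each link, or one
coherent with it, has a leaf in any given formula. Totality is what prevents a larger map from
relating a link to the argument that its premise of & or ⊕ lacks. For ⊗, a link of one premise is
coherent with all links of the other, and a leaf of the other premise compatible with all of those
would contradict the maximality of that premise.

The root of the last rule is then ready, and erasing it returns the premises up to `IsPerm`. For &,
a piece never leaves its premise and, by totality, touches the argument belonging to it. For ⊗, no
conflict edge joins the two premises, so they are exactly the components left when the root is
deleted (`IsProd.inComponent_iff`). Since premises are connected, they can be erased in turn, in any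
context of connected prelinkings, until nothing remains (`Proof.vanishes`). -/

namespace MALL

universe u v w u' w'

/-! ### Embeddings of sequents and parts of prelinkings -/

section

variable {𝒜 : Type v}

/-! ### Addresses -/

/-- The extension to all addresses of a map `f` that sends the roots of a sequent to vertices of
another sequent. -/
def shift (f : ℕ → Pos) (x : Pos) : Pos := ((f x.1).1, (f x.1).2 ++ x.2)

theorem shift_shift (f g : ℕ → Pos) (x : Pos) :
    shift g (shift f x) = shift (fun k => shift g (f k)) x := by
  simp [shift]

theorem shift_nil (f : ℕ → Pos) (k : ℕ) : shift f (k, []) = f k := by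
  simp [shift]

theorem shift_congr {f g : ℕ → Pos} {x : Pos} (h : f x.1 = g x.1) : shift f x = shift g x := by
  simp [shift, h]

theorem Formula.subAt_nil (A : Formula 𝒜) : A.subAt [] = some A := by
  cases A <;> rfl

theorem Formula.subAt_append (A : Formula 𝒜) (s p : List Bool) :
    A.subAt (s ++ p) = (A.subAt s).bind fun B => B.subAt p := by
  induction s generalizing A with
  | nil => simp [Formula.subAt_nil]
  | cons b s ih => cases A <;> simp [Formula.subAt, ih]

theorem subAt_append (Γ : Sequent 𝒜) (i : ℕ) (s p : List Bool) :
    subAt Γ (i, s ++ p) = (subAt Γ (i, s)).bind fun B => B.subAt p := by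
  simp only [subAt]
  cases Γ[i]? <;> simp [Formula.subAt_append]

theorem subAt_root (Γ : Sequent 𝒜) (i : ℕ) : subAt Γ (i, []) = Γ[i]? := by
  simp only [subAt]
  cases Γ[i]? <;> simp [Formula.subAt_nil]

theorem lt_of_subAt {Γ : Sequent 𝒜} {x : Pos} {A : Formula 𝒜} (h : subAt Γ x = some A) :
    x.1 < Γ.length := by
  by_contra hx
  simp [subAt, List.getElem?_eq_none (not_lt.1 hx)] at h

theorem Leaf.lt {Γ : Sequent 𝒜} (x : Leaf Γ) : x.1.1 < Γ.length :=
  let ⟨_, h⟩ := x.2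
  lt_of_subAt h

theorem Vertex.lt {Γ : Sequent 𝒜} (x : Vertex Γ) : x.1.1 < Γ.length :=
  let ⟨_, h⟩ := x.2
  lt_of_subAt h

/-- `f` identifies the formulas of `Γ'` with pairwise disjoint subformula occurrences of `Γ`. -/
structure IsEmb (Γ' Γ : Sequent 𝒜) (f : ℕ → Pos) : Prop where
  sub : ∀ k, k < Γ'.length → subAt Γ (f k) = Γ'[k]?
  inj : ∀ x y : Pos, x.1 < Γ'.length → y.1 < Γ'.length → shift f x = shift f y → x = y

namespace IsEmb

variable {Γ Γ' Γ'' : Sequent 𝒜} {f g : ℕ → Pos}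

theorem subAt_shift (h : IsEmb Γ' Γ f) {x : Pos} (hx : x.1 < Γ'.length) :
    subAt Γ (shift f x) = subAt Γ' x := by
  rw [shift, subAt_append, h.sub _ hx, subAt]

theorem lt (h : IsEmb Γ' Γ f) {k : ℕ} (hk : k < Γ'.length) : (f k).1 < Γ.length :=
  lt_of_subAt (A := Γ'[k]) (by rw [h.sub k hk, List.getElem?_eq_getElem hk])

/-- The image of a leaf. -/
def leaf (h : IsEmb Γ' Γ f) (x : Leaf Γ') : Leaf Γ :=
  ⟨shift f x.1, by rw [h.subAt_shift x.lt]; exact x.2⟩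

/-- The image of a vertex. -/
def vertex (h : IsEmb Γ' Γ f) (x : Vertex Γ') : Vertex Γ :=
  ⟨shift f x.1, by rw [h.subAt_shift x.lt]; exact x.2⟩

theorem leaf_injective (h : IsEmb Γ' Γ f) : Function.Injective h.leaf := fun x y hxy =>
  Subtype.ext (h.inj _ _ x.lt y.lt (congrArg Subtype.val hxy))

theorem comp (h : IsEmb Γ' Γ f) (h' : IsEmb Γ'' Γ' g) :
    IsEmb Γ'' Γ (fun k => shift f (g k)) where
  sub k hk := by rw [h.subAt_shift (h'.lt hk), h'.sub k hk]
  inj x y hx hy hxy := by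
    rw [← shift_shift, ← shift_shift] at hxy
    exact h'.inj _ _ hx hy (h.inj _ _ (h'.lt hx) (h'.lt hy) hxy)

/-- Injectivity holds because all addresses `f k` in one formula of `Γ` have paths of the same
length `c`, so that a concatenated path can be cut in only one way. -/
theorem of_uniform (hs : ∀ k, k < Γ'.length → subAt Γ (f k) = Γ'[k]?)
    (hi : ∀ j k, j < Γ'.length → k < Γ'.length → f j = f k → j = k) (c : ℕ → ℕ)
    (hc : ∀ k, k < Γ'.length → (f k).2.length = c (f k).1) : IsEmb Γ' Γ f where
  sub := hs
  inj x y hx hy hxy := by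
    simp only [shift, Prod.mk.injEq] at hxy
    obtain ⟨h1, h2⟩ := hxy
    have := List.append_inj h2 (by rw [hc _ hx, hc _ hy, h1])
    exact Prod.ext (hi _ _ hx hy (Prod.ext h1 this.1)) this.2

theorem refl (Γ : Sequent 𝒜) : IsEmb Γ Γ (fun k => (k, [])) :=
  of_uniform (fun k _ => subAt_root Γ k) (by simp) (fun _ => 0) (by simp)

end IsEmb

/-! ### Parts of a prelinking -/

/-- `K` is the part of `M` on the links in the range of `e` and on the subformula occurrences in
the range of `f`, and no link in the range of `e` has a leaf elsewhere. -/
structure Part {Γ' Γ : Sequent 𝒜} (K : Prelinking.{u} Γ') (M : Prelinking.{w} Γ) (f : ℕ → Pos)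
    (e : K.Link → M.Link) : Prop extends IsEmb Γ' Γ f where
  link_inj : Function.Injective e
  adj : ∀ l l', M.space.Adj (e l) (e l') ↔ K.space.Adj l l'
  rel : ∀ l y, M.rel (e l) y ↔ ∃ x : Leaf Γ', y.1 = shift f x.1 ∧ K.rel l x

/-- `M` is `K` up to a renaming of links and a permutation of formulas. -/
structure IsPerm {Γ' Γ : Sequent 𝒜} (K : Prelinking.{u} Γ') (M : Prelinking.{w} Γ) (f : ℕ → Pos)
    (e : K.Link → M.Link) : Prop extends Part K M f e where
  surj : Function.Surjective e
  full : ∀ j, j < Γ.length → ∃ k, k < Γ'.length ∧ f k = (j, [])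

namespace Part

variable {Γ Γ' Γ'' : Sequent 𝒜} {K : Prelinking.{u} Γ''} {M : Prelinking.{w} Γ'}
  {N : Prelinking.{u'} Γ} {f g : ℕ → Pos} {e : K.Link → M.Link} {h : M.Link → N.Link}

theorem rel_leaf (p : Part K M f e) (l : K.Link) (x : Leaf Γ'') :
    M.rel (e l) (p.leaf x) ↔ K.rel l x := by
  rw [p.rel]
  constructor
  · rintro ⟨y, hy, hl⟩
    rwa [p.leaf_injective (Subtype.ext hy : p.leaf x = p.leaf y)]
  · exact fun hl => ⟨x, rfl, hl⟩

theorem comp (p : Part M N g h) (q : Part K M f e) :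
    Part K N (fun k => shift g (f k)) (h ∘ e) where
  toIsEmb := p.toIsEmb.comp q.toIsEmb
  link_inj := p.link_inj.comp q.link_inj
  adj l l' := by simp [p.adj, q.adj]
  rel l y := by
    simp only [Function.comp_apply]
    rw [p.rel]
    constructor
    · rintro ⟨x, hx, hl⟩
      obtain ⟨z, hz, hl⟩ := (q.rel _ _).1 hl
      exact ⟨z, by rw [hx, hz, shift_shift], hl⟩
    · rintro ⟨z, hz, hl⟩
      exact ⟨q.leaf z, by rw [hz, ← shift_shift]; rfl, (q.rel_leaf l z).2 hl⟩

/-- A part of `N` that lies inside of the part `M` of `N` is a part of `M`. -/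
theorem lift {f' : ℕ → Pos} {e' : K.Link → N.Link} (p : Part M N g h) (q : Part K N f' e')
    (hf : ∀ k, k < Γ''.length → (f k).1 < Γ'.length ∧ f' k = shift g (f k))
    (he : ∀ l, e' l = h (e l)) : Part K M f e := by
  have hsh : ∀ x : Pos, x.1 < Γ''.length → shift f' x = shift g (shift f x) := fun x hx => by
    rw [shift_shift]; exact shift_congr (hf _ hx).2
  refine ⟨⟨fun k hk => ?_, fun x y hx hy hxy => ?_⟩, fun a b hab => ?_, fun l l' => ?_,
    fun l y => ?_⟩
  · rw [← q.sub k hk, (hf k hk).2, p.subAt_shift (hf k hk).1]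
  · exact q.inj _ _ hx hy (by rw [hsh _ hx, hsh _ hy, hxy])
  · exact q.link_inj (by rw [he, he, hab])
  · rw [← q.adj, he, he, p.adj]
  · rw [← p.rel_leaf, ← he, q.rel]
    refine exists_congr fun x => and_congr_left fun _ => ?_
    rw [hsh _ x.lt]
    exact ⟨fun hy => p.inj _ _ y.lt (hf _ x.lt).1 hy, fun hy => by rw [← hy]; rfl⟩

theorem refl (M : Prelinking.{w} Γ) : Part M M (fun k => (k, [])) id where
  toIsEmb := IsEmb.refl Γ
  link_inj := Function.injective_id
  adj _ _ := Iff.rfl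
  rel l y := ⟨fun h => ⟨y, by simp [shift], h⟩, by
    rintro ⟨x, hx, hl⟩
    have : y = x := Subtype.ext (by simpa [shift] using hx)
    rwa [this]⟩

end Part

section

variable {Γ Γ₀ Γ₁ : Sequent 𝒜} {K₀ : Prelinking.{u} Γ₀} {K₁ : Prelinking.{u'} Γ₁}
  {M : Prelinking.{w} Γ} {f₀ f₁ : ℕ → Pos} {e₀ : K₀.Link → M.Link} {e₁ : K₁.Link → M.Link}

/-- Two parts of `M` on the same links and the same occurrences agree up to permutation. -/
theorem Part.isPerm (p : Part K₀ M f₀ e₀) (q : Part K₁ M f₁ e₁)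
    (hf : ∀ v, (∃ k, k < Γ₀.length ∧ f₀ k = v) ↔ ∃ k, k < Γ₁.length ∧ f₁ k = v)
    (he : ∀ m, (∃ l, e₀ l = m) ↔ ∃ l, e₁ l = m) :
    ∃ g h, IsPerm K₀ K₁ g h ∧ ∀ k, k < Γ₀.length → f₁ (g k).1 = f₀ k := by
  have h1 : ∀ k, ∃ k', k < Γ₀.length → k' < Γ₁.length ∧ f₁ k' = f₀ k := fun k => by
    by_cases hk : k < Γ₀.length
    · obtain ⟨k', h⟩ := (hf (f₀ k)).1 ⟨k, hk, rfl⟩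
      exact ⟨k', fun _ => h⟩
    · exact ⟨0, fun h => absurd h hk⟩
  choose g hg using h1
  have h2 : ∀ l, ∃ l', e₁ l' = e₀ l := fun l => (he _).1 ⟨l, rfl⟩
  choose h hh using h2
  refine ⟨fun k => (g k, []), h, ⟨q.lift p (fun k hk => ⟨(hg k hk).1, ?_⟩) fun l => (hh l).symm,
    fun m => ?_, fun j hj => ?_⟩, fun k hk => (hg k hk).2⟩
  · rw [shift_nil, (hg k hk).2]
  · obtain ⟨l, hl⟩ := (he (e₁ m)).2 ⟨m, rfl⟩
    exact ⟨l, q.link_inj (by rw [hh, hl])⟩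
  · obtain ⟨k, hk, hkj⟩ := (hf (f₁ j)).2 ⟨j, hj, rfl⟩
    refine ⟨k, hk, q.inj _ _ (hg k hk).1 hj ?_⟩
    rw [shift_nil, shift_nil, (hg k hk).2, hkj]

end

namespace IsPerm

variable {Γ Γ' Γ'' : Sequent 𝒜} {K : Prelinking.{u} Γ''} {M : Prelinking.{w} Γ'}
  {N : Prelinking.{u'} Γ} {f g : ℕ → Pos} {e : K.Link → M.Link} {h : M.Link → N.Link}

/-- The root above `f k` is also an image `f k'`, so the address of `f k` is reached both from `k`
and from below `k'`; injectivity leaves only the empty path. -/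
theorem root (p : IsPerm K M f e) {k : ℕ} (hk : k < Γ''.length) : f k = ((f k).1, []) := by
  obtain ⟨k', hk', h'⟩ := p.full _ (p.lt hk)
  have := p.inj (k', (f k).2) (k, []) hk' hk (by simp [shift, h'])
  rw [Prod.mk.injEq] at this
  exact Prod.ext rfl this.2

theorem comp (p : IsPerm M N g h) (q : IsPerm K M f e) :
    IsPerm K N (fun k => shift g (f k)) (h ∘ e) where
  toPart := p.toPart.comp q.toPart
  surj := p.surj.comp q.surj
  full j hj := by
    obtain ⟨k, hk, h1⟩ := p.full j hj
    obtain ⟨k', hk', h2⟩ := q.full k hk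
    exact ⟨k', hk', by rw [h2, shift_nil, h1]⟩

theorem symm (p : IsPerm K M f e) :
    ∃ g h, IsPerm M K g h ∧ ∀ j, j < Γ'.length → f (g j).1 = (j, []) := by
  refine (Part.refl M).isPerm p.toPart (fun v => ?_) fun m => ?_
  · constructor
    · rintro ⟨k, hk, rfl⟩
      exact p.full k hk
    · rintro ⟨k, hk, rfl⟩
      exact ⟨_, p.lt hk, (p.root hk).symm⟩
  · simp [p.surj m]

theorem of_iso {K : Prelinking.{u} Γ} {M : Prelinking.{w} Γ} (h : K.Iso M) :
    ∃ e, IsPerm K M (fun k => (k, [])) e := by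
  obtain ⟨e, h1, h2⟩ := h
  refine ⟨e, ⟨⟨IsEmb.refl Γ, e.injective, h1, fun l y => ?_⟩, e.surjective,
    fun j hj => ⟨j, hj, rfl⟩⟩⟩
  rw [h2]
  refine ⟨fun h => ⟨y, by simp [shift], h⟩, ?_⟩
  rintro ⟨x, hx, hl⟩
  have : y = x := Subtype.ext (by simpa [shift] using hx)
  rwa [this]

end IsPerm

/-! ### Lists of addresses -/

/-- The address map that is given by a list. -/
def addr (vs : List Pos) (k : ℕ) : Pos := vs.getD k (0, [])

theorem addr_eq {vs : List Pos} {k : ℕ} (h : k < vs.length) : addr vs k = vs[k] := by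
  simp [addr, h]

theorem at_iff {vs : List Pos} {x y : Pos} :
    At vs x y ↔ x.1 < vs.length ∧ y = shift (addr vs) x := by
  constructor
  · rintro ⟨v, hv, rfl⟩
    obtain ⟨h, rfl⟩ := List.getElem?_eq_some_iff.1 hv
    exact ⟨h, by simp [shift, addr_eq h]⟩
  · rintro ⟨h, rfl⟩
    exact ⟨vs[x.1], List.getElem?_eq_getElem h, by simp [shift, addr_eq h]⟩

theorem exists_addr {vs : List Pos} {n : ℕ} (h : n = vs.length) (v : Pos) :
    (∃ k, k < n ∧ addr vs k = v) ↔ v ∈ vs := by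
  subst h
  rw [List.mem_iff_getElem]
  exact ⟨fun ⟨k, hk, h⟩ => ⟨k, hk, by rw [← h, addr_eq hk]⟩,
    fun ⟨k, hk, h⟩ => ⟨k, hk, by rw [← h, addr_eq hk]⟩⟩

theorem length_eq_of_map {Γ Γ' : Sequent 𝒜} {vs : List Pos}
    (hΓ : vs.map (subAt Γ) = Γ'.map some) : Γ'.length = vs.length := by
  simpa using (congrArg List.length hΓ).symm

theorem isEmb_addr {Γ Γ' : Sequent 𝒜} {vs : List Pos} (hΓ : vs.map (subAt Γ) = Γ'.map some)
    (hn : vs.Nodup) (c : ℕ → ℕ) (hc : ∀ v ∈ vs, v.2.length = c v.1) : IsEmb Γ' Γ (addr vs) := by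
  have hlen := length_eq_of_map hΓ
  refine IsEmb.of_uniform (fun k hk => ?_) (fun j k hj hk hjk => ?_) c fun k hk => ?_
  · have := congrArg (fun L => L[k]?) hΓ
    rw [addr_eq (hlen ▸ hk)]
    simpa [hk, hlen ▸ hk] using this
  · rw [addr_eq (hlen ▸ hj), addr_eq (hlen ▸ hk)] at hjk
    exact (hn.getElem_inj_iff).1 hjk
  · rw [addr_eq (hlen ▸ hk)]
    exact hc _ (List.getElem_mem _)

theorem map_subAt_filterMap {Γ : Sequent 𝒜} {vs : List Pos}
    (h : ∀ v ∈ vs, ∃ A, subAt Γ v = some A) :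
    vs.map (subAt Γ) = (vs.filterMap (subAt Γ)).map some := by
  induction vs with
  | nil => rfl
  | cons v vs ih =>
    obtain ⟨A, hA⟩ := h v (by simp)
    simp [hA, ih fun w hw => h w (by simp [hw])]

/-- The restriction of a prelinking to a set of links and to a sequent whose formulas are the
subformula occurrences at given addresses. -/
def Prelinking.pull {Γ : Sequent 𝒜} (M : Prelinking.{u} Γ) (S : Set M.Link) (Δ : Sequent 𝒜)
    (vs : List Pos) : Prelinking.{u} Δ where
  Link := S
  finite := have := M.finite; inferInstance
  space := M.space.induce S
  rel l x := ∃ y : Leaf Γ, At vs x.1 y.1 ∧ M.rel l.1 y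

theorem Part.pull {Γ : Sequent 𝒜} (M : Prelinking.{u} Γ) (S : Set M.Link) {Δ : Sequent 𝒜}
    {vs : List Pos} (hΔ : vs.map (subAt Γ) = Δ.map some)
    (hn : vs.Nodup) (c : ℕ → ℕ) (hc : ∀ v ∈ vs, v.2.length = c v.1)
    (hS : ∀ l ∈ S, ∀ y, M.rel l y → ∃ v ∈ vs, ∃ p, y.1 = (v.1, v.2 ++ p)) :
    Part (M.pull S Δ vs) M (addr vs) Subtype.val where
  toIsEmb := isEmb_addr hΔ hn c hc
  link_inj := Subtype.val_injective
  adj _ _ := Iff.rfl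
  rel l y := by
    have hlen := length_eq_of_map hΔ
    have he := isEmb_addr hΔ hn c hc
    constructor
    · intro hl
      obtain ⟨v, hv, p, hy⟩ := hS _ l.2 y hl
      obtain ⟨k, hk, rfl⟩ := (exists_addr hlen v).2 hv
      have hy' : y.1 = shift (addr vs) (k, p) := hy
      refine ⟨⟨(k, p), ?_⟩, hy, y, at_iff.2 ⟨hlen ▸ hk, hy⟩, hl⟩
      rw [← he.subAt_shift (x := (k, p)) hk, ← hy']
      exact y.2
    · rintro ⟨x, hx, y', hy', hl⟩
      have : y = y' := Subtype.ext (hx.trans (at_iff.1 hy').2.symm)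
      rwa [this]

/-- The part of the conclusion of a proof rule that is given by a premise. -/
theorem Part.push {Γ Γ' : Sequent 𝒜} {K : Prelinking.{u} Γ'} {M : Prelinking.{w} Γ}
    {vs : List Pos} {e : K.Link → M.Link} (hΓ : vs.map (subAt Γ) = Γ'.map some)
    (hn : vs.Nodup) (c : ℕ → ℕ) (hc : ∀ v ∈ vs, v.2.length = c v.1)
    (he : Function.Injective e) (ha : ∀ l l', M.space.Adj (e l) (e l') ↔ K.space.Adj l l')
    (hr : ∀ l y, M.rel (e l) y ↔ MALL.push Γ vs K.rel l y) : Part K M (addr vs) e where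
  toIsEmb := isEmb_addr hΓ hn c hc
  link_inj := he
  adj := ha
  rel l y := by
    rw [hr]
    refine exists_congr fun x => and_congr_left fun _ => ?_
    rw [at_iff]
    exact and_iff_right (length_eq_of_map hΓ ▸ x.lt)

end

/-! ### Each rule as a relation between its conclusion and its premises -/

section

variable {𝒜 : Type v}

/-! ### Proof rules on prelinkings -/

/-- The roots of a sequent, with the `i`-th one replaced by those of its arguments that are in
`B`. -/
def front (Γ : Sequent 𝒜) (i : ℕ) (B : Bool → Prop) (v : Pos) : Prop :=
  (v.1 < Γ.length ∧ v.1 ≠ i ∧ v.2 = []) ∨ ∃ b, B b ∧ v = (i, [b])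

/-- The `i`-th formula of `Γ` is compound, with arguments `A` and `B`. -/
def HasArgs (Γ : Sequent 𝒜) (i : ℕ) (A B : Formula 𝒜) : Prop :=
  Γ[i]? = some (.tensor A B) ∨ Γ[i]? = some (.par A B) ∨ Γ[i]? = some (.amp A B) ∨
    Γ[i]? = some (.plus A B)

namespace HasArgs

variable {Γ : Sequent 𝒜} {i : ℕ} {A B : Formula 𝒜}

theorem lt (h : HasArgs Γ i A B) : i < Γ.length := by
  by_contra hi
  simp [HasArgs, List.getElem?_eq_none (not_lt.1 hi)] at h

theorem subAt_cons (h : HasArgs Γ i A B) (b : Bool) (p : List Bool) :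
    subAt Γ (i, b :: p) = (pick A B b).subAt p := by
  rcases h with h | h | h | h <;> simp [subAt, h, Formula.subAt]

theorem subAt_arg (h : HasArgs Γ i A B) (b : Bool) : subAt Γ (i, [b]) = some (pick A B b) := by
  rw [h.subAt_cons, Formula.subAt_nil]

theorem exists_front (h : HasArgs Γ i A B) (y : Leaf Γ) :
    (y.1.1 ≠ i ∧ front Γ i (fun _ => False) (y.1.1, [])) ∨ ∃ b p, y.1 = (i, b :: p) := by
  obtain ⟨⟨j, p⟩, a, hy⟩ := y
  by_cases hj : j = i
  · right
    subst hj
    cases p with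
    | nil =>
      rw [subAt_root] at hy
      rcases h with h | h | h | h <;> simp [h] at hy
    | cons b p => exact ⟨b, p, rfl⟩
  · exact .inl ⟨hj, .inl ⟨(lt_of_subAt hy : j < _), hj, rfl⟩⟩

theorem front_subAt (h : HasArgs Γ i A B) {S : Bool → Prop} {v : Pos} (hv : front Γ i S v) :
    ∃ C, subAt Γ v = some C := by
  obtain ⟨hv, _, h2⟩ | ⟨b, -, rfl⟩ := hv
  · obtain ⟨j, p⟩ := v
    subst h2
    exact ⟨_, by rw [subAt_root, List.getElem?_eq_getElem hv]⟩
  · exact ⟨_, h.subAt_arg b⟩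

end HasArgs

theorem front_length {Γ : Sequent 𝒜} {i : ℕ} {S : Bool → Prop} {v : Pos} (hv : front Γ i S v) :
    v.2.length = if v.1 = i then 1 else 0 := by
  obtain ⟨_, h1, h2⟩ | ⟨b, -, rfl⟩ := hv
  · simp [h1, h2]
  · simp

theorem front_mono {Γ : Sequent 𝒜} {i : ℕ} {S T : Bool → Prop} {v : Pos} (hv : front Γ i S v)
    (h : ∀ b, S b → T b) : front Γ i T v :=
  hv.imp_right fun ⟨b, hb, hv⟩ => ⟨b, h b hb, hv⟩

/-- `K` is the part of `M` on all links and on the arguments of the `i`-th formula that are in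
`B`. -/
structure IsUnary {Γ' Γ : Sequent 𝒜} (K : Prelinking.{u} Γ') (M : Prelinking.{w} Γ) (i : ℕ)
    (B : Bool → Prop) (f : ℕ → Pos) (e : K.Link → M.Link) : Prop extends Part K M f e where
  surj : ∀ m, ∃ l, e l = m
  image : ∀ v, (∃ k, k < Γ'.length ∧ f k = v) ↔ front Γ i B v

/-- `M` is the union of its parts `K b` on the arguments `b` of the `i`-th formula, with conflict
between links of different parts. -/
structure IsSum {Γ' : Bool → Sequent 𝒜} {Γ : Sequent 𝒜} (K : ∀ b, Prelinking.{u} (Γ' b))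
    (M : Prelinking.{w} Γ) (i : ℕ) (f : Bool → ℕ → Pos) (e : ∀ b, (K b).Link → M.Link) :
    Prop where
  part : ∀ b, Part (K b) M (f b) (e b)
  cover : ∀ m, ∃ b l, e b l = m
  sep : ∀ b l l', e b l ≠ e (!b) l'
  cross : ∀ b l l', ¬ M.space.Adj (e b l) (e (!b) l')
  image : ∀ b v, (∃ k, k < (Γ' b).length ∧ f b k = v) ↔ front Γ i (fun c => c = b) v

/-- `M` is the union of its parts `K b`, with strict coherence between links of different parts,
and the parts split the sequent upon replacement of the `i`-th formula by its arguments. -/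
structure IsProd {Γ' : Bool → Sequent 𝒜} {Γ : Sequent 𝒜} (K : ∀ b, Prelinking.{u} (Γ' b))
    (M : Prelinking.{w} Γ) (i : ℕ) (f : Bool → ℕ → Pos) (e : ∀ b, (K b).Link → M.Link) :
    Prop where
  part : ∀ b, Part (K b) M (f b) (e b)
  cover : ∀ m, ∃ b l, e b l = m
  cross : ∀ b l l', M.space.Adj (e b l) (e (!b) l')
  image : ∀ v, (∃ b k, k < (Γ' b).length ∧ f b k = v) ↔ front Γ i (fun _ => True) v
  disj : ∀ b j k, j < (Γ' b).length → k < (Γ' !b).length → f b j ≠ f (!b) k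
  arg : ∀ b, ∃ k, k < (Γ' b).length ∧ f b k = (i, [b])

theorem IsProd.sep {Γ' : Bool → Sequent 𝒜} {Γ : Sequent 𝒜} {K : ∀ b, Prelinking.{u} (Γ' b)}
    {M : Prelinking.{w} Γ} {i : ℕ} {f : Bool → ℕ → Pos} {e : ∀ b, (K b).Link → M.Link}
    (r : IsProd K M i f e) (b : Bool) (l l') : e b l ≠ e (!b) l' := (r.cross b l l').ne

namespace IsPerm

variable {Γ Δ : Sequent 𝒜} {M : Prelinking.{w} Γ} {N : Prelinking.{w'} Δ} {g : ℕ → Pos}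
  {h : M.Link → N.Link}

theorem getElem? (p : IsPerm M N g h) {i : ℕ} (hi : i < Γ.length) : Δ[(g i).1]? = Γ[i]? := by
  rw [← p.sub i hi, p.root hi, subAt_root]

theorem front_iff (p : IsPerm M N g h) {i : ℕ} (hi : i < Γ.length) (B : Bool → Prop) (v : Pos) :
    front Δ (g i).1 B v ↔ ∃ w, front Γ i B w ∧ shift g w = v := by
  constructor
  · rintro (⟨h1, h2, h3⟩ | ⟨b, hb, rfl⟩)
    · obtain ⟨j, s⟩ := v
      obtain ⟨k, hk, hkj⟩ := p.full j h1
      refine ⟨(k, []), .inl ⟨hk, ?_, rfl⟩, ?_⟩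
      · rintro rfl
        simp [hkj] at h2
      · simp only at h3
        rw [shift_nil, hkj, h3]
    · exact ⟨(i, [b]), .inr ⟨b, hb, rfl⟩, by rw [shift, p.root hi]; rfl⟩
  · rintro ⟨⟨j, s⟩, ⟨h1, h2, h3⟩ | ⟨b, hb, hw⟩, rfl⟩
    · simp only at h1 h2 h3
      subst h3
      rw [shift_nil]
      refine .inl ⟨p.lt h1, fun h => h2 ?_, by rw [p.root h1]⟩
      have := p.inj (j, []) (i, []) h1 hi (by
        rw [shift_nil, shift_nil, p.root h1, p.root hi, h])
      exact congrArg Prod.fst this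
    · rw [hw]
      exact .inr ⟨b, hb, by rw [shift, p.root hi]; rfl⟩

theorem isUnary {Γ' : Sequent 𝒜} {K : Prelinking.{u} Γ'} {i : ℕ} {B : Bool → Prop}
    {f : ℕ → Pos} {e : K.Link → M.Link} (p : IsPerm M N g h) (hi : i < Γ.length)
    (r : IsUnary K M i B f e) : IsUnary K N (g i).1 B (fun k => shift g (f k)) (h ∘ e) where
  toPart := p.toPart.comp r.toPart
  surj := Function.Surjective.comp p.surj r.surj
  image v := by
    rw [p.front_iff hi]
    simp only [← r.image]
    grind

theorem isSum {Γ' : Bool → Sequent 𝒜} {K : ∀ b, Prelinking.{u} (Γ' b)} {i : ℕ}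
    {f : Bool → ℕ → Pos} {e : ∀ b, (K b).Link → M.Link} (p : IsPerm M N g h) (hi : i < Γ.length)
    (r : IsSum K M i f e) :
    IsSum K N (g i).1 (fun b k => shift g (f b k)) (fun b => h ∘ e b) where
  part b := p.toPart.comp (r.part b)
  cover m := by
    obtain ⟨m, rfl⟩ := p.surj m
    obtain ⟨b, l, rfl⟩ := r.cover m
    exact ⟨b, l, rfl⟩
  sep b l l' hl := r.sep b l l' (p.link_inj hl)
  cross b l l' := by simpa [p.adj] using r.cross b l l'
  image b v := by
    rw [p.front_iff hi]
    simp only [← r.image]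
    grind

theorem isProd {Γ' : Bool → Sequent 𝒜} {K : ∀ b, Prelinking.{u} (Γ' b)} {i : ℕ}
    {f : Bool → ℕ → Pos} {e : ∀ b, (K b).Link → M.Link} (p : IsPerm M N g h) (hi : i < Γ.length)
    (r : IsProd K M i f e) :
    IsProd K N (g i).1 (fun b k => shift g (f b k)) (fun b => h ∘ e b) where
  part b := p.toPart.comp (r.part b)
  cover m := by
    obtain ⟨m, rfl⟩ := p.surj m
    obtain ⟨b, l, rfl⟩ := r.cover m
    exact ⟨b, l, rfl⟩
  cross b l l' := by simpa [p.adj] using r.cross b l l'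
  image v := by
    rw [p.front_iff hi]
    simp only [← r.image]
    grind
  disj b j k hj hk hjk :=
    r.disj b j k hj hk (p.inj _ _ ((r.part b).lt hj) ((r.part (!b)).lt hk) hjk)
  arg b := by
    obtain ⟨k, hk, h⟩ := r.arg b
    exact ⟨k, hk, by rw [h, shift, p.root hi]; rfl⟩

end IsPerm

/-! ### Translations of proofs -/

theorem mem_roots {n : ℕ} {v : Pos} : v ∈ roots n ↔ v.1 < n ∧ v.2 = [] := by
  obtain ⟨j, p⟩ := v
  simp only [roots, List.mem_map, List.mem_range, Prod.mk.injEq]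
  grind

theorem nodup_roots (n : ℕ) : (roots n).Nodup :=
  List.nodup_range.map fun _ _ h => congrArg Prod.fst h

theorem length_roots (n : ℕ) : (roots n).length = n := by simp [roots]

theorem map_subAt_roots (Γ Δ : Sequent 𝒜) :
    (roots Γ.length).map (subAt (Γ ++ Δ)) = Γ.map some := by
  refine List.ext_getElem (by simp [roots]) fun k hk _ => ?_
  have hk : k < Γ.length := by simpa [roots] using hk
  simp [roots, subAt_root, List.getElem?_append_left hk]

theorem subAt_append_cons (Γ Δ : Sequent 𝒜) (C : Formula 𝒜) (p : List Bool) :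
    subAt (Γ ++ C :: Δ) (Γ.length, p) = C.subAt p := by
  simp [subAt]

theorem map_subAt_right (Γ Δ : Sequent 𝒜) (C : Formula 𝒜) :
    ((List.range Δ.length).map fun k => (Γ.length + 1 + k, [])).map (subAt (Γ ++ C :: Δ)) =
      Δ.map some := by
  refine List.ext_getElem (by simp) fun k hk _ => ?_
  have hk : k < Δ.length := by simpa using hk
  simp [subAt_root, hk, add_assoc, add_comm 1 k]

namespace Proof

/-- The premises of a tensor rule. -/
abbrev tensorPremise (Γ Δ : Sequent 𝒜) (A B : Formula 𝒜) : Bool → Sequent 𝒜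
  | false => Γ ++ [A]
  | true => B :: Δ

/-- The addresses of the formulas of the premises of a tensor rule in its conclusion. -/
abbrev tensorAddr (Γ Δ : Sequent 𝒜) : Bool → List Pos
  | false => roots Γ.length ++ [(Γ.length, [false])]
  | true => (Γ.length, [true]) :: (List.range Δ.length).map fun k => (Γ.length + 1 + k, [])

theorem length_tensorAddr {Γ Δ : Sequent 𝒜} {A B : Formula 𝒜} (b : Bool) :
    (tensorPremise Γ Δ A B b).length = (tensorAddr Γ Δ b).length := by
  cases b <;> simp [length_roots]

theorem map_subAt_tensorAddr {Γ Δ : Sequent 𝒜} {A B : Formula 𝒜} (b : Bool) :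
    (tensorAddr Γ Δ b).map (subAt (Γ ++ .tensor A B :: Δ)) =
      (tensorPremise Γ Δ A B b).map some := by
  cases b
  · simp [map_subAt_roots, subAt_append_cons, Formula.subAt, pick]
  · rw [List.map_cons, map_subAt_right]
    simp [subAt_append_cons, Formula.subAt, pick]

theorem nodup_tensorAddr {Γ Δ : Sequent 𝒜} (b : Bool) : (tensorAddr Γ Δ b).Nodup := by
  cases b
  · rw [List.nodup_append]
    simp [nodup_roots, mem_roots]
  · rw [List.nodup_cons]
    refine ⟨by simp, List.nodup_range.map fun _ _ h => ?_⟩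
    simpa using h

theorem uniform_tensorAddr {Γ Δ : Sequent 𝒜} (b : Bool) :
    ∀ v ∈ tensorAddr Γ Δ b, v.2.length = if v.1 = Γ.length then 1 else 0 := by
  cases b
  · simp only [List.mem_append, mem_roots]
    grind
  · simp
    grind

variable [Literals 𝒜] {Γ Δ : Sequent 𝒜} {A B : Formula 𝒜}

theorem isUnary_par (π : Proof (Γ ++ [A, B])) :
    IsUnary π.translation (Proof.par π).translation Γ.length (fun _ => True)
      (addr (roots Γ.length ++ [(Γ.length, [false]), (Γ.length, [true])])) id where
  toPart := by
    -- The function gives the path length of the premise formulas: one step down inside the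
    -- principal formula, at index `Γ.length`, and none elsewhere.
    refine Part.push ?_ ?_ (fun j => if j = Γ.length then 1 else 0) ?_ Function.injective_id
      (fun _ _ => Iff.rfl) fun _ _ => Iff.rfl
    · simp [map_subAt_roots, subAt_append_cons, Formula.subAt, pick]
    · rw [List.nodup_append]
      simp [nodup_roots, mem_roots]
    · simp only [List.mem_append, mem_roots]
      grind
  surj m := ⟨m, rfl⟩
  image v := by
    rw [exists_addr (by simp [length_roots])]
    simp only [front, List.mem_append, mem_roots]
    simp
    grind

theorem isUnary_plus (b : Bool) (π : Proof (Γ ++ [pick A B b])) :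
    IsUnary π.translation (Proof.plus b π).translation Γ.length (fun c => c = b)
      (addr (roots Γ.length ++ [(Γ.length, [b])])) id where
  toPart := by
    refine Part.push ?_ ?_ (fun j => if j = Γ.length then 1 else 0) ?_ Function.injective_id
      (fun _ _ => Iff.rfl) fun _ _ => Iff.rfl
    · simp [map_subAt_roots, subAt_append_cons, Formula.subAt]
    · rw [List.nodup_append]
      simp [nodup_roots, mem_roots]
    · simp only [List.mem_append, mem_roots]
      grind
  surj m := ⟨m, rfl⟩
  image v := by
    rw [exists_addr (by simp [length_roots])]
    simp only [front, List.mem_append, mem_roots]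
    simp
    grind

theorem isSum_amp (π : ∀ b, Proof (Γ ++ [pick A B b])) :
    IsSum (fun b => (π b).translation) (Proof.amp (A := A) (B := B) (π false) (π true)).translation Γ.length
      (fun b => addr (roots Γ.length ++ [(Γ.length, [b])]))
      (fun | false => Sum.inl | true => Sum.inr) where
  part b := by
    refine Part.push ?_ ?_ (fun j => if j = Γ.length then 1 else 0) ?_ ?_ ?_ ?_
    · simp [map_subAt_roots, subAt_append_cons, Formula.subAt]
    · rw [List.nodup_append]
      simp [nodup_roots, mem_roots]
    · simp only [List.mem_append, mem_roots]
      grind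
    · cases b
      · exact Sum.inl_injective
      · exact Sum.inr_injective
    · cases b <;> exact fun _ _ => Iff.rfl
    · cases b <;> exact fun _ _ => Iff.rfl
  cover := by
    rintro (l | l)
    · exact ⟨false, l, rfl⟩
    · exact ⟨true, l, rfl⟩
  sep b l l' := by cases b <;> exact nofun
  cross b l l' := by
    cases b
    · change ¬ (cohSum _ _).Adj (Sum.inl l) (Sum.inr l')
      exact nofun
    · change ¬ (cohSum _ _).Adj (Sum.inr l) (Sum.inl l')
      exact nofun
  image b v := by
    rw [exists_addr (by simp [length_roots])]
    simp only [front, List.mem_append, mem_roots]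
    simp
    grind

theorem isProd_tensor (π : ∀ b, Proof (tensorPremise Γ Δ A B b)) :
    IsProd (fun b => (π b).translation) (Proof.tensor (Γ := Γ) (Δ := Δ) (A := A) (B := B) (π false) (π true)).translation Γ.length
      (fun b => addr (tensorAddr Γ Δ b))
      (fun | false => Sum.inl | true => Sum.inr) where
  part b := by
    refine Part.push ?_ ?_ (fun j => if j = Γ.length then 1 else 0) ?_ ?_ ?_ ?_
    · exact map_subAt_tensorAddr b
    · exact nodup_tensorAddr b
    · exact uniform_tensorAddr b
    · cases b
      · exact Sum.inl_injective
      · exact Sum.inr_injective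
    · cases b <;> simp [Proof.translation, cohProd] <;>
      · intro l l'
        by_cases h : l = l' <;> simp [h]
    · cases b <;> exact fun _ _ => Iff.rfl
  cover := by
    rintro (l | l)
    · exact ⟨false, l, rfl⟩
    · exact ⟨true, l, rfl⟩
  cross b l l' := by
    cases b
    · change (cohProd _ _).Adj (Sum.inl l) (Sum.inr l')
      simp [cohProd]
    · change (cohProd _ _).Adj (Sum.inr l) (Sum.inl l')
      simp [cohProd]
  image v := by
    simp only [exists_addr (length_tensorAddr _)]
    simp only [front, Bool.exists_bool, List.mem_append, mem_roots]
    obtain ⟨j, p⟩ := v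
    simp
    constructor
    · rintro ((⟨h, rfl⟩ | ⟨rfl, rfl⟩) | ⟨rfl, rfl⟩ | ⟨k, h, rfl, rfl⟩)
      · exact .inl ⟨by omega, by omega, rfl⟩
      · simp
      · simp
      · exact .inl ⟨by omega, by omega, rfl⟩
    · rintro (⟨h, h', rfl⟩ | ⟨rfl, rfl⟩ | ⟨rfl, rfl⟩)
      · rcases lt_or_gt_of_ne h' with h1 | h1
        · simp [h1]
        -- The formulas of `Δ` start one place after the tensor, which has index `Γ.length`.
        · exact .inr (.inr ⟨j - (Γ.length + 1), by omega, by omega, rfl⟩)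
      · simp
      · simp
  disj b j k hj hk h := by
    have h1 := (exists_addr (length_tensorAddr (Δ := Δ) (A := A) (B := B) b) _).1 ⟨j, hj, rfl⟩
    have h2 := (exists_addr (length_tensorAddr (Δ := Δ) (A := A) (B := B) !b) _).1 ⟨k, hk, h.symm⟩
    revert h1 h2
    generalize addr (tensorAddr Γ Δ b) j = v
    obtain ⟨j, p⟩ := v
    cases b <;> simp [mem_roots] <;> grind
  arg b := by
    rw [exists_addr (length_tensorAddr b)]
    cases b <;> simp

theorem isPerm_perm (σ : Equiv.Perm (Fin Γ.length)) (π : Proof Γ) :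
    IsPerm π.translation (Proof.perm σ π).translation
      (addr (List.ofFn fun k : Fin Γ.length => ((σ.symm k : ℕ), []))) id where
  toPart := by
    refine Part.push ?_ ?_ (fun _ => 0) ?_ Function.injective_id
      (fun _ _ => Iff.rfl) fun _ _ => Iff.rfl
    · refine List.ext_getElem (by simp) fun k hk _ => ?_
      simp [subAt_root, permute]
    · rw [List.nodup_ofFn]
      intro j k h
      simpa [Fin.val_inj] using h
    · simp [List.mem_ofFn]
  surj m := ⟨m, rfl⟩
  full j hj := by
    rw [exists_addr (by simp)]
    have hj : j < Γ.length := by simpa [permute] using hj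
    rw [List.mem_ofFn]
    exact ⟨σ ⟨j, hj⟩, by simp⟩

end Proof

/-! ### Sequentializable prelinkings -/

/-- `K` is the translation of a proof, up to renaming of links. -/
def Prelinking.Seq [Literals 𝒜] {Γ : Sequent 𝒜} (K : Prelinking.{u} Γ) : Prop :=
  ∃ π : Proof Γ, K.Iso π.translation

theorem sigma_injective {ι : Type*} {X : ι → Type*} {Y : Type*} (φ : ∀ b, X b → Y)
    (h1 : ∀ b, Function.Injective (φ b)) (h2 : ∀ b c l l', b ≠ c → φ b l ≠ φ c l') :
    Function.Injective fun s : Σ b, X b => φ s.1 s.2 := by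
  rintro ⟨b, l⟩ ⟨c, l'⟩ h
  by_cases hbc : b = c
  · subst hbc
    exact congrArg _ (h1 b h)
  · exact absurd h (h2 b c l l' hbc)

/-- A prelinking is determined by its parts and by the coherence between them. -/
theorem iso_of_parts {ι : Type*} {Γ' : ι → Sequent 𝒜} {Γ : Sequent 𝒜}
    {K : ∀ b, Prelinking.{u} (Γ' b)} {M : Prelinking.{w} Γ} {N : Prelinking.{w'} Γ}
    {f f' : ι → ℕ → Pos} {e : ∀ b, (K b).Link → M.Link} {e' : ∀ b, (K b).Link → N.Link}
    (p : ∀ b, Part (K b) M (f b) (e b)) (q : ∀ b, Part (K b) N (f' b) (e' b))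
    (hf : ∀ b k, k < (Γ' b).length → f b k = f' b k)
    (hM : ∀ m, ∃ b l, e b l = m) (hN : ∀ m, ∃ b l, e' b l = m)
    (sM : ∀ b c l l', b ≠ c → e b l ≠ e c l') (sN : ∀ b c l l', b ≠ c → e' b l ≠ e' c l')
    (hc : ∀ b c l l', b ≠ c → (M.space.Adj (e b l) (e c l') ↔ N.space.Adj (e' b l) (e' c l'))) :
    M.Iso N := by
  let E := Equiv.ofBijective (fun s : Σ b, (K b).Link => e s.1 s.2)
    ⟨sigma_injective e (fun b => (p b).link_inj) sM, fun m => let ⟨b, l, h⟩ := hM m; ⟨⟨b, l⟩, h⟩⟩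
  let E' := Equiv.ofBijective (fun s : Σ b, (K b).Link => e' s.1 s.2)
    ⟨sigma_injective e' (fun b => (q b).link_inj) sN, fun m => let ⟨b, l, h⟩ := hN m; ⟨⟨b, l⟩, h⟩⟩
  have key : ∀ b l, (E.symm.trans E') (e b l) = e' b l := fun b l => by
    have : E.symm (e b l) = ⟨b, l⟩ := E.symm_apply_eq.2 rfl
    rw [Equiv.trans_apply, this]
    rfl
  refine ⟨E.symm.trans E', fun m m' => ?_, fun m y => ?_⟩
  · obtain ⟨b, l, rfl⟩ := hM m
    obtain ⟨c, l', rfl⟩ := hM m'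
    rw [key, key]
    by_cases hbc : b = c
    · subst hbc
      rw [(p b).adj, (q b).adj]
    · exact (hc b c l l' hbc).symm
  · obtain ⟨b, l, rfl⟩ := hM m
    rw [key, (p b).rel, (q b).rel]
    exact exists_congr fun x => and_congr_left fun _ => by rw [shift_congr (hf b _ x.lt)]

theorem iso_of_part {Γ' Γ : Sequent 𝒜} {K : Prelinking.{u} Γ'} {M : Prelinking.{w} Γ}
    {N : Prelinking.{w'} Γ} {f f' : ℕ → Pos} {e : K.Link → M.Link} {e' : K.Link → N.Link}
    (p : Part K M f e) (q : Part K N f' e') (hf : ∀ k, k < Γ'.length → f k = f' k)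
    (hM : ∀ m, ∃ l, e l = m) (hN : ∀ m, ∃ l, e' l = m) : M.Iso N :=
  iso_of_parts (ι := Unit) (fun _ => p) (fun _ => q) (fun _ => hf) (by simpa using hM)
    (by simpa using hN) (by simp) (by simp) (by simp)

/-- A reordering of formulas is absorbed by one permutation rule; this is what lets every other
argument ignore the order of formulas. -/
theorem IsPerm.seq [Literals 𝒜] {Γ' Γ : Sequent 𝒜} {K : Prelinking.{u} Γ'}
    {M : Prelinking.{w} Γ} {f : ℕ → Pos} {e : K.Link → M.Link} (p : IsPerm K M f e)
    (hK : K.Seq) : M.Seq := by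
  obtain ⟨π, hπ⟩ := hK
  obtain ⟨e₁, p₁⟩ := IsPerm.of_iso hπ
  let φ : Fin Γ'.length → Fin Γ.length := fun k => ⟨(f k).1, p.lt k.2⟩
  have hφ : Function.Bijective φ := by
    constructor
    · intro j k h
      have h : (f j).1 = (f k).1 := congrArg Fin.val h
      have := p.inj (j, []) (k, []) j.2 k.2 (by
        rw [shift_nil, shift_nil, p.root j.2, p.root k.2, h])
      exact Fin.ext (congrArg Prod.fst this)
    · intro j
      obtain ⟨k, hk, h⟩ := p.full j j.2
      exact ⟨⟨k, hk⟩, Fin.ext (by simp [φ, h])⟩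
  have hlen : Γ'.length = Γ.length := by simpa using Fintype.card_of_bijective hφ
  -- It is `σ.symm` that matches `f`, because the permutation rule puts the `k`-th formula of its
  -- premise at index `σ.symm k`.
  obtain ⟨σ, hσ⟩ : ∃ σ : Equiv.Perm (Fin Γ'.length), ∀ k, (σ.symm k : ℕ) = (f k).1 :=
    ⟨((Equiv.ofBijective φ hφ).trans (finCongr hlen.symm)).symm, fun k => rfl⟩
  clear hφ
  have hΓ : Γ = permute Γ' σ := by
    refine List.ext_getElem? fun j => ?_
    by_cases hj : j < Γ'.length
    · have h1 := p.getElem? (σ ⟨j, hj⟩).2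
      rw [← hσ, σ.symm_apply_apply] at h1
      simp only at h1
      rw [h1]
      simp [permute, hj]
    · rw [List.getElem?_eq_none (by omega), List.getElem?_eq_none (by simp [permute]; omega)]
  subst hΓ
  have p₂ := (Proof.isPerm_perm σ π).comp p₁
  refine ⟨.perm σ π, iso_of_part p.toPart p₂.toPart (fun k hk => ?_) p.surj p₂.surj⟩
  rw [p.root hk, shift_nil, addr_eq (by simpa using hk)]
  simp [hσ]

end

/-! ### Reapplying a rule to premises that are translations of proofs -/

section

variable {𝒜 : Type v}

/-! ### Sequentialization of one rule -/

theorem exists_addr_of_lt {vs : List Pos} {v : Pos} {k : ℕ} (hk : k < vs.length)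
    (h : addr vs k = v) : vs[k]? = some v := by
  rw [List.getElem?_eq_getElem hk, ← addr_eq hk, h]

/-- The `i`-th formula can be moved between the formulas that satisfy `T` and the others. -/
theorem exists_isPerm_around {Γ : Sequent 𝒜} (M : Prelinking.{w} Γ) {i : ℕ} {C : Formula 𝒜}
    (hi : Γ[i]? = some C) (T : ℕ → Prop) :
    ∃ (Γ₀ Γ₁ : Sequent 𝒜) (N : Prelinking.{w} (Γ₀ ++ C :: Γ₁)) (g : ℕ → Pos) (h : _),
      IsPerm M N g h ∧ (g i).1 = Γ₀.length ∧
      (∀ j, j < Γ.length → j ≠ i → ((g j).1 < Γ₀.length ↔ T j)) ∧ ((∀ j, T j) → Γ₁ = []) := by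
  classical
  have hin : i < Γ.length := (List.getElem?_eq_some_iff.1 hi).1
  let L₀ := (roots Γ.length).filter fun v => v.1 ≠ i ∧ T v.1
  let L₁ := (roots Γ.length).filter fun v => v.1 ≠ i ∧ ¬ T v.1
  have m₀ : ∀ v, v ∈ L₀ ↔ v.1 < Γ.length ∧ v.2 = [] ∧ v.1 ≠ i ∧ T v.1 := fun v => by
    simp only [L₀, List.mem_filter, mem_roots, decide_eq_true_eq]
    tauto
  have m₁ : ∀ v, v ∈ L₁ ↔ v.1 < Γ.length ∧ v.2 = [] ∧ v.1 ≠ i ∧ ¬ T v.1 := fun v => by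
    simp only [L₁, List.mem_filter, mem_roots, decide_eq_true_eq]
    tauto
  have sub : ∀ v : Pos, v.1 < Γ.length → v.2 = [] → ∃ A, subAt Γ v = some A := by
    rintro ⟨j, p⟩ hj rfl
    exact ⟨_, by rw [subAt_root, List.getElem?_eq_getElem hj]⟩
  have hmap : (L₀ ++ (i, []) :: L₁).map (subAt Γ) =
      (L₀.filterMap (subAt Γ) ++ C :: L₁.filterMap (subAt Γ)).map some := by
    rw [List.map_append, List.map_append, List.map_cons, List.map_cons, subAt_root, hi,
      map_subAt_filterMap fun v hv => sub v ((m₀ v).1 hv).1 ((m₀ v).1 hv).2.1,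
      map_subAt_filterMap fun v hv => sub v ((m₁ v).1 hv).1 ((m₁ v).1 hv).2.1]
  have hn : (L₀ ++ (i, []) :: L₁).Nodup := by
    rw [List.nodup_append, List.nodup_cons]
    refine ⟨(nodup_roots _).filter _, ⟨fun h => ((m₁ _).1 h).2.2.1 rfl,
      (nodup_roots _).filter _⟩, fun a ha b hb hab => ?_⟩
    subst hab
    have ha := (m₀ a).1 ha
    rcases List.mem_cons.1 hb with rfl | hb
    · exact ha.2.2.1 rfl
    · exact ((m₁ a).1 hb).2.2.2 ha.2.2.2
  have mem : ∀ j, j < Γ.length → (j, []) ∈ L₀ ++ (i, []) :: L₁ := fun j hj => by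
    by_cases h1 : j = i
    · simp [h1]
    · by_cases h2 : T j
      · exact List.mem_append_left _ ((m₀ _).2 ⟨hj, rfl, h1, h2⟩)
      · exact List.mem_append_right _ (List.mem_cons_of_mem _ ((m₁ _).2 ⟨hj, rfl, h1, h2⟩))
  have hlen := length_eq_of_map hmap
  have hlen₀ : (L₀.filterMap (subAt Γ)).length = L₀.length :=
    length_eq_of_map (map_subAt_filterMap fun v hv => sub v ((m₀ v).1 hv).1 ((m₀ v).1 hv).2.1)
  have p : IsPerm (M.pull Set.univ _ (L₀ ++ (i, []) :: L₁)) M _ _ :=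
    { toPart := Part.pull M Set.univ hmap hn (fun _ => 0) (fun v hv => by
        rcases List.mem_append.1 hv with hv | hv
        · simp [((m₀ v).1 hv).2.1]
        · rcases List.mem_cons.1 hv with rfl | hv
          · rfl
          · simp [((m₁ v).1 hv).2.1]) fun l _ y _ => ⟨_, mem _ y.lt, y.1.2, rfl⟩
      surj := fun m => ⟨⟨m, trivial⟩, rfl⟩
      full := fun j hj => (exists_addr hlen _).2 (mem j hj) }
  obtain ⟨g, h, q, hg⟩ := p.symm
  -- The new index of the `j`-th formula is its place in this list, so comparing it with `L₀.length`
  -- tells on which side of the `i`-th formula it lies.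
  have key : ∀ j, j < Γ.length → (L₀ ++ (i, []) :: L₁)[(g j).1]? = some (j, []) := fun j hj =>
    exists_addr_of_lt (hlen ▸ q.lt hj) (hg j hj)
  refine ⟨_, _, _, g, h, q, ?_, fun j hj hji => ?_, fun hT => ?_⟩
  · rw [hlen₀]
    have := key i hin
    rcases lt_trichotomy (g i).1 L₀.length with hlt | heq | hgt
    · rw [List.getElem?_append_left hlt] at this
      exact absurd rfl ((m₀ _).1 (List.mem_of_getElem? this)).2.2.1
    · exact heq
    · rw [List.getElem?_append_right hgt.le, List.getElem?_cons, if_neg (by omega)] at this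
      exact absurd rfl ((m₁ _).1 (List.mem_of_getElem? this)).2.2.1
  · rw [hlen₀]
    have := key j hj
    rcases lt_trichotomy (g j).1 L₀.length with hlt | heq | hgt
    · rw [List.getElem?_append_left hlt] at this
      exact iff_of_true hlt ((m₀ _).1 (List.mem_of_getElem? this)).2.2.2
    · rw [List.getElem?_append_right heq.ge, List.getElem?_cons, if_pos (by omega)] at this
      exact absurd (congrArg Prod.fst (Option.some.inj this)).symm hji
    · rw [List.getElem?_append_right hgt.le, List.getElem?_cons, if_neg (by omega)] at this
      exact iff_of_false (by omega) ((m₁ _).1 (List.mem_of_getElem? this)).2.2.2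
  · have : L₁ = [] := List.eq_nil_iff_forall_not_mem.2 fun v hv => ((m₁ v).1 hv).2.2.2 (hT _)
    simp [this]

theorem front_iff_mem {Γ : Sequent 𝒜} {C : Formula 𝒜} {B : Bool → Prop} {bs : List Bool}
    (hB : ∀ b, B b ↔ b ∈ bs) (v : Pos) :
    front (Γ ++ [C]) Γ.length B v ↔
      v ∈ roots Γ.length ++ bs.map fun b => (Γ.length, [b]) := by
  simp only [front, hB, List.mem_append, mem_roots, List.mem_map, List.length_append,
    List.length_singleton]
  grind

variable [Literals 𝒜]

/-- The proof of a premise can be chosen to have its formulas in a given order. -/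
theorem Part.exists_proof {Γ' Γ Δ : Sequent 𝒜} {K : Prelinking.{u} Γ'} {M : Prelinking.{w} Γ}
    {f : ℕ → Pos} {e : K.Link → M.Link} (p : Part K M f e) (hK : K.Seq) {vs : List Pos}
    (hΔ : vs.map (subAt Γ) = Δ.map some) (hn : vs.Nodup) (c : ℕ → ℕ)
    (hc : ∀ v ∈ vs, v.2.length = c v.1)
    (hv : ∀ v, (∃ k, k < Γ'.length ∧ f k = v) ↔ v ∈ vs) :
    ∃ (π : Proof Δ) (e' : π.translation.Link → M.Link), Part π.translation M (addr vs) e' ∧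
      ∀ m, (∃ l, e' l = m) ↔ ∃ l, e l = m := by
  -- The part of `M` on the links of `K`, with its formulas listed in the order `vs`, has the same
  -- links and occurrences as `K`. It is therefore a reordering of `K` and inherits a proof.
  have q : Part (M.pull (Set.range e) Δ vs) M (addr vs) Subtype.val := by
    refine Part.pull M _ hΔ hn c hc ?_
    rintro _ ⟨l, rfl⟩ y hy
    obtain ⟨x, hx, -⟩ := (p.rel l y).1 hy
    exact ⟨_, (hv _).1 ⟨x.1.1, x.lt, rfl⟩, x.1.2, hx⟩
  have hj : ∀ m, (∃ l, e l = m) ↔ ∃ l : (M.pull (Set.range e) Δ vs).Link, Subtype.val l = m :=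
    fun m => ⟨fun ⟨l, hl⟩ => ⟨⟨m, l, hl⟩, rfl⟩, fun ⟨l, hl⟩ => hl ▸ l.2⟩
  obtain ⟨j, q, hj⟩ : ∃ j, Part (M.pull (Set.range e) Δ vs) M (addr vs) j ∧
      ∀ m, (∃ l, e l = m) ↔ ∃ l, j l = m := ⟨_, q, hj⟩
  obtain ⟨g, h, r, -⟩ := p.isPerm q
    (fun v => by rw [hv, exists_addr (length_eq_of_map hΔ)]) hj
  obtain ⟨π, hπ⟩ := r.seq hK
  obtain ⟨a, s⟩ := IsPerm.of_iso hπ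
  obtain ⟨g', h', s', hg'⟩ := s.symm
  have t := q.comp s'.toPart
  refine ⟨π, j ∘ h', ⟨⟨?_, ?_⟩, t.link_inj, t.adj, fun l y => ?_⟩, fun m => ?_⟩
  · exact q.sub
  · exact q.inj
  · rw [t.rel]
    refine exists_congr fun x => and_congr_left fun _ => ?_
    rw [shift_congr (g := addr vs)]
    rw [s'.root x.lt, hg' _ x.lt, shift_nil]
  · rw [hj]
    constructor
    · rintro ⟨l, rfl⟩
      exact ⟨h' l, rfl⟩
    · rintro ⟨l, rfl⟩
      obtain ⟨l, rfl⟩ := s'.surj l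
      exact ⟨l, rfl⟩

/-- The proof of the premise of a unary rule, or of a premise of `&`, for the last formula. -/
theorem Part.exists_proof_last {Γ' Γ : Sequent 𝒜} {A B C : Formula 𝒜} {K : Prelinking.{u} Γ'}
    {M : Prelinking.{w} (Γ ++ [C])} {f : ℕ → Pos} {e : K.Link → M.Link} (p : Part K M f e)
    (hK : K.Seq) (hC : HasArgs (Γ ++ [C]) Γ.length A B) {S : Bool → Prop} {bs : List Bool}
    (hB : ∀ b, S b ↔ b ∈ bs) (hn : bs.Nodup)
    (hS : ∀ v, (∃ k, k < Γ'.length ∧ f k = v) ↔ front (Γ ++ [C]) Γ.length S v) :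
    ∃ (π : Proof (Γ ++ bs.map (pick A B))) (e' : π.translation.Link → M.Link),
      Part π.translation M (addr (roots Γ.length ++ bs.map fun b => (Γ.length, [b]))) e' ∧
      ∀ m, (∃ l, e' l = m) ↔ ∃ l, e l = m := by
  refine p.exists_proof hK ?_ ?_ (fun j => if j = Γ.length then 1 else 0) ?_
    fun v => (hS v).trans (front_iff_mem hB v)
  · rw [List.map_append, map_subAt_roots, List.map_append, List.map_map, List.map_map]
    congr 1
    exact List.map_congr_left fun b _ => hC.subAt_arg b
  · rw [List.nodup_append]
    refine ⟨nodup_roots _, hn.map fun b c h => by simpa using h, fun a ha b hb hab => ?_⟩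
    simp only [mem_roots, List.mem_map] at ha hb
    grind
  · intro v hv
    exact front_length ((front_iff_mem hB (C := C) v).2 hv)

namespace IsUnary

variable {Γ' Γ : Sequent 𝒜} {K : Prelinking.{u} Γ'} {M : Prelinking.{w} Γ} {i : ℕ}
  {A B : Formula 𝒜} {f : ℕ → Pos} {e : K.Link → M.Link}

theorem seq_par (r : IsUnary K M i (fun _ => True) f e) (hi : Γ[i]? = some (.par A B))
    (hK : K.Seq) : M.Seq := by
  obtain ⟨Γ₀, Γ₁, N, g, h, p, hg, -, hΓ⟩ := exists_isPerm_around M hi fun _ => True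
  obtain rfl := hΓ fun _ => trivial
  have hin : i < Γ.length := (List.getElem?_eq_some_iff.1 hi).1
  have r' := p.isUnary hin r
  rw [hg] at r'
  obtain ⟨π, e', q, he'⟩ := r'.toPart.exists_proof_last hK (A := A) (B := B) (.inr (.inl (by simp)))
    (bs := [false, true]) (by simp) (by simp) r'.image
  obtain ⟨g', h', p', -⟩ := p.symm
  exact p'.seq ⟨.par π, iso_of_part q (Proof.isUnary_par π).toPart (fun _ _ => rfl)
    (fun m => (he' m).2 (r'.surj m)) (fun m => ⟨m, rfl⟩)⟩

theorem seq_plus {b : Bool} (r : IsUnary K M i (fun c => c = b) f e)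
    (hi : Γ[i]? = some (.plus A B)) (hK : K.Seq) : M.Seq := by
  obtain ⟨Γ₀, Γ₁, N, g, h, p, hg, -, hΓ⟩ := exists_isPerm_around M hi fun _ => True
  obtain rfl := hΓ fun _ => trivial
  have hin : i < Γ.length := (List.getElem?_eq_some_iff.1 hi).1
  have r' := p.isUnary hin r
  rw [hg] at r'
  obtain ⟨π, e', q, he'⟩ := r'.toPart.exists_proof_last hK (A := A) (B := B)
    (.inr (.inr (.inr (by simp)))) (bs := [b]) (by simp) (by simp) r'.image
  obtain ⟨g', h', p', -⟩ := p.symm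
  exact p'.seq ⟨.plus b π, iso_of_part q (Proof.isUnary_plus b π).toPart (fun _ _ => rfl)
    (fun m => (he' m).2 (r'.surj m)) (fun m => ⟨m, rfl⟩)⟩

end IsUnary

/-- With the `i`-th formula moved to the end and both premises in the order that the rule expects,
`M` and the translation have the same parts and conflict everywhere between them, so `iso_of_parts`
identifies them. -/
theorem IsSum.seq {Γ' : Bool → Sequent 𝒜} {Γ : Sequent 𝒜} {K : ∀ b, Prelinking.{u} (Γ' b)}
    {M : Prelinking.{w} Γ} {i : ℕ} {A B : Formula 𝒜} {f : Bool → ℕ → Pos}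
    {e : ∀ b, (K b).Link → M.Link} (r : IsSum K M i f e) (hi : Γ[i]? = some (.amp A B))
    (hK : ∀ b, (K b).Seq) : M.Seq := by
  obtain ⟨Γ₀, Γ₁, N, g, h, p, hg, -, hΓ⟩ := exists_isPerm_around M hi fun _ => True
  obtain rfl := hΓ fun _ => trivial
  have hin : i < Γ.length := (List.getElem?_eq_some_iff.1 hi).1
  have r' := p.isSum hin r
  rw [hg] at r'
  have := fun b => (r'.part b).exists_proof_last (hK b) (A := A) (B := B)
    (.inr (.inr (.inl (by simp)))) (S := fun c => c = b) (bs := [b]) (by simp) (by simp)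
    (r'.image b)
  choose π e' q he' using this
  have t := Proof.isSum_amp (A := A) (B := B) π
  obtain ⟨g', h', p', -⟩ := p.symm
  have hne : ∀ {b c : Bool}, b ≠ c → c = !b := fun {b c} h => by cases b <;> cases c <;> simp at *
  have hs : ∀ b l l', ∃ m m', e' b l = h (e b m) ∧ e' (!b) l' = h (e (!b) m') := fun b l l' => by
    obtain ⟨m, hm⟩ := (he' b _).1 ⟨l, rfl⟩
    obtain ⟨m', hm'⟩ := (he' (!b) _).1 ⟨l', rfl⟩
    exact ⟨m, m', hm.symm, hm'.symm⟩
  refine p'.seq ⟨.amp (π false) (π true), iso_of_parts q t.part (fun _ _ _ => rfl) (fun m => ?_)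
    t.cover (fun b c l l' hbc => ?_) (fun b c l l' hbc => ?_) (fun b c l l' hbc => ?_)⟩
  · obtain ⟨b, l, hl⟩ := r'.cover m
    exact ⟨b, (he' b m).2 ⟨l, hl⟩⟩
  · obtain rfl := hne hbc
    obtain ⟨m, m', h1, h2⟩ := hs b l l'
    rw [h1, h2]
    exact r'.sep b m m'
  · obtain rfl := hne hbc
    exact t.sep b l l'
  · obtain rfl := hne hbc
    obtain ⟨m, m', h1, h2⟩ := hs b l l'
    rw [h1, h2]
    exact iff_of_false (r'.cross b m m') (t.cross b l l')

theorem IsProd.seq {Γ' : Bool → Sequent 𝒜} {Γ : Sequent 𝒜} {K : ∀ b, Prelinking.{u} (Γ' b)}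
    {M : Prelinking.{w} Γ} {i : ℕ} {A B : Formula 𝒜} {f : Bool → ℕ → Pos}
    {e : ∀ b, (K b).Link → M.Link} (r : IsProd K M i f e) (hi : Γ[i]? = some (.tensor A B))
    (hK : ∀ b, (K b).Seq) : M.Seq := by
  -- The context formulas of the left premise are moved to the left of the tensor, and the remaining
  -- ones to its right.
  obtain ⟨Γ₀, Γ₁, N, g, h, p, hg, hT, -⟩ := exists_isPerm_around M hi
    fun j => ∃ k, k < (Γ' false).length ∧ f false k = (j, [])
  have hin : i < Γ.length := (List.getElem?_eq_some_iff.1 hi).1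
  have r' := p.isProd hin r
  rw [hg] at r'
  have harg : HasArgs (Γ₀ ++ Formula.tensor A B :: Γ₁) Γ₀.length A B := .inl (by simp)
  have hne : ∀ {b c : Bool}, b ≠ c → c = !b := fun {b c} h => by cases b <;> cases c <;> simp at *
  have uniq : ∀ b c j k, j < (Γ' b).length → k < (Γ' c).length → f b j = f c k → b = c :=
    fun b c j k hj hk hjk => by
      by_contra hbc
      obtain rfl := hne hbc
      exact r.disj b j k hj hk hjk
  have himg : ∀ b k, k < (Γ' b).length → shift g (f b k) ∈ Proof.tensorAddr Γ₀ Γ₁ b := by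
    intro b k hk
    rcases (r.image (f b k)).1 ⟨b, k, hk, rfl⟩ with ⟨h1, h2, h3⟩ | ⟨c, -, h1⟩
    · have hT := hT _ h1 h2
      have hlt := p.lt h1
      have hroot := p.root h1
      have hfk : f b k = ((f b k).1, []) := Prod.ext rfl h3
      rw [hfk, shift_nil, hroot]
      have hgi : (g (f b k).1).1 ≠ Γ₀.length := fun h => h2 (congrArg Prod.fst
        (p.inj ((f b k).1, []) (i, []) h1 hin (by
          rw [shift_nil, shift_nil, hroot, p.root hin, h, hg])))
      simp only [List.length_append, List.length_cons] at hlt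
      cases b
      · exact List.mem_append_left _ (mem_roots.2 ⟨hT.2 ⟨k, hk, hfk⟩, rfl⟩)
      · have : ¬ (g (f true k).1).1 < Γ₀.length := fun h => by
          obtain ⟨k', hk', h'⟩ := hT.1 h
          have := uniq false true k' k hk' hk (h'.trans hfk.symm)
          simp at this
        refine List.mem_cons_of_mem _ (List.mem_map.2
          ⟨(g (f true k).1).1 - (Γ₀.length + 1), List.mem_range.2 ?_, Prod.ext ?_ rfl⟩)
        · omega
        · simp only
          omega
    · obtain ⟨k', hk', h'⟩ := r.arg c
      obtain rfl := uniq c b k' k hk' hk (h'.trans h1.symm)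
      rw [h1, shift, p.root hin, hg]
      cases c <;> simp
  -- The inclusions `himg` suffice: the two images together cover all addresses, and the two lists
  -- are disjoint, so neither inclusion can be proper.
  have hmem : ∀ b v, (∃ k, k < (Γ' b).length ∧ shift g (f b k) = v) ↔
      v ∈ Proof.tensorAddr Γ₀ Γ₁ b := by
    intro b v
    constructor
    · rintro ⟨k, hk, rfl⟩
      exact himg b k hk
    · intro hv
      have hfront : front (Γ₀ ++ Formula.tensor A B :: Γ₁) Γ₀.length (fun _ => True) v := by
        obtain ⟨j, p⟩ := v
        cases b
        · simp [mem_roots] at hv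
          rcases hv with ⟨h1, rfl⟩ | ⟨rfl, rfl⟩
          · exact .inl ⟨by simp; omega, by simp; omega, rfl⟩
          · exact .inr ⟨false, trivial, rfl⟩
        · simp at hv
          rcases hv with ⟨rfl, rfl⟩ | ⟨k, h1, rfl, rfl⟩
          · exact .inr ⟨true, trivial, rfl⟩
          · exact .inl ⟨by simp; omega, by simp; omega, rfl⟩
      obtain ⟨c, k, hk, h⟩ := (r'.image v).2 hfront
      by_cases hbc : b = c
      · subst hbc
        exact ⟨k, hk, h⟩
      · obtain rfl := hne hbc
        have := himg _ k hk
        rw [h] at this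
        obtain ⟨j, p⟩ := v
        exfalso
        cases b <;> simp [mem_roots] at hv this <;> grind
  have := fun b => (r'.part b).exists_proof (hK b)
    (Proof.map_subAt_tensorAddr (Γ := Γ₀) (Δ := Γ₁) (A := A) (B := B) b)
    (Proof.nodup_tensorAddr b) (fun j => if j = Γ₀.length then 1 else 0)
    (Proof.uniform_tensorAddr b) (hmem b)
  choose π e' q he' using this
  have t := Proof.isProd_tensor (A := A) (B := B) π
  obtain ⟨g', h', p', -⟩ := p.symm
  have hs : ∀ b l l', ∃ m m', e' b l = h (e b m) ∧ e' (!b) l' = h (e (!b) m') := fun b l l' => by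
    obtain ⟨m, hm⟩ := (he' b _).1 ⟨l, rfl⟩
    obtain ⟨m', hm'⟩ := (he' (!b) _).1 ⟨l', rfl⟩
    exact ⟨m, m', hm.symm, hm'.symm⟩
  refine p'.seq ⟨.tensor (π false) (π true), iso_of_parts q t.part (fun _ _ _ => rfl)
    (fun m => ?_) t.cover (fun b c l l' hbc => ?_) (fun b c l l' hbc => ?_)
    (fun b c l l' hbc => ?_)⟩
  · obtain ⟨b, l, hl⟩ := r'.cover m
    exact ⟨b, (he' b m).2 ⟨l, hl⟩⟩
  · obtain rfl := hne hbc
    obtain ⟨m, m', h1, h2⟩ := hs b l l'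
    rw [h1, h2]
    exact r'.sep b m m'
  · obtain rfl := hne hbc
    exact t.sep b l l'
  · obtain rfl := hne hbc
    obtain ⟨m, m', h1, h2⟩ := hs b l l'
    rw [h1, h2]
    exact iff_of_true (r'.cross b m m') (t.cross b l l')

theorem Prelinking.IsAxiom.seq {Γ : Sequent 𝒜} {K : Prelinking.{u} Γ} (h : K.IsAxiom) :
    K.Seq := by
  obtain ⟨⟨P, rfl⟩, ⟨l, -, hl⟩, hrel⟩ := h
  have hu : ∀ m, m = l := fun m => hl m trivial
  refine ⟨.ax P, ⟨fun _ => (), fun _ => l, fun m => (hu m).symm, fun _ => rfl⟩,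
    fun m m' => iff_of_false id ?_, fun m x => iff_of_true trivial (hrel m x)⟩
  rw [hu m, hu m']
  exact K.space.loopless.irrefl l

end

/-! ### Erasable prelinkings are translations of proofs -/

section

variable {𝒜 : Type v}

/-! ### The conflict graph -/

theorem reachable_induction {V : Type*} {G : SimpleGraph V} {P : V → Prop} {a b : V}
    (h : G.Reachable a b) (ha : P a) (step : ∀ s t, G.Adj s t → P s → P t) : P b := by
  obtain ⟨p⟩ := h
  induction p with
  | nil => exact ha
  | cons hadj _ ih => exact ih (step _ _ hadj ha)

/-- Climbing in the parse tree: a property that passes from child to parent, at and below the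
address `(j, s)`, reaches that address from any vertex below it. All initial segments of a valid
path are valid. -/
theorem exists_prefix_vertex {Γ : Sequent 𝒜} {j : ℕ} {s : List Bool} {P : Vertex Γ → Prop}
    (h : ∀ (x y : Vertex Γ) (b : Bool) (p : List Bool), x.1 = (j, s ++ p ++ [b]) →
      y.1 = (j, s ++ p) → P x → P y) (p : List Bool) (x : Vertex Γ) (hx : x.1 = (j, s ++ p))
    (hP : P x) : ∃ y : Vertex Γ, y.1 = (j, s) ∧ P y := by
  induction p using List.reverseRecOn generalizing x with
  | nil => exact ⟨x, by simpa using hx, hP⟩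
  | append_singleton p b ih =>
    rw [← List.append_assoc] at hx
    have : ∃ A, subAt Γ (j, s ++ p) = some A := by
      obtain ⟨A, hA⟩ := x.2
      rw [hx, subAt_append] at hA
      obtain ⟨B, hB, -⟩ := Option.bind_eq_some_iff.1 hA
      exact ⟨B, hB⟩
    exact ih ⟨_, this⟩ rfl (h x ⟨_, this⟩ b p hx rfl hP)

namespace Prelinking

variable {Γ : Sequent 𝒜} {K : Prelinking.{u} Γ} {i : ℕ}

theorem adj_inl_inl {x y : Vertex Γ} : K.conflictGraph.Adj (.inl x) (.inl y) ↔
    (∃ b, y.1 = (x.1.1, x.1.2 ++ [b])) ∨ ∃ b, x.1 = (y.1.1, y.1.2 ++ [b]) := by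
  rw [conflictGraph, SimpleGraph.fromRel_adj]
  refine and_iff_right_of_imp fun h hxy => ?_
  obtain rfl := Sum.inl_injective hxy
  rcases h with ⟨b, h⟩ | ⟨b, h⟩ <;> simpa using congrArg (fun v => v.2.length) h

theorem adj_inr_inl {l : K.Link} {x : Vertex Γ} : K.conflictGraph.Adj (.inr l) (.inl x) ↔
    ∃ z : Leaf Γ, z.1 = x.1 ∧ K.rel l z := by
  simp [conflictGraph, SimpleGraph.fromRel_adj]

theorem adj_inl_inr {l : K.Link} {x : Vertex Γ} : K.conflictGraph.Adj (.inl x) (.inr l) ↔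
    ∃ z : Leaf Γ, z.1 = x.1 ∧ K.rel l z := by
  rw [SimpleGraph.adj_comm, adj_inr_inl]

theorem adj_inr_inr {l m : K.Link} : K.conflictGraph.Adj (.inr l) (.inr m) ↔
    l ≠ m ∧ ¬ K.space.Adj l m := by
  rw [conflictGraph, SimpleGraph.fromRel_adj]
  simp only [SimpleGraph.compl_adj, ne_eq, Sum.inr.injEq, K.space.adj_comm m l, eq_comm (a := m)]
  tauto

/-- A vertex of the conflict graph other than the `i`-th root. -/
def NotRoot (K : Prelinking.{u} Γ) (i : ℕ) (t : Vertex Γ ⊕ K.Link) : Prop :=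
  ∀ r : Vertex Γ, t = .inl r → r.1 ≠ (i, [])

theorem inComponent_arg {b : Bool} (x : Vertex Γ) (hx : x.1 = (i, [b])) :
    K.InComponent i b (.inl x) := by
  have : K.NotRoot i (.inl x) := by
    rintro r h
    obtain rfl := Sum.inl_injective h
    simp [hx]
  exact ⟨⟨_, this⟩, ⟨_, this⟩, ⟨x, rfl, hx⟩, rfl, SimpleGraph.Reachable.refl _⟩

theorem InComponent.notRoot {b : Bool} {s} (h : K.InComponent i b s) : K.NotRoot i s := by
  obtain ⟨a, t, -, rfl, -⟩ := h
  exact t.2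

theorem InComponent.of_adj {b : Bool} {s t} (h : K.InComponent i b s)
    (hst : K.conflictGraph.Adj s t) (ht : K.NotRoot i t) : K.InComponent i b t := by
  obtain ⟨a, s, ha, rfl, h⟩ := h
  exact ⟨a, ⟨t, ht⟩, ha, rfl, h.trans (SimpleGraph.Adj.reachable hst)⟩

theorem InComponent.induction {b : Bool} {P : Vertex Γ ⊕ K.Link → Prop} {s}
    (h : K.InComponent i b s) (ha : ∀ x : Vertex Γ, x.1 = (i, [b]) → P (.inl x))
    (step : ∀ s t, K.conflictGraph.Adj s t → K.NotRoot i t → P s → P t) : P s := by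
  obtain ⟨a, t, ⟨x, hx, hx'⟩, rfl, h⟩ := h
  refine reachable_induction (P := fun c => P c.1) h ?_ fun c d hcd hc => step c.1 d.1 hcd d.2 hc
  rw [hx]
  exact ha x hx'

variable {A B : Formula 𝒜}

theorem adj_root (hC : HasArgs Γ i A B) {r : Vertex Γ} (hr : r.1 = (i, []))
    {t : Vertex Γ ⊕ K.Link} : K.conflictGraph.Adj (.inl r) t ↔
      ∃ (b : Bool) (x : Vertex Γ), t = .inl x ∧ x.1 = (i, [b]) := by
  rcases t with x | l
  · rw [adj_inl_inl, hr]
    simp only [Sum.inl.injEq, List.nil_append, Prod.mk.injEq, List.nil_eq, List.append_eq_nil_iff]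
    simp
  · rw [adj_inl_inr, hr]
    simp only [reduceCtorEq, false_and, exists_false, iff_false, not_exists, not_and]
    intro z hz
    rcases hC.exists_front z with ⟨h, -⟩ | ⟨b, p, h⟩ <;> simp [hz] at h

/-- The vertex of the `i`-th formula. -/
theorem _root_.MALL.HasArgs.exists_root (hC : HasArgs Γ i A B) : ∃ r : Vertex Γ, r.1 = (i, []) :=
  ⟨⟨(i, []), _, by rw [subAt_root, List.getElem?_eq_getElem hC.lt]⟩, rfl⟩

theorem _root_.MALL.HasArgs.exists_arg (hC : HasArgs Γ i A B) (b : Bool) :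
    ∃ r : Vertex Γ, r.1 = (i, [b]) :=
  ⟨⟨(i, [b]), _, hC.subAt_arg b⟩, rfl⟩

/-- The neighbours of the root are its two arguments. A walk from the root to `s` therefore enters
the component of an argument each time that it leaves the root. -/
theorem Connected.notRoot_iff (hK : K.Connected) (hC : HasArgs Γ i A B) (s) :
    K.NotRoot i s ↔ ∃ b, K.InComponent i b s := by
  refine ⟨fun hs => ?_, fun ⟨b, h⟩ => h.notRoot⟩
  obtain ⟨r, hr⟩ := hC.exists_root
  have := reachable_induction (P := fun s => K.NotRoot i s → ∃ b, K.InComponent i b s)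
    (hK.2.preconnected (.inl r) s) (fun h => absurd hr (h r rfl)) fun s t hst ih ht => ?_
  · exact this hs
  · by_cases h : K.NotRoot i s
    · obtain ⟨b, h⟩ := ih h
      exact ⟨b, h.of_adj hst ht⟩
    · simp only [NotRoot, not_forall, not_not] at h
      obtain ⟨r', rfl, hr'⟩ := h
      obtain ⟨b, x, rfl, hx⟩ := (adj_root hC hr').1 hst
      exact ⟨b, inComponent_arg x hx⟩

/-- Upon deletion of a root that is on no cycle, its arguments are in different components. -/
theorem not_inComponent_arg (hC : HasArgs Γ i A B)
    (hcyc : ∀ r : Vertex Γ, r.1 = (i, []) →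
      ∀ c : K.conflictGraph.Walk (.inl r) (.inl r), ¬ c.IsCycle) {b : Bool} {x : Vertex Γ}
    (hx : x.1 = (i, [!b])) : ¬ K.InComponent i b (.inl x) := by
  classical
  intro h
  obtain ⟨r, hr⟩ := hC.exists_root
  obtain ⟨y, hy⟩ := hC.exists_arg b
  have hry : K.conflictGraph.Adj (.inl r) (.inl y) := (adj_root hC hr).2 ⟨b, y, rfl, hy⟩
  have hrx : K.conflictGraph.Adj (.inl r) (.inl x) := (adj_root hC hr).2 ⟨!b, x, rfl, hx⟩
  -- A cycle through this edge could be rotated to start at the root, so the edge is a bridge.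
  have hbr : K.conflictGraph.IsBridge s(.inl r, .inl y) := by
    rw [SimpleGraph.isBridge_iff_forall_cycle_notMem hry]
    intro u c hc hmem
    exact hcyc r hr _ (hc.rotate (c.fst_mem_support_of_mem_edges hmem))
  rw [SimpleGraph.isBridge_iff] at hbr
  refine hbr ?_
  -- Walks inside the component avoid the root, hence also the bridge. If they reached the other
  -- argument `x`, then going from the root to `x` and on to `y` would bypass the bridge.
  have key : ∀ s, K.InComponent i b s →
      (K.conflictGraph.deleteEdges {s(.inl r, .inl y)}).Reachable s (.inl y) := by
    intro s hs
    have := hs.induction (P := fun s => K.NotRoot i s ∧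
      (K.conflictGraph.deleteEdges {s(.inl r, .inl y)}).Reachable s (.inl y)) ?_ ?_
    · exact this.2
    · intro z hz
      have : z = y := Subtype.ext (hz.trans hy.symm)
      subst this
      exact ⟨(inComponent_arg z hz).notRoot, .refl _⟩
    · rintro s t hst ht ⟨hs, h⟩
      refine ⟨ht, SimpleGraph.Reachable.trans (SimpleGraph.Adj.reachable ?_) h⟩
      rw [SimpleGraph.deleteEdges_adj]
      refine ⟨hst.symm, fun hmem => ?_⟩
      rw [Set.mem_singleton_iff, Sym2.eq_iff] at hmem
      rcases hmem with ⟨h1, -⟩ | ⟨-, h1⟩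
      · exact ht r h1 hr
      · exact hs r h1 hr
  refine SimpleGraph.Reachable.trans (SimpleGraph.Adj.reachable ?_) (key _ h)
  rw [SimpleGraph.deleteEdges_adj]
  refine ⟨hrx, fun hmem => ?_⟩
  rw [Set.mem_singleton_iff, Sym2.eq_iff] at hmem
  have hxy : x ≠ y := by
    rintro rfl
    rw [hx] at hy
    simp at hy
  rcases hmem with ⟨-, h1⟩ | ⟨h0, h1⟩
  · exact hxy (Sum.inl_injective h1)
  · obtain rfl := Sum.inl_injective h0
    rw [hr] at hy
    simp at hy

/-! ### Premises obtained by erasure -/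

theorem _root_.MALL.Part.restrict (hC : HasArgs Γ i A B) {S : Set K.Link} {vs : List Pos}
    (hn : vs.Nodup) (hvs : ∀ v ∈ vs, front Γ i (fun _ => True) v)
    (hS : ∀ l ∈ S, ∀ y, K.rel l y → ∃ v ∈ vs, ∃ p, y.1 = (v.1, v.2 ++ p)) :
    Part (K.restrict S vs) K (addr vs) (fun l : S => l.1) :=
  Part.pull K S (map_subAt_filterMap fun v hv => hC.front_subAt (hvs v hv)) hn
    (fun j => if j = i then 1 else 0)
    (fun v hv => front_length (hvs v hv)) hS

theorem _root_.MALL.HasArgs.exists_addr (hC : HasArgs Γ i A B) {vs : List Pos}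
    (hvs : ∀ v ∈ vs, front Γ i (fun _ => True) v) (v : Pos) :
    (∃ k, k < (vs.filterMap (subAt Γ)).length ∧ addr vs k = v) ↔ v ∈ vs :=
  MALL.exists_addr (length_eq_of_map
    (map_subAt_filterMap fun v hv => hC.front_subAt (hvs v hv))) v

theorem mem_replaceRoot (hC : HasArgs Γ i A B) {bs : List Bool} {v : Pos} :
    v ∈ replaceRoot Γ i (bs.map fun b => (i, [b])) ↔ front Γ i (fun b => b ∈ bs) v := by
  have := hC.lt
  obtain ⟨j, p⟩ := v
  simp only [replaceRoot, List.mem_flatMap, List.mem_range, front]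
  constructor
  · rintro ⟨k, hk, h⟩
    split_ifs at h with hki
    · right
      simpa [eq_comm] using h
    · left
      grind
  · rintro (⟨h1, h2, h3⟩ | ⟨b, hb, h⟩)
    · exact ⟨j, h1, by simp_all⟩
    · exact ⟨i, hC.lt, by simp_all⟩

theorem nodup_replaceRoot {bs : List Bool} (hn : bs.Nodup) :
    (replaceRoot Γ i (bs.map fun b => (i, [b]))).Nodup := by
  rw [replaceRoot, List.nodup_flatMap]
  constructor
  · intro k _
    split_ifs
    · exact hn.map fun b c h => by simpa using h
    · simp
  · refine List.nodup_range.imp ?_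
    intro a b hab v ha hb
    have : ∀ {k}, v ∈ (if k = i then bs.map (fun b => (i, [b])) else [(k, [])]) → v.1 = k := by
      intro k hk
      split_ifs at hk with h
      · obtain ⟨b, -, rfl⟩ := List.mem_map.1 hk
        exact h.symm
      · rw [List.mem_singleton.1 hk]
    exact hab ((this ha).symm.trans (this hb))

/-- The prelinking that is obtained by replacing a formula by some of its arguments. -/
theorem part_replaceRoot (hC : HasArgs Γ i A B) {S : Set K.Link} {bs : List Bool}
    (hn : bs.Nodup) (hS : ∀ b, b ∉ bs → ¬ K.Touches S i b) :
    Part (K.restrict S (replaceRoot Γ i (bs.map fun b => (i, [b])))) K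
      (addr (replaceRoot Γ i (bs.map fun b => (i, [b])))) (fun l : S => l.1) := by
  refine Part.restrict hC (nodup_replaceRoot hn)
    (fun v hv => front_mono ((mem_replaceRoot hC).1 hv) fun _ _ => trivial) fun l hl y hy => ?_
  rcases hC.exists_front y with ⟨h1, h2⟩ | ⟨b, p, h⟩
  · exact ⟨_, (mem_replaceRoot hC).2 (front_mono h2 fun _ h => h.elim), y.1.2, rfl⟩
  · by_cases hb : b ∈ bs
    · exact ⟨(i, [b]), (mem_replaceRoot hC).2 (.inr ⟨b, hb, rfl⟩), p, h⟩
    · exact absurd ⟨l, hl, y, hy, p, h⟩ (hS b hb)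

theorem image_replaceRoot (hC : HasArgs Γ i A B) {bs : List Bool} (v : Pos) :
    (∃ k, k < ((replaceRoot Γ i (bs.map fun b => (i, [b]))).filterMap (subAt Γ)).length ∧
      addr (replaceRoot Γ i (bs.map fun b => (i, [b]))) k = v) ↔ front Γ i (fun b => b ∈ bs) v := by
  rw [hC.exists_addr fun v hv => front_mono ((mem_replaceRoot hC).1 hv) fun _ _ => trivial,
    mem_replaceRoot hC]

theorem isUnary_restrict (hC : HasArgs Γ i A B) {bs : List Bool} (hn : bs.Nodup)
    (hS : ∀ b, b ∉ bs → ¬ K.Touches Set.univ i b) :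
    IsUnary (K.restrict Set.univ (replaceRoot Γ i (bs.map fun b => (i, [b])))) K i
      (fun b => b ∈ bs) (addr (replaceRoot Γ i (bs.map fun b => (i, [b]))))
      (fun l : (Set.univ : Set K.Link) => l.1) where
  toPart := part_replaceRoot hC hn hS
  surj m := ⟨⟨m, trivial⟩, rfl⟩
  image := image_replaceRoot hC

theorem exists_isPiece (l : K.Link) : ∃ S, K.IsPiece S ∧ l ∈ S :=
  ⟨_, ⟨_, rfl⟩, SimpleGraph.ConnectedComponent.connectedComponentMk_mem (v := l)⟩

theorem IsPiece.mem_of_adj {S : Set K.Link} (hS : K.IsPiece S) {l l' : K.Link} (hl : l ∈ S)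
    (h : K.space.Adj l l') : l' ∈ S := by
  obtain ⟨c, rfl⟩ := hS
  exact (c.mem_supp_congr_adj h).1 hl

theorem IsPiece.eq_of_mem {S T : Set K.Link} (hS : K.IsPiece S) (hT : K.IsPiece T) {l : K.Link}
    (h₁ : l ∈ S) (h₂ : l ∈ T) : S = T := by
  obtain ⟨c, rfl⟩ := hS
  obtain ⟨d, rfl⟩ := hT
  rw [SimpleGraph.ConnectedComponent.mem_supp_iff] at h₁ h₂
  rw [← h₁, ← h₂]

theorem Chooses.eq {S : Set K.Link} {b c : Bool} (hb : K.Chooses S i b) (hc : K.Chooses S i c) :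
    b = c := by
  by_contra h
  obtain rfl : c = !b := by cases b <;> cases c <;> simp at *
  exact hb.2 hc.1

/-- Pieces partition the links, each chooses exactly one argument, and no coherence edge joins two
pieces; so the two sets of choosers partition the links, with conflict between them. -/
theorem isSum_argumentPart (hC : HasArgs Γ i A B) (h : ∀ S, K.IsPiece S → K.Unary S i) :
    IsSum (fun b => (K.argumentPart (K.choosers i b) i b).2) K i
      (fun b => addr (replaceRoot Γ i [(i, [b])]))
      (fun b (l : (K.choosers i b : Set K.Link)) => l.1) where
  part b := by
    refine part_replaceRoot hC (bs := [b]) (by simp) fun c hc => ?_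
    obtain rfl : c = !b := by cases b <;> cases c <;> simp at *
    rintro ⟨l, ⟨S, hS, hl, hch⟩, h⟩
    exact hch.2 ⟨l, hl, h⟩
  cover m := by
    obtain ⟨S, hS, hm⟩ := K.exists_isPiece m
    obtain ⟨b, hb⟩ := h S hS
    exact ⟨b, ⟨m, S, hS, hm, hb⟩, rfl⟩
  sep := by
    rintro b ⟨l, S, hS, hl, hb⟩ ⟨l', T, hT, hl', hc⟩ hll
    obtain rfl : l = l' := hll
    obtain rfl := hS.eq_of_mem hT hl hl'
    simpa using hb.eq hc
  cross := by
    rintro b ⟨l, S, hS, hl, hb⟩ ⟨l', T, hT, hl', hc⟩ hll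
    obtain rfl := hS.eq_of_mem hT (hS.mem_of_adj hl hll) hl'
    simpa using hb.eq hc
  image b v := by
    have hB : (fun c => c ∈ [b]) = fun c => c = b := by ext c; simp
    rw [← hB]
    exact image_replaceRoot hC (bs := [b]) v

/-- Connectedness makes the components of the two arguments cover everything but the root, and the
absence of cycles makes them disjoint. Conflicting links are adjacent, so links of different
components must be coherent. The second conclusion records which addresses each component receives,
for later comparison with given premises. -/
theorem isProd_componentPart (hK : K.Connected) (hC : HasArgs Γ i A B)
    (hcyc : ∀ r : Vertex Γ, r.1 = (i, []) →
      ∀ c : K.conflictGraph.Walk (.inl r) (.inl r), ¬ c.IsCycle) :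
    ∃ f, IsProd (fun b => (K.componentPart i b).2) K i f
      (fun b (l : {l | K.InComponent i b (.inr l)}) => l.1) ∧
      ∀ b v, (∃ k, k < (K.componentPart i b).1.length ∧ f b k = v) ↔
        front Γ i (fun _ => True) v ∧ ∃ y : Vertex Γ, y.1 = v ∧ K.InComponent i b (.inl y) := by
  classical
  let vs : Bool → List Pos := fun b =>
    (replaceRoot Γ i [(i, [false]), (i, [true])]).filter fun x =>
      ∃ y : Vertex Γ, y.1 = x ∧ K.InComponent i b (.inl y)
  have hmem : ∀ b v, v ∈ vs b ↔ front Γ i (fun _ => True) v ∧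
      ∃ y : Vertex Γ, y.1 = v ∧ K.InComponent i b (.inl y) := fun b v => by
    have := mem_replaceRoot hC (bs := [false, true]) (v := v)
    simp only [List.map_cons, List.map_nil] at this
    simp only [vs, List.mem_filter, this, decide_eq_true_eq]
    simp
  have hdisj : ∀ b s, K.InComponent i b s → ¬ K.InComponent i (!b) s := by
    intro b s h
    refine (h.induction (P := fun s => K.NotRoot i s ∧ ¬ K.InComponent i (!b) s)
      (fun x hx => ?_) fun s t hst ht hs => ?_).2
    · exact ⟨(inComponent_arg x hx).notRoot,
        not_inComponent_arg hC hcyc (b := !b) (by simpa using hx)⟩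
    · exact ⟨ht, fun h => hs.2 (h.of_adj hst.symm hs.1)⟩
  have harg : ∀ b, (i, [b]) ∈ vs b := fun b => by
    obtain ⟨x, hx⟩ := hC.exists_arg b
    exact (hmem _ _).2 ⟨.inr ⟨b, trivial, rfl⟩, x, hx, inComponent_arg x hx⟩
  have hnr : ∀ v, front Γ i (fun _ => True) v → v ≠ (i, []) := by
    rintro v (⟨-, h, -⟩ | ⟨b, -, rfl⟩)
    · rintro rfl
      exact h rfl
    · simp
  have hpart : ∀ b, Part (K.componentPart i b).2 K (addr (vs b))
      (fun l : {l | K.InComponent i b (.inr l)} => l.1) := fun b => by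
    refine Part.restrict hC ((nodup_replaceRoot (bs := [false, true]) (by simp)).filter _)
      (fun v hv => ((hmem b v).1 hv).1) fun l hl y hy => ?_
    have hy' : K.conflictGraph.Adj (.inr l) (.inl ⟨y.1, _, y.2.choose_spec⟩) :=
      adj_inr_inl.2 ⟨y, rfl, hy⟩
    -- Climbing from a leaf of `l` to the address above it in the new sequent stays in the
    -- component, as the deleted root is not met on the way.
    have hup : ∀ (j : ℕ) (s : List Bool), (j, s) ≠ (i, []) → ∀ p, y.1 = (j, s ++ p) →
        ∃ z : Vertex Γ, z.1 = (j, s) ∧ K.InComponent i b (.inl z) := fun j s hjs p hp => by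
      have hne : ∀ (z : Vertex Γ) (q : List Bool), z.1 = (j, s ++ q) → K.NotRoot i (.inl z) := by
        rintro z q hz r hzr hr
        obtain rfl := Sum.inl_injective hzr
        rw [hz] at hr
        apply hjs
        simp only [Prod.mk.injEq, List.append_eq_nil_iff] at hr ⊢
        exact ⟨hr.1, hr.2.1⟩
      refine exists_prefix_vertex (fun x z c q hx hz h => ?_) p _ hp
        (hl.of_adj hy' (hne _ p hp))
      exact h.of_adj (adj_inl_inl.2 (.inr ⟨c, by rw [hx, hz]⟩)) (hne z q hz)
    rcases hC.exists_front y with ⟨h1, h2⟩ | ⟨c, p, h⟩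
    · exact ⟨_, (hmem b _).2 ⟨front_mono h2 fun _ h => h.elim,
        hup _ [] (by simp [h1]) y.1.2 rfl⟩, y.1.2, rfl⟩
    · exact ⟨(i, [c]), (hmem b _).2 ⟨.inr ⟨c, trivial, rfl⟩, hup i [c] (by simp) p h⟩, p, h⟩
  have himg : ∀ b v, (∃ k, k < (K.componentPart i b).1.length ∧ addr (vs b) k = v) ↔ v ∈ vs b :=
    fun b => hC.exists_addr fun v hv => ((hmem b v).1 hv).1
  refine ⟨_, ⟨hpart, fun m => ?_, fun b l l' => ?_, fun v => ?_, fun b j k hj hk hjk => ?_,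
    fun b => (himg b _).2 (harg b)⟩, fun b v => (himg b v).trans (hmem b v)⟩
  · obtain ⟨b, h⟩ := (hK.notRoot_iff hC (.inr m)).1 nofun
    exact ⟨b, ⟨m, h⟩, rfl⟩
  · by_contra h
    have hne : l.1 ≠ l'.1 := fun h => hdisj b _ l.2 (h ▸ l'.2)
    exact hdisj b _ (l.2.of_adj (adj_inr_inr.2 ⟨hne, h⟩) nofun) l'.2
  · simp only [himg, hmem]
    constructor
    · rintro ⟨b, h, -⟩
      exact h
    · intro h
      obtain ⟨C, hv⟩ := hC.front_subAt h
      obtain ⟨b, hb⟩ := (hK.notRoot_iff hC (.inl ⟨v, C, hv⟩)).1 (by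
        rintro r hr
        obtain rfl := Sum.inl_injective hr
        exact hnr v h)
      exact ⟨b, h, _, rfl, hb⟩
  · obtain ⟨-, y, hy, h1⟩ := (hmem b _).1 ((himg b _).1 ⟨j, hj, rfl⟩)
    obtain ⟨-, z, hz, h2⟩ := (hmem (!b) _).1 ((himg (!b) _).1 ⟨k, hk, rfl⟩)
    obtain rfl : y = z := Subtype.ext (by rw [hy, hz, hjk])
    exact hdisj b _ h1 h2

/-! ### Sequentialization of erasable prelinkings -/

variable [Literals 𝒜]

/-- Readiness is exactly what makes erasure the inverse of a rule: the erased parts are the premises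
of that rule, so their proofs can be recombined. -/
theorem Ready.seq (h : K.Ready i) (hK : ∀ T ∈ K.erase i, T.2.Seq) : K.Seq := by
  obtain ⟨hc, h⟩ := h
  rcases hi : Γ[i]? with _ | (a | ⟨A, B⟩ | ⟨A, B⟩ | ⟨A, B⟩ | ⟨A, B⟩)
  · simp [hi] at h
  · simp [hi] at h
  · simp only [hi] at h
    simp only [erase, hi] at hK
    obtain ⟨f, r, -⟩ := isProd_componentPart hc (.inl hi) h
    exact r.seq hi fun b => by cases b <;> exact hK _ (by simp)
  · simp only [erase, hi] at hK
    have r := isUnary_restrict (K := K) (.inr (.inl hi)) (bs := [false, true]) (by simp) (by simp)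
    have hB : (fun b => b ∈ [false, true]) = fun _ => True := by ext b; simp
    rw [hB] at r
    exact r.seq_par hi (hK _ rfl)
  · simp only [hi] at h
    simp only [erase, hi] at hK
    exact (isSum_argumentPart (.inr (.inr (.inl hi))) h).seq hi fun b => by
      cases b <;> exact hK _ (by simp)
  · simp only [hi] at h
    simp only [erase, hi] at hK
    obtain ⟨b, hb⟩ := h
    have r := isUnary_restrict (K := K) (.inr (.inr (.inr hi))) (bs := [b]) (by simp)
      fun c hc => by
        obtain rfl : c = !b := by cases b <;> cases c <;> simp at *
        exact hb.2
    have hB : (fun c => c ∈ [b]) = fun c => c = b := by ext c; simp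
    rw [hB] at r
    exact r.seq_plus hi (hK _ ⟨b, hb, rfl⟩)

end Prelinking

/-- All prelinkings of a cluster are translations of proofs. -/
def Cluster.AllSeq [Literals 𝒜] : Cluster.{u} 𝒜 → Prop
  | .set X => ∀ T ∈ X, T.2.Seq
  | .error => False

/-- The invariant is read backwards along a rewrite. It is set to `False` at the error symbol, so a
step into the error needs no argument. -/
theorem Cluster.allSeq_of_erasure [Literals 𝒜] {Y Z : Cluster.{u} 𝒜} (h : Erasure Y Z)
    (hZ : Z.AllSeq) : Y.AllSeq := by
  cases h with
  | error Y h => exact hZ.elim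
  | root X T i hT hX hr =>
    rintro U (hU | rfl)
    · exact hZ U (.inl hU)
    · exact hr.seq fun V hV => hZ V (.inr hV)
  | ax X T hT hX hA =>
    rintro U (hU | rfl)
    · exact hZ U hU
    · exact hA.seq

theorem Linking.Erasable.sequentializable [Literals 𝒜] {Γ : Sequent 𝒜} {K : Linking.{u} Γ}
    (h : K.Erasable) : K.Sequentializable := by
  have : (Cluster.set {⟨Γ, K.toPrelinking⟩} : Cluster.{u} 𝒜).AllSeq := by
    refine Relation.ReflTransGen.head_induction_on (motive := fun Y _ => Y.AllSeq) h ?_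
      fun h _ ih => Cluster.allSeq_of_erasure h ih
    exact fun T hT => hT.elim
  exact this _ rfl

end

/-! ### Translations of proofs are connected slicings -/

section

variable {𝒜 : Type v}

/-! ### Connectedness -/

section Node

variable {Γ' Γ : Sequent 𝒜} {K : Prelinking.{u} Γ'} {M : Prelinking.{w} Γ} {f : ℕ → Pos}
  {e : K.Link → M.Link}

/-- The inclusion of the conflict graph of a part. -/
def Part.node (p : Part K M f e) : Vertex Γ' ⊕ K.Link → Vertex Γ ⊕ M.Link :=
  Sum.map p.vertex e

theorem Part.node_adj (p : Part K M f e) {s t : Vertex Γ' ⊕ K.Link}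
    (h : K.conflictGraph.Adj s t) : M.conflictGraph.Adj (p.node s) (p.node t) := by
  have key : ∀ (x y : Vertex Γ') (b : Bool), y.1 = (x.1.1, x.1.2 ++ [b]) →
      (p.vertex y).1 = ((p.vertex x).1.1, (p.vertex x).1.2 ++ [b]) := fun x y b h => by
    change shift f y.1 = ((f x.1.1).1, (f x.1.1).2 ++ x.1.2 ++ [b])
    rw [h, shift, List.append_assoc]
  have key' : ∀ (l : K.Link) (x : Vertex Γ'), (∃ z : Leaf Γ', z.1 = x.1 ∧ K.rel l z) →
      ∃ z : Leaf Γ, z.1 = (p.vertex x).1 ∧ M.rel (e l) z := by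
    rintro l x ⟨z, hz, hl⟩
    exact ⟨p.leaf z, congrArg (shift f) hz, (p.rel_leaf l z).2 hl⟩
  rcases s with x | l <;> rcases t with y | m
  · rw [Prelinking.adj_inl_inl] at h
    exact Prelinking.adj_inl_inl.2 (h.imp (fun ⟨b, h⟩ => ⟨b, key _ _ _ h⟩)
      fun ⟨b, h⟩ => ⟨b, key _ _ _ h⟩)
  · rw [Prelinking.adj_inl_inr] at h
    exact Prelinking.adj_inl_inr.2 (key' _ _ h)
  · rw [Prelinking.adj_inr_inl] at h
    exact Prelinking.adj_inr_inl.2 (key' _ _ h)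
  · rw [Prelinking.adj_inr_inr] at h
    exact Prelinking.adj_inr_inr.2 ⟨p.link_inj.ne h.1, by rw [p.adj]; exact h.2⟩

theorem Part.node_reachable (p : Part K M f e) {s t : Vertex Γ' ⊕ K.Link}
    (h : K.conflictGraph.Reachable s t) : M.conflictGraph.Reachable (p.node s) (p.node t) :=
  h.map ⟨p.node, p.node_adj⟩

end Node

theorem exists_root_reachable {Γ : Sequent 𝒜} (M : Prelinking.{w} Γ) (x : Vertex Γ) :
    ∃ y : Vertex Γ, y.1 = (x.1.1, []) ∧ M.conflictGraph.Reachable (.inl x) (.inl y) := by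
  refine exists_prefix_vertex (P := fun y => M.conflictGraph.Reachable (.inl x) (.inl y))
    (fun y z b p hy hz h => h.trans (SimpleGraph.Adj.reachable ?_)) x.1.2 x rfl (.refl _)
  exact Prelinking.adj_inl_inl.2 (.inr ⟨b, by rw [hy, hz]⟩)

section Parts

variable {ι : Type*} {Γ' : ι → Sequent 𝒜} {Γ : Sequent 𝒜} {K : ∀ b, Prelinking.{u} (Γ' b)}
  {M : Prelinking.{w} Γ} {f : ι → ℕ → Pos} {e : ∀ b, (K b).Link → M.Link}

/-- Every part is connected and contains a vertex of the tree of the `i`-th formula, so that tree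
glues the parts together. The other trees each contain a vertex of some part. -/
theorem connected_of_parts [Nonempty ι] (p : ∀ b, Part (K b) M (f b) (e b))
    (hK : ∀ b, (K b).Connected) (cover : ∀ m, ∃ b l, e b l = m)
    (hroot : ∀ j, j < Γ.length → ∃ b k, k < (Γ' b).length ∧ (f b k).1 = j) {i : ℕ}
    (hi : ∀ b, ∃ k, k < (Γ' b).length ∧ (f b k).1 = i) : M.Connected := by
  have hn : i < Γ.length := by
    obtain ⟨k, hk, rfl⟩ := hi (Classical.arbitrary ι)
    exact (p _).lt hk
  let root : ∀ {Δ : Sequent 𝒜} (j : ℕ), j < Δ.length → Vertex Δ := fun {Δ} j hj =>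
    ⟨(j, []), Δ[j], by rw [subAt_root, List.getElem?_eq_getElem hj]⟩
  have up : ∀ (x : Vertex Γ) (j : ℕ) (hj : j < Γ.length), x.1.1 = j →
      M.conflictGraph.Reachable (.inl x) (.inl (root j hj)) := by
    rintro x j hj rfl
    obtain ⟨y, hy, h⟩ := exists_root_reachable M x
    obtain rfl : y = root _ hj := Subtype.ext hy
    exact h
  have node : ∀ b s, M.conflictGraph.Reachable ((p b).node s) (.inl (root i hn)) := by
    intro b s
    obtain ⟨k, hk, hki⟩ := hi b
    exact ((p b).node_reachable ((hK b).2.preconnected s (.inl (root k hk)))).trans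
      (up _ _ hn hki)
  have all : ∀ s, M.conflictGraph.Reachable s (.inl (root i hn)) := by
    rintro (x | m)
    · obtain ⟨b, k, hk, hkj⟩ := hroot x.1.1 x.lt
      exact (up x _ x.lt rfl).trans ((up ((p b).vertex (root k hk)) _ x.lt hkj).symm.trans
        (node b (.inl (root k hk))))
    · obtain ⟨b, l, rfl⟩ := cover m
      exact node b (.inr l)
  obtain ⟨l⟩ := (hK (Classical.arbitrary ι)).1
  exact ⟨⟨e _ l⟩,
    { preconnected := fun s t => (all s).trans (all t).symm, nonempty := ⟨.inl (root i hn)⟩ }⟩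

/-! ### Contractibility -/

/-- A path on four vertices and its complement are both connected, so an induced conflict path
cannot be spread over parts with uniform coherence or uniform conflict between them. With conflict
across, one of the pairs 1–3, 2–4, 1–4 meets two parts and conflicts, unless all four links share a
part. With coherence across, conflicting neighbours share a part. -/
theorem contractible_of_parts (p : ∀ b, Part (K b) M (f b) (e b))
    (hK : ∀ b, Contractible (K b).space) (cover : ∀ m, ∃ b l, e b l = m)
    (cross : (∀ b c l l', b ≠ c → ¬ M.space.Adj (e b l) (e c l')) ∨
      ∀ b c l l', b ≠ c → M.space.Adj (e b l) (e c l')) : Contractible M.space := by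
  refine ⟨M.finite, fun x₁ x₂ x₃ x₄ hx h₁₂ h₂₃ h₃₄ => ?_⟩
  obtain ⟨b₁, l₁, rfl⟩ := cover x₁
  obtain ⟨b₂, l₂, rfl⟩ := cover x₂
  obtain ⟨b₃, l₃, rfl⟩ := cover x₃
  obtain ⟨b₄, l₄, rfl⟩ := cover x₄
  simp only [List.nodup_cons, List.mem_cons, List.not_mem_nil, or_false, not_or, List.nodup_nil,
    and_true, not_false_eq_true] at hx
  simp only [SimpleGraph.compl_adj, ne_eq] at *
  have same : b₁ = b₂ → b₂ = b₃ → b₃ = b₄ → (¬ e b₁ l₁ = e b₃ l₃ ∧ ¬ M.space.Adj (e b₁ l₁) (e b₃ l₃))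
      ∨ (¬ e b₂ l₂ = e b₄ l₄ ∧ ¬ M.space.Adj (e b₂ l₂) (e b₄ l₄)) ∨
      (¬ e b₁ l₁ = e b₄ l₄ ∧ ¬ M.space.Adj (e b₁ l₁) (e b₄ l₄)) := by
    rintro rfl rfl rfl
    have := (hK b₁).2 l₁ l₂ l₃ l₄
    simp only [List.nodup_cons, List.mem_cons, List.not_mem_nil, or_false, not_or,
      List.nodup_nil, and_true, not_false_eq_true, SimpleGraph.compl_adj, ne_eq] at this
    simp only [(p b₁).adj, (p b₁).link_inj.eq_iff] at *
    exact this hx h₁₂ h₂₃ h₃₄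
  rcases cross with h | h
  · by_cases h13 : b₁ = b₃
    · by_cases h24 : b₂ = b₄
      · by_cases h14 : b₁ = b₄
        · exact same (h14.trans h24.symm) (h24.trans (h14.symm.trans h13)) (h13.symm.trans h14)
        · exact .inr (.inr ⟨hx.1.2.2, h _ _ _ _ h14⟩)
      · exact .inr (.inl ⟨hx.2.1.2, h _ _ _ _ h24⟩)
    · exact .inl ⟨hx.1.2.1, h _ _ _ _ h13⟩
  · have eq : ∀ {b c l l'}, ¬ M.space.Adj (e b l) (e c l') → b = c := fun {b c l l'} h' => by
      by_contra hbc
      exact h' (h _ _ _ _ hbc)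
    exact same (eq h₁₂.2) (eq h₂₃.2) (eq h₃₄.2)

end Parts

/-! ### Maps to the coherence space of a sequent -/

theorem AdditiveSplit.ne {Γ : Sequent 𝒜} {x y : Pos} (h : AdditiveSplit Γ x y) : x ≠ y := by
  obtain ⟨i, s, p, q, b, A, B, rfl, rfl, -⟩ := h
  simp

/-- The two clauses of `IsMap` overlap: that coherent links have leaves not split at an additive
vertex is the contrapositive of reflecting conflict. What remains of preserving coherence is that
the leaves differ. -/
theorem isMap_iff {Γ : Sequent 𝒜} {L : Type u} {G : SimpleGraph L} {R : L → Leaf Γ → Prop} :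
    IsMap G (coh Γ) R ↔ ∀ l l' x x', R l x → R l' x' →
      (G.Adj l l' → x ≠ x') ∧ (AdditiveSplit Γ x.1 x'.1 → l ≠ l' ∧ ¬ G.Adj l l') := by
  constructor
  · rintro ⟨h1, h2⟩ l l' x x' hx hx'
    refine ⟨fun h => (h1 _ _ _ _ hx hx' h).1, fun h => ?_⟩
    have := h2 _ _ _ _ hx hx' ((SimpleGraph.compl_adj _ _ _).2
      ⟨fun hxx => h.ne (congrArg Subtype.val hxx), fun h' => h'.2 h⟩)
    exact (SimpleGraph.compl_adj _ _ _).1 this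
  · intro h
    refine ⟨fun l l' x x' hx hx' hl => ⟨(h _ _ _ _ hx hx').1 hl, fun hs =>
      ((h _ _ _ _ hx hx').2 hs).2 hl⟩, fun l l' x x' hx hx' hl => ?_⟩
    rw [SimpleGraph.compl_adj] at hl ⊢
    exact (h _ _ _ _ hx hx').2 (not_not.1 fun hs => hl.2 ⟨hl.1, hs⟩)

/-- Formulas of `Γ'` are never separated by an additive vertex of `Γ`. -/
def NoSplit (Γ' Γ : Sequent 𝒜) (f : ℕ → Pos) : Prop :=
  ∀ x y : Pos, x.1 < Γ'.length → y.1 < Γ'.length → x.1 ≠ y.1 →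
    ¬ AdditiveSplit Γ (shift f x) (shift f y)

/-- Two paths with common initial segment `a` cannot branch before the end of `a`. -/
theorem exists_append_of_split {a u v s p q : List Bool} {b : Bool} (h₁ : a ++ u = s ++ b :: p)
    (h₂ : a ++ v = s ++ (!b) :: q) : ∃ t, s = a ++ t := by
  induction a generalizing s with
  | nil => exact ⟨s, rfl⟩
  | cons c a ih =>
    cases s with
    | nil =>
      simp only [List.cons_append, List.nil_append, List.cons.injEq] at h₁ h₂
      have := h₁.1.symm.trans h₂.1
      simp at this
    | cons d s =>
      simp only [List.cons_append, List.cons.injEq] at h₁ h₂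
      obtain ⟨t, rfl⟩ := ih h₁.2 h₂.2
      exact ⟨t, by rw [h₁.1, List.cons_append]⟩

/-- Inside one formula of `Γ'` the branching vertex lies in that formula and is seen from both
sides; between different formulas, `NoSplit` excludes an additive one. -/
theorem IsEmb.split_iff {Γ' Γ : Sequent 𝒜} {f : ℕ → Pos} (h : IsEmb Γ' Γ f)
    (hf : NoSplit Γ' Γ f) {x y : Pos} (hx : x.1 < Γ'.length) (hy : y.1 < Γ'.length) :
    AdditiveSplit Γ (shift f x) (shift f y) ↔ AdditiveSplit Γ' x y := by
  constructor
  · intro hs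
    by_cases hxy : x.1 = y.1
    · obtain ⟨i, s, p, q, b, A, B, h1, h2, h3⟩ := hs
      obtain ⟨k, x⟩ := x
      obtain ⟨k', y⟩ := y
      obtain rfl : k = k' := hxy
      simp only [shift, Prod.mk.injEq] at h1 h2
      obtain ⟨t, rfl⟩ := exists_append_of_split h1.2 h2.2
      refine ⟨k, t, p, q, b, A, B, ?_, ?_, ?_⟩
      · have := h1.2
        rw [List.append_assoc, List.append_cancel_left_eq] at this
        rw [this]
      · have := h2.2
        rw [List.append_assoc, List.append_cancel_left_eq] at this
        rw [this]
      · rw [← h.subAt_shift (x := (k, t)) hx]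
        simpa only [shift, h1.1] using h3
    · exact absurd hs (hf _ _ hx hy hxy)
  · rintro ⟨i, s, p, q, b, A, B, rfl, rfl, h3⟩
    refine ⟨(f i).1, (f i).2 ++ s, p, q, b, A, B, by simp [shift], by simp [shift], ?_⟩
    rw [← h.subAt_shift (x := (i, s)) hx] at h3
    exact h3

/-- Only the `i`-th formula can contribute more than one address. So an additive split between
distinct premise formulas could occur only at its root, which is excluded when the root is ⊗ or ⅋ or
when just one argument is kept. -/
theorem front_index {Γ : Sequent 𝒜} {i : ℕ} {S : Bool → Prop} {v w : Pos} (hv : front Γ i S v)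
    (hw : front Γ i S w) (hvw : v ≠ w) (h : v.1 = w.1) :
    ∃ b, S b ∧ S (!b) ∧ v = (i, [b]) ∧ w = (i, [!b]) := by
  rcases hv with ⟨-, h1, h2⟩ | ⟨b, hb, rfl⟩ <;> rcases hw with ⟨-, h3, h4⟩ | ⟨c, hc, rfl⟩
  · exact absurd (Prod.ext h (h2.trans h4.symm)) hvw
  · exact absurd h h1
  · exact absurd h.symm h3
  · obtain rfl : c = !b := by
      cases b <;> cases c <;> simp at *
    exact ⟨b, hb, hc, rfl, rfl⟩

theorem not_split_arg {Γ : Sequent 𝒜} {i : ℕ} {A B : Formula 𝒜}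
    (hi : Γ[i]? = some (.tensor A B) ∨ Γ[i]? = some (.par A B)) {b c : Bool} (hbc : b ≠ c)
    (p q : List Bool) : ¬ AdditiveSplit Γ (i, b :: p) (i, c :: q) := by
  rintro ⟨j, s, p', q', b', A', B', h1, h2, h3⟩
  cases s with
  | nil =>
    simp only [Prod.mk.injEq] at h1
    rw [← h1.1, subAt_root] at h3
    rcases hi with hi | hi <;> simp [hi] at h3
  | cons d s =>
    simp only [List.cons_append, Prod.mk.injEq, List.cons.injEq] at h1 h2
    exact hbc (h1.2.1.trans h2.2.1.symm)

theorem AdditiveSplit.index {Γ : Sequent 𝒜} {x y : Pos} (h : AdditiveSplit Γ x y) :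
    x.1 = y.1 := by
  obtain ⟨i, s, p, q, b, A, B, rfl, rfl, -⟩ := h
  rfl

theorem not_split_front {Γ : Sequent 𝒜} {i : ℕ} {A B : Formula 𝒜}
    (hi : Γ[i]? = some (.tensor A B) ∨ Γ[i]? = some (.par A B)) {v w : Pos}
    (hv : front Γ i (fun _ => True) v) (hw : front Γ i (fun _ => True) w) (hvw : v ≠ w)
    (p q : List Bool) : ¬ AdditiveSplit Γ (v.1, v.2 ++ p) (w.1, w.2 ++ q) := by
  intro hs
  obtain ⟨b, -, -, rfl, rfl⟩ := front_index hv hw hvw hs.index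
  exact not_split_arg hi (by simp) p q hs

theorem IsEmb.ne_of_ne {Γ' Γ : Sequent 𝒜} {f : ℕ → Pos} (h : IsEmb Γ' Γ f) {j k : ℕ}
    (hj : j < Γ'.length) (hk : k < Γ'.length) (hjk : j ≠ k) : f j ≠ f k := fun h' =>
  hjk (congrArg Prod.fst (h.inj (j, []) (k, []) hj hk (by rw [shift_nil, shift_nil, h'])))

theorem IsEmb.noSplit {Γ' Γ : Sequent 𝒜} {f : ℕ → Pos} (h : IsEmb Γ' Γ f) {i : ℕ}
    {A B : Formula 𝒜} (hi : Γ[i]? = some (.tensor A B) ∨ Γ[i]? = some (.par A B))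
    (hf : ∀ k, k < Γ'.length → front Γ i (fun _ => True) (f k)) : NoSplit Γ' Γ f :=
  fun _ _ hx hy hxy => not_split_front hi (hf _ hx) (hf _ hy) (h.ne_of_ne hx hy hxy) _ _

theorem IsEmb.noSplit_single {Γ' Γ : Sequent 𝒜} {f : ℕ → Pos} (h : IsEmb Γ' Γ f) {i : ℕ}
    {b : Bool} (hf : ∀ k, k < Γ'.length → front Γ i (fun c => c = b) (f k)) :
    NoSplit Γ' Γ f := by
  intro x y hx hy hxy hs
  obtain ⟨c, h1, h2, -⟩ := front_index (hf _ hx) (hf _ hy) (h.ne_of_ne hx hy hxy) hs.index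
  simpa using h2.trans h1.symm

theorem IsPerm.noSplit {Γ' Γ : Sequent 𝒜} {K : Prelinking.{u} Γ'} {M : Prelinking.{w} Γ}
    {f : ℕ → Pos} {e : K.Link → M.Link} (p : IsPerm K M f e) : NoSplit Γ' Γ f := by
  intro x y hx hy hxy hs
  refine p.ne_of_ne hx hy hxy ?_
  rw [p.root hx, p.root hy]
  exact congrArg (fun j => (j, [])) hs.index

theorem Part.isMap_pullback {Γ' Γ : Sequent 𝒜} {K : Prelinking.{u} Γ'} {M : Prelinking.{w} Γ}
    {f : ℕ → Pos} {e : K.Link → M.Link} (p : Part K M f e) (hf : NoSplit Γ' Γ f)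
    {R : M.Link → Leaf Γ → Prop} (hR : IsMap M.space (coh Γ) R) :
    IsMap K.space (coh Γ') fun l x => R (e l) (p.leaf x) := by
  rw [isMap_iff] at hR ⊢
  intro l l' x x' hx hx'
  have := hR _ _ _ _ hx hx'
  rw [p.adj, p.link_inj.ne_iff, p.leaf_injective.ne_iff] at this
  exact ⟨this.1, fun h => this.2 ((p.split_iff hf x.lt x'.lt).2 h)⟩

theorem isMap_of_parts {ι : Type*} {Γ' : ι → Sequent 𝒜} {Γ : Sequent 𝒜}
    {K : ∀ b, Prelinking.{u} (Γ' b)} {M : Prelinking.{w} Γ} {f : ι → ℕ → Pos}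
    {e : ∀ b, (K b).Link → M.Link} (p : ∀ b, Part (K b) M (f b) (e b))
    (hf : ∀ b, NoSplit (Γ' b) Γ (f b)) (hK : ∀ b, IsMap (K b).space (coh (Γ' b)) (K b).rel)
    (cover : ∀ m, ∃ b l, e b l = m)
    (cross : ∀ b c l l' x x', b ≠ c →
      (M.space.Adj (e b l) (e c l') → (p b).leaf x ≠ (p c).leaf x') ∧
      (AdditiveSplit Γ ((p b).leaf x).1 ((p c).leaf x').1 → e b l ≠ e c l' ∧
        ¬ M.space.Adj (e b l) (e c l'))) : IsMap M.space (coh Γ) M.rel := by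
  rw [isMap_iff]
  intro m m' y y' hy hy'
  obtain ⟨b, l, rfl⟩ := cover m
  obtain ⟨c, l', rfl⟩ := cover m'
  obtain ⟨x, hx, hl⟩ := ((p b).rel _ _).1 hy
  obtain ⟨x', hx', hl'⟩ := ((p c).rel _ _).1 hy'
  obtain rfl : y = (p b).leaf x := Subtype.ext hx
  obtain rfl : y' = (p c).leaf x' := Subtype.ext hx'
  by_cases hbc : b = c
  · subst hbc
    have := isMap_iff.1 (hK b) _ _ _ _ hl hl'
    rw [(p b).adj, (p b).link_inj.ne_iff, (p b).leaf_injective.ne_iff]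
    exact ⟨this.1, fun h => this.2 (((p b).split_iff (hf b) x.lt x'.lt).1 h)⟩
  · exact cross b c l l' x x' hbc

/-! ### Invariants of translations -/

/-- Every link, or a link that is strictly coherent with it, has a leaf in any given formula. -/
def Prelinking.Total {Γ : Sequent 𝒜} (K : Prelinking.{u} Γ) : Prop :=
  ∀ l j, j < Γ.length → ∃ l', (l' = l ∨ K.space.Adj l l') ∧ ∃ x, K.rel l' x ∧ x.1.1 = j

/-- The properties of the translation of a proof. -/
structure Prelinking.Sound {Γ : Sequent 𝒜} (K : Prelinking.{u} Γ) : Prop where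
  ne_nil : 0 < Γ.length
  connected : K.Connected
  total : K.Total
  contractible : Contractible K.space
  maximal : Maximal (IsMap K.space (coh Γ)) K.rel

theorem Part.total {Γ' Γ : Sequent 𝒜} {K : Prelinking.{u} Γ'} {M : Prelinking.{w} Γ}
    {f : ℕ → Pos} {e : K.Link → M.Link} (p : Part K M f e) (hK : K.Total) (l : K.Link) {k : ℕ}
    (hk : k < Γ'.length) : ∃ l', (e l' = e l ∨ M.space.Adj (e l) (e l')) ∧
      ∃ y q, M.rel (e l') y ∧ y.1 = ((f k).1, (f k).2 ++ q) := by
  obtain ⟨l', h, x, hx, rfl⟩ := hK l k hk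
  exact ⟨l', h.imp (congrArg e) (p.adj _ _).2, p.leaf x, x.1.2, (p.rel_leaf _ _).2 hx, rfl⟩

/-- The hypothesis `hout` reduces maximality to the parts: a larger map relates links of a part only
to leaves of that part, so its pullbacks are maps that extend the maximal maps of the premises.
Proving `hout` is the real work for each rule. -/
theorem Prelinking.Sound.of_parts {ι : Type*} [Nonempty ι] {Γ' : ι → Sequent 𝒜} {Γ : Sequent 𝒜}
    {K : ∀ b, Prelinking.{u} (Γ' b)} {M : Prelinking.{w} Γ} {f : ι → ℕ → Pos}
    {e : ∀ b, (K b).Link → M.Link} (p : ∀ b, Part (K b) M (f b) (e b)) (hK : ∀ b, (K b).Sound)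
    (hf : ∀ b, NoSplit (Γ' b) Γ (f b)) (cover : ∀ m, ∃ b l, e b l = m)
    (hroot : ∀ j, j < Γ.length → ∃ b k, k < (Γ' b).length ∧ (f b k).1 = j) {i : ℕ}
    (hi : ∀ b, ∃ k, k < (Γ' b).length ∧ (f b k).1 = i) (total : M.Total)
    (cross : (∀ b c l l', b ≠ c → e b l ≠ e c l' ∧ ¬ M.space.Adj (e b l) (e c l')) ∨
      ∀ b c l l', b ≠ c → M.space.Adj (e b l) (e c l') ∧
        ∀ x x', (p b).leaf x ≠ (p c).leaf x' ∧
          ¬ AdditiveSplit Γ ((p b).leaf x).1 ((p c).leaf x').1)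
    (hout : ∀ R, IsMap M.space (coh Γ) R → M.rel ≤ R → ∀ b l y, R (e b l) y →
      ∃ x, y = (p b).leaf x) : M.Sound where
  ne_nil := by
    obtain ⟨k, hk, -⟩ := hi (Classical.arbitrary ι)
    exact Nat.zero_lt_of_lt ((p _).lt hk)
  connected := connected_of_parts p (fun b => (hK b).connected) cover hroot hi
  total := total
  contractible := contractible_of_parts p (fun b => (hK b).contractible) cover
    (cross.imp (fun h b c l l' hbc => (h b c l l' hbc).2) fun h b c l l' hbc => (h b c l l' hbc).1)
  maximal := by
    refine ⟨isMap_of_parts p hf (fun b => (hK b).maximal.1) cover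
      fun b c l l' x x' hbc => ?_, fun R hR hle m y hy => ?_⟩
    · rcases cross with h | h
      · exact ⟨fun h' => absurd h' (h _ _ _ _ hbc).2, fun _ => h _ _ _ _ hbc⟩
      · have := (h b c l l' hbc).2 x x'
        exact ⟨fun _ => this.1, fun h' => absurd h' this.2⟩
    · obtain ⟨b, l, rfl⟩ := cover m
      obtain ⟨x, rfl⟩ := hout R hR hle b l y hy
      exact ((p b).rel_leaf l x).2 ((hK b).maximal.2 ((p b).isMap_pullback (hf b) hR)
        (fun l x hx => hle _ _ (((p b).rel_leaf l x).2 hx)) l x hy)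

theorem Part.exists_leaf {Γ' Γ : Sequent 𝒜} {K : Prelinking.{u} Γ'} {M : Prelinking.{w} Γ}
    {f : ℕ → Pos} {e : K.Link → M.Link} (p : Part K M f e) {y : Leaf Γ} {v : Pos}
    {q : List Bool} (hy : y.1 = (v.1, v.2 ++ q)) (hv : ∃ k, k < Γ'.length ∧ f k = v) :
    ∃ x, y = p.leaf x := by
  obtain ⟨k, hk, rfl⟩ := hv
  have hy : y.1 = shift f (k, q) := hy
  exact ⟨⟨(k, q), by rw [← p.subAt_shift (x := (k, q)) hk, ← hy]; exact y.2⟩, Subtype.ext hy⟩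

theorem IsPerm.exists_leaf {Γ' Γ : Sequent 𝒜} {K : Prelinking.{u} Γ'} {M : Prelinking.{w} Γ}
    {f : ℕ → Pos} {e : K.Link → M.Link} (p : IsPerm K M f e) (y : Leaf Γ) :
    ∃ x, y = p.leaf x :=
  p.toPart.exists_leaf (v := (y.1.1, [])) (q := y.1.2) rfl (p.full _ y.lt)

theorem IsPerm.sound {Γ' Γ : Sequent 𝒜} {K : Prelinking.{u} Γ'} {M : Prelinking.{w} Γ}
    {f : ℕ → Pos} {e : K.Link → M.Link} (p : IsPerm K M f e) (hK : K.Sound) : M.Sound := by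
  refine .of_parts (ι := Unit) (fun _ => p.toPart) (fun _ => hK) (fun _ => p.noSplit)
    (fun m => ⟨(), p.surj m⟩) (fun j hj => ?_) (fun _ => ⟨0, hK.ne_nil, rfl⟩)
    (fun m j hj => ?_) (.inl (by simp)) fun R _ _ _ l y _ => p.exists_leaf y
  · obtain ⟨k, hk, h⟩ := p.full j hj
    exact ⟨(), k, hk, by rw [h]⟩
  · obtain ⟨l, rfl⟩ := p.surj m
    obtain ⟨k, hk, h⟩ := p.full j hj
    obtain ⟨l', h1, y, q, h2, h3⟩ := p.toPart.total hK.total l hk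
    exact ⟨e l', h1, y, h2, by rw [h3, h]⟩

theorem front_cover {Γ : Sequent 𝒜} {i : ℕ} {S : Bool → Prop} (hS : ∃ b, S b) {j : ℕ}
    (hj : j < Γ.length) : ∃ v, front Γ i S v ∧ v.1 = j := by
  by_cases h : j = i
  · obtain ⟨b, hb⟩ := hS
    exact ⟨(i, [b]), .inr ⟨b, hb, rfl⟩, h.symm⟩
  · exact ⟨(j, []), .inl ⟨hj, h, rfl⟩, rfl⟩

section Single

variable {Γ' Γ : Sequent 𝒜} {K : Prelinking.{u} Γ'} {M : Prelinking.{w} Γ} {f : ℕ → Pos}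
  {e : K.Link → M.Link} {i : ℕ} {A B : Formula 𝒜}

/-- An extension of a linking cannot have a link between different arguments of an additive
formula. -/
theorem Part.exists_leaf_of_additive (p : Part K M f e) (hK : K.Total) {b : Bool}
    (hi : Γ[i]? = some (.amp A B) ∨ Γ[i]? = some (.plus A B))
    (hf : ∀ v, (∃ k, k < Γ'.length ∧ f k = v) ↔ front Γ i (fun c => c = b) v)
    {R : M.Link → Leaf Γ → Prop} (hR : IsMap M.space (coh Γ) R) (hle : M.rel ≤ R) {l : K.Link}
    {y : Leaf Γ} (hy : R (e l) y) : ∃ x, y = p.leaf x := by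
  have hC : HasArgs Γ i A B := .inr (.inr hi)
  rcases hC.exists_front y with ⟨h1, h2⟩ | ⟨c, q, h⟩
  · exact p.exists_leaf (v := (y.1.1, [])) (q := y.1.2) rfl
      ((hf _).2 (front_mono h2 fun _ h => h.elim))
  · by_cases hcb : c = b
    · exact p.exists_leaf (v := (i, [c])) (q := q) h ((hf _).2 (.inr ⟨c, hcb, rfl⟩))
    · exfalso
      obtain rfl : c = !b := by cases b <;> cases c <;> simp at *
      obtain ⟨k, hk, hki⟩ := (hf (i, [b])).2 (.inr ⟨b, rfl, rfl⟩)
      -- Totality gives a link equal to or coherent with `l` that has a leaf `z` in argument `b`. As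
      -- `y` and `z` split at the additive root, a map would force the two links to conflict.
      obtain ⟨l', h1, z, q', h2, h3⟩ := p.total hK l hk
      have := (isMap_iff.1 hR _ _ _ _ hy (hle _ _ h2)).2 ⟨i, [], q, q', !b, A, B, h, by
        rw [h3, hki]; simp, by rwa [subAt_root]⟩
      rcases h1 with h1 | h1
      · exact this.1 h1.symm
      · exact this.2 h1

theorem IsUnary.total {S : Bool → Prop} (r : IsUnary K M i S f e) (hS : ∃ b, S b)
    (hK : K.Total) : M.Total := by
  intro m j hj
  obtain ⟨l, rfl⟩ := r.surj m
  obtain ⟨v, hv, rfl⟩ := front_cover (i := i) hS hj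
  obtain ⟨k, hk, rfl⟩ := (r.image v).2 hv
  obtain ⟨l', h1, y, q, h2, h3⟩ := r.toPart.total hK l hk
  exact ⟨e l', h1, y, h2, by rw [h3]⟩

theorem IsUnary.sound_par (r : IsUnary K M i (fun _ => True) f e)
    (hi : Γ[i]? = some (.par A B)) (hK : K.Sound) : M.Sound := by
  have hC : HasArgs Γ i A B := .inr (.inl hi)
  refine .of_parts (ι := Unit) (i := i) (fun _ => r.toPart) (fun _ => hK)
    (fun _ => r.noSplit (.inr hi) fun k hk => (r.image _).1 ⟨k, hk, rfl⟩)
    (fun m => ⟨(), r.surj m⟩) (fun j hj => ?_) (fun _ => ?_)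
    (r.total ⟨true, trivial⟩ hK.total) (.inl (by simp)) fun R _ _ _ l y _ => ?_
  · obtain ⟨v, hv, rfl⟩ := front_cover (i := i) (S := fun _ => True) ⟨true, trivial⟩ hj
    obtain ⟨k, hk, rfl⟩ := (r.image v).2 hv
    exact ⟨(), k, hk, rfl⟩
  · obtain ⟨k, hk, h⟩ := (r.image (i, [true])).2 (.inr ⟨true, trivial, rfl⟩)
    exact ⟨k, hk, by rw [h]⟩
  · rcases hC.exists_front y with ⟨h1, h2⟩ | ⟨c, q, h⟩
    · exact r.exists_leaf (v := (y.1.1, [])) (q := y.1.2) rfl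
        ((r.image _).2 (front_mono h2 fun _ h => h.elim))
    · exact r.exists_leaf (v := (i, [c])) (q := q) h ((r.image _).2 (.inr ⟨c, trivial, rfl⟩))

theorem IsUnary.sound_plus {b : Bool} (r : IsUnary K M i (fun c => c = b) f e)
    (hi : Γ[i]? = some (.plus A B)) (hK : K.Sound) : M.Sound := by
  refine .of_parts (ι := Unit) (i := i) (fun _ => r.toPart) (fun _ => hK)
    (fun _ => r.noSplit_single fun k hk => (r.image _).1 ⟨k, hk, rfl⟩)
    (fun m => ⟨(), r.surj m⟩) (fun j hj => ?_) (fun _ => ?_)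
    (r.total ⟨b, rfl⟩ hK.total) (.inl (by simp)) fun R hR hle _ l y hy =>
      r.exists_leaf_of_additive hK.total (.inr hi) r.image hR hle hy
  · obtain ⟨v, hv, rfl⟩ := front_cover (i := i) (S := fun c => c = b) ⟨b, rfl⟩ hj
    obtain ⟨k, hk, rfl⟩ := (r.image v).2 hv
    exact ⟨(), k, hk, rfl⟩
  · obtain ⟨k, hk, h⟩ := (r.image (i, [b])).2 (.inr ⟨b, rfl, rfl⟩)
    exact ⟨k, hk, by rw [h]⟩

end Single

section Family

variable {Γ' : Bool → Sequent 𝒜} {Γ : Sequent 𝒜} {K : ∀ b, Prelinking.{u} (Γ' b)}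
  {M : Prelinking.{w} Γ} {i : ℕ} {A B : Formula 𝒜} {f : Bool → ℕ → Pos}
  {e : ∀ b, (K b).Link → M.Link}

theorem IsSum.sound (r : IsSum K M i f e) (hi : Γ[i]? = some (.amp A B))
    (hK : ∀ b, (K b).Sound) : M.Sound := by
  have hroot : ∀ b j, j < Γ.length → ∃ k, k < (Γ' b).length ∧ (f b k).1 = j := fun b j hj => by
    obtain ⟨v, hv, rfl⟩ := front_cover (i := i) (S := fun c => c = b) ⟨b, rfl⟩ hj
    obtain ⟨k, hk, rfl⟩ := (r.image b v).2 hv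
    exact ⟨k, hk, rfl⟩
  refine .of_parts (i := i) r.part hK
    (fun b => (r.part b).noSplit_single fun k hk => (r.image b _).1 ⟨k, hk, rfl⟩)
    r.cover (fun j hj => ⟨true, hroot true j hj⟩)
    (fun b => hroot b i (HasArgs.lt (A := A) (B := B) (.inr (.inr (.inl hi)))))
    (fun m j hj => ?_) (.inl fun b c l l' hbc => ?_) fun R hR hle b l y hy =>
      (r.part b).exists_leaf_of_additive (hK b).total (.inl hi) (r.image b) hR hle hy
  · obtain ⟨b, l, rfl⟩ := r.cover m
    obtain ⟨k, hk, rfl⟩ := hroot b j hj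
    obtain ⟨l', h1, y, q, h2, h3⟩ := (r.part b).total (hK b).total l hk
    exact ⟨e b l', h1, y, h2, by rw [h3]⟩
  · obtain rfl : c = !b := by cases b <;> cases c <;> simp at *
    exact ⟨r.sep b l l', r.cross b l l'⟩

theorem IsProd.front (r : IsProd K M i f e) {b : Bool} {k : ℕ} (hk : k < (Γ' b).length) :
    front Γ i (fun _ => True) (f b k) := (r.image _).1 ⟨b, k, hk, rfl⟩

theorem IsProd.shift_ne (r : IsProd K M i f e) {b : Bool} {x x' : Pos}
    (hx : x.1 < (Γ' b).length) (hx' : x'.1 < (Γ' !b).length) :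
    shift (f b) x ≠ shift (f !b) x' := by
  intro h
  simp only [shift, Prod.mk.injEq] at h
  exact r.disj b _ _ hx hx' (Prod.ext h.1 (List.append_inj h.2 (by
    rw [front_length (r.front hx), front_length (r.front hx'), h.1])).1)

theorem IsProd.sound (r : IsProd K M i f e) (hi : Γ[i]? = some (.tensor A B))
    (hK : ∀ b, (K b).Sound) : M.Sound := by
  have hC : HasArgs Γ i A B := .inl hi
  have hroot : ∀ j, j < Γ.length → ∃ b k, k < (Γ' b).length ∧ (f b k).1 = j := fun j hj => by
    obtain ⟨v, hv, rfl⟩ := front_cover (i := i) (S := fun _ => True) ⟨true, trivial⟩ hj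
    obtain ⟨b, k, hk, rfl⟩ := (r.image v).2 hv
    exact ⟨b, k, hk, rfl⟩
  have hne : ∀ {b c : Bool}, b ≠ c → c = !b := fun {b c} h => by cases b <;> cases c <;> simp at *
  have hleaf : ∀ b (x : Leaf (Γ' b)) (x' : Leaf (Γ' !b)),
      ¬ AdditiveSplit Γ ((r.part b).leaf x).1 ((r.part (!b)).leaf x').1 ∧
      (r.part b).leaf x ≠ (r.part (!b)).leaf x' := by
    intro b x x'
    exact ⟨not_split_front (.inl hi) (r.front x.lt) (r.front x'.lt) (r.disj b _ _ x.lt x'.lt) _ _,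
      fun h => r.shift_ne x.lt x'.lt (congrArg Subtype.val h)⟩
  refine .of_parts (i := i) r.part hK (fun b => (r.part b).noSplit (.inl hi) fun k hk => r.front hk)
    r.cover hroot (fun b => ?_) (fun m j hj => ?_) (.inr fun b c l l' hbc => ?_)
    fun R hR hle b l y hy => ?_
  · obtain ⟨k, hk, h⟩ := r.arg b
    exact ⟨k, hk, by rw [h]⟩
  · obtain ⟨b, l, rfl⟩ := r.cover m
    obtain ⟨c, k, hk, rfl⟩ := hroot j hj
    by_cases hbc : b = c
    · subst hbc
      obtain ⟨l', h1, y, q, h2, h3⟩ := (r.part b).total (hK b).total l hk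
      exact ⟨e b l', h1, y, h2, by rw [h3]⟩
    · obtain rfl := hne hbc
      -- The wanted formula lies in the other premise, where any link is coherent with `e b l`;
      -- totality may thus start from an arbitrary link there.
      obtain ⟨l₀⟩ := (hK !b).connected.1
      obtain ⟨l', h1, y, q, h2, h3⟩ := (r.part !b).total (hK !b).total l₀ hk
      exact ⟨e (!b) l', .inr (r.cross b l l'), y, h2, by rw [h3]⟩
  · obtain rfl := hne hbc
    exact ⟨r.cross b l l', fun x x' => ⟨(hleaf b x x').2, (hleaf b x x').1⟩⟩
  · have hcase : ∃ c x, y = (r.part c).leaf x := by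
      rcases hC.exists_front y with ⟨h1, h2⟩ | ⟨c, q, h⟩
      · obtain ⟨c, hc⟩ := (r.image _).2 (front_mono h2 fun _ h => h.elim)
        exact ⟨c, (r.part c).exists_leaf (v := (y.1.1, [])) (q := y.1.2) rfl hc⟩
      · exact ⟨c, (r.part c).exists_leaf (v := (i, [c])) (q := q) h (r.arg c)⟩
    obtain ⟨c, x, rfl⟩ := hcase
    by_cases hbc : b = c
    · subst hbc
      exact ⟨x, rfl⟩
    · exfalso
      obtain rfl := hne hbc
      obtain ⟨l₀⟩ := (hK !b).connected.1
      -- Suppose that `e b l` is related to a leaf `x` of the other premise. It is coherent with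
      -- every link there, so `x` differs from all leaves of these links and is not split from any
      -- of them.
      have hx : ∀ l' x', (K !b).rel l' x' → x ≠ x' ∧ ¬ AdditiveSplit (Γ' !b) x.1 x'.1 := by
        intro l' x' hl'
        have := isMap_iff.1 hR _ _ _ _ hy (hle _ _ (((r.part !b).rel_leaf l' x').2 hl'))
        refine ⟨fun h => this.1 (r.cross b l l') (by rw [h]), fun h => ?_⟩
        exact (this.2 (((r.part !b).split_iff ((r.part !b).noSplit (.inl hi) fun k hk => r.front hk) x.lt
          x'.lt).2 h)).2 (r.cross b l l')
      -- Such a leaf can be added to any link `l₀` of the other premise. By maximality it was a leaf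
      -- of `l₀` already, so `hx` says that it differs from itself.
      have hmap : IsMap (K !b).space (coh (Γ' !b)) fun l' x' =>
          (K !b).rel l' x' ∨ l' = l₀ ∧ x' = x := by
        rw [isMap_iff]
        rintro l₁ l₂ x₁ x₂ (h₁ | ⟨rfl, rfl⟩) (h₂ | ⟨rfl, rfl⟩)
        · exact isMap_iff.1 (hK !b).maximal.1 _ _ _ _ h₁ h₂
        · have := hx _ _ h₁
          exact ⟨fun _ => this.1.symm, fun h => absurd h.symm this.2⟩
        · have := hx _ _ h₂
          exact ⟨fun _ => this.1, fun h => absurd h this.2⟩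
        · exact ⟨fun h => absurd rfl h.ne, fun h => absurd rfl h.ne⟩
      exact (hx l₀ x ((hK !b).maximal.2 hmap (fun _ _ h => .inl h) l₀ x (.inr ⟨rfl, rfl⟩))).1 rfl

end Family

variable [Literals 𝒜]

/-- There is only one link, it is related to all leaves, and a sequent of literals has no branching
vertices, so nothing can violate the map conditions or enlarge the relation. -/
theorem Proof.sound_ax (P : 𝒜) : (Proof.ax P).translation.Sound := by
  have hlit : ∀ j (b : Bool) (p : List Bool),
      subAt [Formula.lit P, .lit (Literals.dual P)] (j, b :: p) = none := by
    intro j b p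
    rcases j with _ | _ | j <;> simp [subAt, Formula.subAt]
  have hleaf : ∀ j, j < 2 →
      ∃ x : Leaf [Formula.lit P, .lit (Literals.dual P)], x.1 = (j, []) := by
    intro j hj
    interval_cases j
    · exact ⟨⟨(0, []), P, rfl⟩, rfl⟩
    · exact ⟨⟨(1, []), _, rfl⟩, rfl⟩
  refine ⟨by simp, ⟨⟨()⟩, { preconnected := ?_, nonempty := ⟨.inr ()⟩ }⟩, fun l j hj => ?_, ?_, ?_⟩
  · have all : ∀ s, (Proof.ax P).translation.conflictGraph.Reachable s (.inr ()) := by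
      rintro (x | ⟨⟩)
      · refine SimpleGraph.Adj.reachable (Prelinking.adj_inl_inr.2 ?_)
        obtain ⟨⟨j, p⟩, hx⟩ := x
        cases p with
        | nil =>
          obtain ⟨z, hz⟩ := hleaf j (lt_of_subAt hx.choose_spec)
          exact ⟨z, hz, trivial⟩
        | cons b p => simp [hlit] at hx
      · exact .refl _
    exact fun s t => (all s).trans (all t).symm
  · obtain ⟨x, hx⟩ := hleaf j hj
    exact ⟨(), .inl rfl, x, trivial, by rw [hx]⟩
  · refine ⟨inferInstanceAs (Finite Unit), fun x₁ x₂ _ _ _ h => ?_⟩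
    exact absurd (Subsingleton.elim (α := Unit) x₁ x₂) h.ne
  · refine ⟨isMap_iff.2 fun l l' x x' _ _ => ⟨fun h => h.elim, fun h => ?_⟩,
      fun R _ _ l x _ => trivial⟩
    obtain ⟨i, s, p, q, b, A, B, h1, -⟩ := h
    obtain ⟨a, ha⟩ := x.2
    rw [h1] at ha
    cases s <;> simp [hlit] at ha

theorem Proof.sound {Γ : Sequent 𝒜} (π : Proof Γ) : π.translation.Sound := by
  induction π with
  | ax P => exact sound_ax P
  | perm σ π ih => exact (isPerm_perm σ π).sound ih
  | @par Γ A B π ih => exact (isUnary_par π).sound_par (A := A) (B := B) (by simp) ih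
  | @plus Γ A B b π ih => exact (isUnary_plus b π).sound_plus (A := A) (B := B) (by simp) ih
  | @tensor Γ Δ A B π ρ ihπ ihρ =>
    exact (isProd_tensor (A := A) (B := B) fun | false => π | true => ρ).sound (A := A) (B := B)
      (by simp) fun | false => ihπ | true => ihρ
  | @amp Γ A B π ρ ihπ ihρ =>
    exact (isSum_amp (A := A) (B := B) fun | false => π | true => ρ).sound (A := A) (B := B)
      (by simp) fun | false => ihπ | true => ihρ

end

/-! ### Translations of proofs can be erased -/

section

variable {𝒜 : Type v}

/-! ### Readiness of the last rule -/

section Single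

variable {Γ' Γ'' Γ : Sequent 𝒜} {K : Prelinking.{u} Γ'} {M : Prelinking.{w} Γ} {f : ℕ → Pos}
  {e : K.Link → M.Link} {i : ℕ} {A B : Formula 𝒜}

theorem IsUnary.isPerm {K' : Prelinking.{u'} Γ''} {f' : ℕ → Pos} {e' : K'.Link → M.Link}
    {S : Bool → Prop} (r : IsUnary K M i S f e) (r' : IsUnary K' M i S f' e') :
    ∃ g h, IsPerm K K' g h := by
  obtain ⟨g, h, p, -⟩ := r.toPart.isPerm r'.toPart (fun v => by rw [r.image, r'.image])
    fun m => iff_of_true (r.surj m) (r'.surj m)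
  exact ⟨g, h, p⟩

/-- Totality, started at `l`, yields a link of `S` that touches argument `b`; the other argument is
untouched because links of the part have leaves only in the part. -/
theorem Part.chooses (p : Part K M f e) (hK : K.Total) {b : Bool}
    (hf : ∀ v, (∃ k, k < Γ'.length ∧ f k = v) ↔ front Γ i (fun c => c = b) v) {S : Set M.Link}
    {l : K.Link} (hl : e l ∈ S) (hS : ∀ m ∈ S, ∃ l, e l = m)
    (hadj : ∀ m, M.space.Adj (e l) m → m ∈ S) : M.Chooses S i b := by
  constructor
  · obtain ⟨k, hk, hki⟩ := (hf (i, [b])).2 (.inr ⟨b, rfl, rfl⟩)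
    obtain ⟨l', h1, y, q, h2, h3⟩ := p.total hK l hk
    refine ⟨e l', ?_, y, h2, q, by rw [h3, hki]; rfl⟩
    rcases h1 with h1 | h1
    · rwa [h1]
    · exact hadj _ h1
  · rintro ⟨m, hm, y, hy, q, hq⟩
    obtain ⟨l', rfl⟩ := hS m hm
    obtain ⟨x, hx, -⟩ := (p.rel _ _).1 hy
    rw [hq] at hx
    simp only [shift, Prod.mk.injEq] at hx
    rcases (hf _).1 ⟨x.1.1, x.lt, rfl⟩ with ⟨-, h, -⟩ | ⟨c, rfl, h⟩
    · exact h hx.1.symm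
    · rw [h] at hx
      simp at hx

theorem IsUnary.chooses {b : Bool} (r : IsUnary K M i (fun c => c = b) f e) (hK : K.Total)
    (hne : Nonempty K.Link) : M.Chooses Set.univ i b :=
  r.toPart.chooses hK r.image (l := hne.some) trivial (fun m _ => r.surj m) fun _ _ => trivial

end Single

section Family

variable {Γ' : Bool → Sequent 𝒜} {Γ : Sequent 𝒜} {K : ∀ b, Prelinking.{u} (Γ' b)}
  {M : Prelinking.{w} Γ} {i : ℕ} {A B : Formula 𝒜} {f : Bool → ℕ → Pos}
  {e : ∀ b, (K b).Link → M.Link}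

/-- A piece that meets the part `b` stays inside it, since no coherence edge leads to the other
part. Being closed under coherence, it satisfies the conditions of `Part.chooses`. -/
theorem IsSum.chooses_iff (r : IsSum K M i f e) (hK : ∀ b, (K b).Total) {S : Set M.Link}
    (hS : M.IsPiece S) {b : Bool} {l : (K b).Link} (hl : e b l ∈ S) : M.Chooses S i b := by
  refine (r.part b).chooses (hK b) (r.image b) hl (fun m hm => ?_) fun m h => hS.mem_of_adj hl h
  obtain ⟨c, rfl⟩ := hS
  rw [SimpleGraph.ConnectedComponent.mem_supp_iff] at hl hm
  refine reachable_induction (P := fun m => ∃ l, e b l = m)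
    (SimpleGraph.ConnectedComponent.eq.1 (hl.trans hm.symm)) ⟨l, rfl⟩ ?_
  rintro _ t hst ⟨l₁, rfl⟩
  obtain ⟨c', l₂, rfl⟩ := r.cover t
  by_cases hbc : c' = b
  · subst hbc
    exact ⟨l₂, rfl⟩
  · obtain rfl : c' = !b := by cases b <;> cases c' <;> simp at *
    exact absurd hst (r.cross b l₁ l₂)

theorem IsSum.unary (r : IsSum K M i f e) (hK : ∀ b, (K b).Total) {S : Set M.Link}
    (hS : M.IsPiece S) : M.Unary S i := by
  have hne : S.Nonempty := by
    obtain ⟨c, rfl⟩ := hS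
    exact c.nonempty_supp
  obtain ⟨m, hm⟩ := hne
  obtain ⟨b, l, rfl⟩ := r.cover m
  exact ⟨b, r.chooses_iff hK hS hm⟩

theorem IsSum.mem_choosers (r : IsSum K M i f e) (hK : ∀ b, (K b).Total) (b : Bool)
    (m : M.Link) : (∃ l, e b l = m) ↔ m ∈ M.choosers i b := by
  constructor
  · rintro ⟨l, rfl⟩
    obtain ⟨S, hS, hl⟩ := M.exists_isPiece (e b l)
    exact ⟨S, hS, hl, r.chooses_iff hK hS hl⟩
  · rintro ⟨S, hS, hm, hb⟩
    obtain ⟨c, l, rfl⟩ := r.cover m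
    obtain rfl := (r.chooses_iff hK hS hm).eq hb
    exact ⟨l, rfl⟩

/-- Erasure undoes the rule: the premise and the erased part have the same links and occurrences in
`M`, so `Part.isPerm` identifies them. -/
theorem IsSum.isPerm_argumentPart (r : IsSum K M i f e) (hK : ∀ b, (K b).Total)
    (hC : HasArgs Γ i A B) (b : Bool) :
    ∃ g h, IsPerm (K b) (M.argumentPart (M.choosers i b) i b).2 g h := by
  have r' := Prelinking.isSum_argumentPart hC fun S hS => r.unary hK hS
  obtain ⟨g, h, p, -⟩ := (r.part b).isPerm (r'.part b) (fun v => by rw [r.image, r'.image])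
    fun m => (r.mem_choosers hK b m).trans ⟨fun h => ⟨⟨m, h⟩, rfl⟩, fun ⟨l, h⟩ => h ▸ l.2⟩
  exact ⟨g, h, p⟩

/-- An edge out of a premise can lead only to the deleted root: tree edges and leaf edges stay among
the occurrences of the premise, and conflict edges do because links of different premises are
coherent. -/
theorem IsProd.exists_node_of_adj (r : IsProd K M i f e) {b : Bool} {s} {t : Vertex Γ ⊕ M.Link}
    (h : M.conflictGraph.Adj ((r.part b).node s) t) (ht : M.NotRoot i t) :
    ∃ t', (r.part b).node t' = t := by
  have hlink : ∀ m, (∀ l', m ≠ e (!b) l') → ∃ t', (r.part b).node t' = .inr m := by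
    intro m hm
    obtain ⟨c, l, rfl⟩ := r.cover m
    by_cases hbc : c = b
    · subst hbc
      exact ⟨.inr l, rfl⟩
    · obtain rfl : c = !b := by cases b <;> cases c <;> simp at *
      exact absurd rfl (hm l)
  have hvert : ∀ (x : Pos) (y : Vertex Γ), x.1 < (Γ' b).length → y.1 = shift (f b) x →
      ∃ t', (r.part b).node t' = .inl y := by
    intro x y hx hy
    refine ⟨.inl ⟨x, ?_⟩, congrArg Sum.inl (Subtype.ext hy.symm)⟩
    rw [← (r.part b).subAt_shift hx, ← hy]
    exact y.2
  rcases s with x | l <;> rcases t with y | m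
  · rcases Prelinking.adj_inl_inl.1 h with ⟨c, hc⟩ | ⟨c, hc⟩
    · exact hvert (x.1.1, x.1.2 ++ [c]) y x.lt (by
        rw [hc, shift, ← List.append_assoc]; rfl)
    · have hc : shift (f b) x.1 = (y.1.1, y.1.2 ++ [c]) := hc
      have hx := x.lt
      obtain ⟨⟨k, p⟩, hp⟩ := x
      simp only [shift, Prod.mk.injEq] at hc hx
      -- An empty path means that `x` is the root of a premise formula. Its parent could then only
      -- be the `i`-th root, which `ht` forbids.
      rcases List.eq_nil_or_concat p with rfl | ⟨q, c', rfl⟩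
      · exfalso
        rw [List.append_nil] at hc
        rcases r.front hx with ⟨-, -, h0⟩ | ⟨c', -, h0⟩
        · simp [h0] at hc
        · refine ht y rfl (Prod.ext ?_ ?_)
          · rw [← hc.1, h0]
          · have := hc.2
            rw [h0] at this
            exact (List.append_inj' (s₁ := []) this rfl).1.symm
      · refine hvert (k, q) y hx (Prod.ext hc.1.symm ?_)
        have := hc.2
        rw [List.concat_eq_append, ← List.append_assoc] at this
        exact (List.append_inj' this rfl).1.symm
  · obtain ⟨z, hz, hm⟩ := Prelinking.adj_inl_inr.1 h
    refine hlink m fun l' hl' => ?_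
    subst hl'
    obtain ⟨x', hx', -⟩ := ((r.part !b).rel _ _).1 hm
    exact r.shift_ne x.lt x'.lt (hz.symm.trans hx')
  · obtain ⟨z, hz, hm⟩ := Prelinking.adj_inr_inl.1 h
    obtain ⟨x, hx, -⟩ := ((r.part b).rel _ _).1 hm
    exact hvert x.1 y x.lt (hz.symm.trans hx)
  · have := (Prelinking.adj_inr_inr.1 h).2
    refine hlink m fun l' hl' => this ?_
    subst hl'
    exact r.cross b l l'

theorem IsProd.notRoot_node (r : IsProd K M i f e) {b : Bool} (s) :
    M.NotRoot i ((r.part b).node s) := by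
  intro y hy hy'
  rcases s with x | l
  · obtain rfl := Sum.inl_injective hy
    have hy' : shift (f b) x.1 = (i, []) := hy'
    simp only [shift, Prod.mk.injEq, List.append_eq_nil_iff] at hy'
    rcases r.front x.lt with ⟨-, h, -⟩ | ⟨c, -, h⟩
    · exact h hy'.1
    · simp [h] at hy'
  · exact nomatch hy

theorem IsProd.exists_arg_vertex (r : IsProd K M i f e) (b : Bool) :
    ∃ x : Vertex (Γ' b), ((r.part b).vertex x).1 = (i, [b]) := by
  obtain ⟨k, hk, h⟩ := r.arg b
  exact ⟨⟨(k, []), _, by rw [subAt_root, List.getElem?_eq_getElem hk]⟩,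
    (shift_nil _ _).trans h⟩

/-- The nodes of a premise are closed under adjacency away from the root, and they are connected
among themselves by the connectedness of the premise. -/
theorem IsProd.inComponent_iff (r : IsProd K M i f e) (hK : ∀ b, (K b).Connected) {b : Bool}
    (s) : M.InComponent i b s ↔ ∃ t, (r.part b).node t = s := by
  obtain ⟨x₀, hx₀⟩ := r.exists_arg_vertex b
  constructor
  · intro h
    refine h.induction (P := fun s => ∃ t, (r.part b).node t = s) (fun x hx => ?_) ?_
    · exact ⟨.inl x₀, congrArg Sum.inl (Subtype.ext (hx₀.trans hx.symm))⟩
    · rintro _ t hst ht ⟨s, rfl⟩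
      exact r.exists_node_of_adj hst ht
  · rintro ⟨t, rfl⟩
    refine reachable_induction (P := fun t => M.InComponent i b ((r.part b).node t))
      ((hK b).2.preconnected (.inl x₀) t) (Prelinking.inComponent_arg _ hx₀) fun s t hst hs => ?_
    exact hs.of_adj ((r.part b).node_adj hst) (r.notRoot_node t)

theorem IsProd.not_isCycle (r : IsProd K M i f e) (hK : ∀ b, (K b).Connected)
    (hC : HasArgs Γ i A B) (x : Vertex Γ) (hx : x.1 = (i, []))
    (c : M.conflictGraph.Walk (.inl x) (.inl x)) : ¬ c.IsCycle := by
  intro hc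
  cases c with
  | nil => exact hc.ne_nil rfl
  | @cons _ t _ hadj p =>
    obtain ⟨b, y, rfl, hy⟩ := (Prelinking.adj_root hC hx).1 hadj
    -- A cycle at the root starts with an edge to an argument `y`. Without that edge, a walk from
    -- `y` to the root would have to pass through the other argument, which belongs to the other
    -- premise; so the edge is a bridge.
    refine (SimpleGraph.isBridge_iff_forall_cycle_notMem
      (G := M.conflictGraph) (e := s(.inl x, .inl y)) hadj).1 ?_ _ hc (by simp)
    rw [SimpleGraph.isBridge_iff]
    intro hreach
    refine (reachable_induction (P := fun s => M.InComponent i b s) hreach.symm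
      (Prelinking.inComponent_arg y hy) fun s t hst hs => ?_).notRoot x rfl hx
    rw [SimpleGraph.deleteEdges_adj] at hst
    refine hs.of_adj hst.1 ?_
    rintro z rfl hz
    obtain rfl : z = x := Subtype.ext (hz.trans hx.symm)
    obtain ⟨c, w, rfl, hw⟩ := (Prelinking.adj_root hC hz).1 hst.1.symm
    by_cases hbc : c = b
    · subst hbc
      obtain rfl : w = y := Subtype.ext (hw.trans hy.symm)
      exact hst.2 Sym2.eq_swap
    · obtain rfl : c = !b := by cases b <;> cases c <;> simp at *
      obtain ⟨t, ht⟩ := (r.inComponent_iff hK _).1 hs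
      rcases t with t | t
      · obtain ⟨k, hk, h⟩ := r.arg !b
        refine r.shift_ne t.lt (x' := (k, [])) hk ?_
        rw [shift_nil, h, ← hw]
        exact congrArg Subtype.val (Sum.inl_injective ht)
      · exact nomatch ht

theorem IsProd.isPerm_componentPart (r : IsProd K M i f e) (hK : ∀ b, (K b).Connected)
    (hM : M.Connected) (hC : HasArgs Γ i A B) (b : Bool) :
    ∃ g h, IsPerm (K b) (M.componentPart i b).2 g h := by
  obtain ⟨f', r', hf'⟩ := Prelinking.isProd_componentPart hM hC fun x hx =>
    r.not_isCycle hK hC x hx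
  suffices h : _ ∧ _ from
    let ⟨g, h, p, _⟩ := (r.part b).isPerm (r'.part b) h.1 h.2
    ⟨g, h, p⟩
  refine ⟨fun v => ?_, fun m => ?_⟩
  · rw [hf']
    constructor
    · rintro ⟨k, hk, rfl⟩
      refine ⟨r.front hk, (r.part b).vertex ⟨(k, []), _, by
        rw [subAt_root, List.getElem?_eq_getElem hk]⟩, shift_nil _ _, ?_⟩
      exact (r.inComponent_iff hK _).2 ⟨.inl _, rfl⟩
    · rintro ⟨hv, y, rfl, hy⟩
      obtain ⟨t, ht⟩ := (r.inComponent_iff hK _).1 hy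
      rcases t with x | l
      · have hxy : shift (f b) x.1 = y.1 := congrArg Subtype.val (Sum.inl_injective ht)
        obtain ⟨c, k, hk, h⟩ := (r.image _).2 hv
        by_cases hbc : c = b
        · subst hbc
          exact ⟨k, hk, h⟩
        · obtain rfl : c = !b := by cases b <;> cases c <;> simp at *
          refine absurd ?_ (r.shift_ne x.lt (x' := (k, [])) hk)
          rw [shift_nil, h, hxy]
      · exact nomatch ht
  · have : M.InComponent i b (.inr m) ↔ ∃ l, e b l = m := by
      rw [r.inComponent_iff hK]
      constructor
      · rintro ⟨x | l, h⟩
        · exact nomatch h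
        · exact ⟨l, Sum.inr_injective h⟩
      · rintro ⟨l, rfl⟩
        exact ⟨.inr l, rfl⟩
    rw [← this]
    exact ⟨fun h => ⟨⟨m, h⟩, rfl⟩, fun ⟨l, h⟩ => h ▸ l.2⟩

end Family

/-! ### Erasability of translations -/

theorem Prelinking.finite_erase {Γ : Sequent 𝒜} (K : Prelinking.{u} Γ) (i : ℕ) :
    (K.erase i).Finite := by
  rw [Prelinking.erase]
  split
  · simp
  · simp
  · refine (Set.finite_range fun b => K.argumentPart Set.univ i b).subset ?_
    rintro T ⟨b, -, rfl⟩
    exact ⟨b, rfl⟩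
  · simp
  · simp
  · simp

variable [Literals 𝒜]

/-- `T` can be removed from any cluster of connected prelinkings. -/
def Vanishes (T : (Γ : Sequent 𝒜) × Prelinking.{u} Γ) : Prop :=
  ∀ X : Set ((Γ : Sequent 𝒜) × Prelinking.{u} Γ), (∀ U ∈ X, U.2.Connected) → T ∉ X →
    Relation.ReflTransGen Erasure (.set (X ∪ {T})) (.set X)

/-- Clusters are sets, so an element of `E` that is already present needs no erasure of its own.
This covers two premises that coincide, or a premise that is already in the context. -/
theorem erasure_union {X E : Set ((Γ : Sequent 𝒜) × Prelinking.{u} Γ)}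
    (hX : ∀ U ∈ X, U.2.Connected) (hE : E.Finite) (h : ∀ U ∈ E, U.2.Connected ∧ Vanishes U) :
    Relation.ReflTransGen Erasure (.set (X ∪ E)) (.set X) := by
  induction E, hE using Set.Finite.induction_on with
  | empty => rw [Set.union_empty]
  | @insert T E _ _ ih =>
    have ih := ih fun U hU => h U (.inr hU)
    by_cases hT : T ∈ X ∪ E
    · rwa [Set.union_insert, Set.insert_eq_of_mem hT]
    · rw [Set.union_insert, ← Set.union_singleton]
      refine ((h T (.inl rfl)).2 _ ?_ hT).trans ih
      rintro U (hU | hU)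
      · exact hX U hU
      · exact (h U (.inr hU)).1

theorem Prelinking.Ready.vanishes {Γ : Sequent 𝒜} {K : Prelinking.{u} Γ} {i : ℕ}
    (h : K.Ready i) (hE : ∀ U ∈ K.erase i, U.2.Connected ∧ Vanishes U) : Vanishes ⟨Γ, K⟩ :=
  fun X hX hT => .head (.root X ⟨Γ, K⟩ i hT hX h) (erasure_union hX (K.finite_erase i) hE)

theorem IsPerm.isAxiom {P : 𝒜} {Γ : Sequent 𝒜} {K : Prelinking.{u} Γ} {f : ℕ → Pos}
    {e : (Proof.ax P).translation.Link → K.Link} (p : IsPerm (Proof.ax P).translation K f e) :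
    K.IsAxiom := by
  have h0 := p.getElem? (i := 0) (by simp)
  have h1 := p.getElem? (i := 1) (by simp)
  simp only [List.getElem?_cons_zero, List.getElem?_cons_succ] at h0 h1
  have l0 := (List.getElem?_eq_some_iff.1 h0).1
  have l1 := (List.getElem?_eq_some_iff.1 h1).1
  have hne : (f 0).1 ≠ (f 1).1 := fun h => p.ne_of_ne (j := 0) (k := 1) (by simp) (by simp)
    (by simp) (by rw [p.root (k := 0) (by simp), p.root (k := 1) (by simp), h])
  have hall : ∀ j, j < Γ.length → j = (f 0).1 ∨ j = (f 1).1 := by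
    intro j hj
    obtain ⟨k, hk, h⟩ := p.full j hj
    have hk : k < 2 := hk
    interval_cases k
    · exact .inl (by rw [h])
    · exact .inr (by rw [h])
  have hlen : Γ.length = 2 := by
    have h2 : ¬ 2 < Γ.length := fun h => by
      have := hall 0 (by omega)
      have := hall 1 (by omega)
      have := hall 2 h
      omega
    omega
  refine ⟨?_, ⟨e (), trivial, fun m _ => ?_⟩, fun m y => ?_⟩
  · obtain ⟨C, D, rfl⟩ := List.length_eq_two.1 hlen
    rcases hall 0 (by simp) with h | h
    · rw [← h] at h0
      have h' : (f 1).1 = 1 := by simp only [hlen] at l1; omega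
      rw [h'] at h1
      simp only [List.getElem?_cons_zero, List.getElem?_cons_succ, Option.some.injEq] at h0 h1
      exact ⟨P, by rw [h0, h1]⟩
    · rw [← h] at h1
      have h' : (f 0).1 = 1 := by simp only [hlen] at l0; omega
      rw [h'] at h0
      simp only [List.getElem?_cons_zero, List.getElem?_cons_succ, Option.some.injEq] at h0 h1
      -- The two literals appear in reversed order, which is again an axiom sequent, for the dual
      -- literal.
      exact ⟨Literals.dual P, by rw [h0, h1, Literals.dual_dual]⟩
  · obtain ⟨⟨⟩, rfl⟩ := p.surj m
    rfl
  · obtain ⟨l, rfl⟩ := p.surj m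
    obtain ⟨x, rfl⟩ := p.exists_leaf y
    exact (p.rel_leaf l x).2 trivial

/-- The induction runs over all prelinkings that agree with the translation up to `IsPerm`. A
permutation rule then requires no erasure, and the premises recovered by erasure, which come in a
different order and with other link names, are covered by the induction hypothesis. -/
theorem Proof.vanishes {Γ : Sequent 𝒜} (π : Proof Γ) {Δ : Sequent 𝒜} (U : Prelinking.{u} Δ)
    {f : ℕ → Pos} {e : π.translation.Link → U.Link} (p : IsPerm π.translation U f e) :
    Vanishes ⟨Δ, U⟩ := by
  have hU := p.sound π.sound
  induction π generalizing Δ f with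
  | ax P =>
    exact fun X hX hT => .single (.ax X ⟨Δ, U⟩ hT hX p.isAxiom)
  | perm σ π ih => exact ih U (p.comp (isPerm_perm σ π)) hU
  | @par Γ A B π ih =>
    have r := p.isUnary (i := Γ.length) (by simp) (isUnary_par π)
    have hi := p.getElem? (i := Γ.length) (by simp)
    simp only [List.getElem?_concat_length] at hi
    refine Prelinking.Ready.vanishes (i := (f Γ.length).1) ⟨hU.connected, by simp [hi]⟩ ?_
    simp only [Prelinking.erase, hi]
    rintro _ rfl
    have r' := Prelinking.isUnary_restrict (K := U) (.inr (.inl hi)) (bs := [false, true])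
      (by simp) (by simp)
    have hB : (fun b => b ∈ [false, true]) = fun _ => True := by ext b; simp
    rw [hB] at r'
    obtain ⟨g, h, q⟩ := r.isPerm r'
    exact ⟨(q.sound π.sound).connected, ih _ q (q.sound π.sound)⟩
  | @plus Γ A B b π ih =>
    have r := p.isUnary (i := Γ.length) (by simp) (isUnary_plus b π)
    have hi := p.getElem? (i := Γ.length) (by simp)
    simp only [List.getElem?_concat_length] at hi
    have hb := r.chooses π.sound.total π.sound.connected.1
    refine Prelinking.Ready.vanishes (i := (f Γ.length).1)
      ⟨hU.connected, by simp only [hi]; exact ⟨b, hb⟩⟩ ?_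
    simp only [Prelinking.erase, hi]
    rintro _ ⟨c, hc, rfl⟩
    obtain rfl := hb.eq hc
    have r' := Prelinking.isUnary_restrict (K := U) (.inr (.inr (.inr hi))) (bs := [b])
      (by simp) fun c hc => by
        obtain rfl : c = !b := by cases b <;> cases c <;> simp at *
        exact hb.2
    have hB : (fun c => c ∈ [b]) = fun c => c = b := by ext c; simp
    rw [hB] at r'
    obtain ⟨g, h, q⟩ := r.isPerm r'
    exact ⟨(q.sound π.sound).connected, ih _ q (q.sound π.sound)⟩
  | @tensor Γ Γ₁ A B π ρ ihπ ihρ =>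
    have r := p.isProd (i := Γ.length) (by simp)
      (isProd_tensor (A := A) (B := B) fun | false => π | true => ρ)
    have hi := p.getElem? (i := Γ.length) (by simp)
    simp only [List.getElem?_append_right le_rfl, Nat.sub_self, List.getElem?_cons_zero] at hi
    have hs : ∀ b, (match b with | false => π | true => ρ :
        Proof (tensorPremise Γ Γ₁ A B b)).translation.Connected
      | false => π.sound.connected
      | true => ρ.sound.connected
    refine Prelinking.Ready.vanishes (i := (f Γ.length).1)
      ⟨hU.connected, by simp only [hi]; exact fun x hx => r.not_isCycle hs (.inl hi) x hx⟩ ?_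
    simp only [Prelinking.erase, hi]
    rintro _ (rfl | rfl)
    · obtain ⟨g, h, q⟩ := r.isPerm_componentPart hs hU.connected (.inl hi) false
      exact ⟨(q.sound π.sound).connected, ihπ _ q (q.sound π.sound)⟩
    · obtain ⟨g, h, q⟩ := r.isPerm_componentPart hs hU.connected (.inl hi) true
      exact ⟨(q.sound ρ.sound).connected, ihρ _ q (q.sound ρ.sound)⟩
  | @amp Γ A B π ρ ihπ ihρ =>
    have r := p.isSum (i := Γ.length) (by simp)
      (isSum_amp (A := A) (B := B) fun | false => π | true => ρ)
    have hi := p.getElem? (i := Γ.length) (by simp)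
    simp only [List.getElem?_concat_length] at hi
    have hs : ∀ b, (match b with | false => π | true => ρ :
        Proof (Γ ++ [pick A B b])).translation.Total
      | false => π.sound.total
      | true => ρ.sound.total
    refine Prelinking.Ready.vanishes (i := (f Γ.length).1)
      ⟨hU.connected, by simp only [hi]; exact fun S hS => r.unary hs hS⟩ ?_
    simp only [Prelinking.erase, hi]
    rintro _ (rfl | rfl)
    · obtain ⟨g, h, q⟩ := r.isPerm_argumentPart hs (.inr (.inr (.inl hi))) false
      exact ⟨(q.sound π.sound).connected, ihπ _ q (q.sound π.sound)⟩
    · obtain ⟨g, h, q⟩ := r.isPerm_argumentPart hs (.inr (.inr (.inl hi))) true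
      exact ⟨(q.sound ρ.sound).connected, ihρ _ q (q.sound ρ.sound)⟩

theorem Linking.Sequentializable.isConflictNet {Γ : Sequent 𝒜} {K : Linking.{u} Γ}
    (h : K.Sequentializable) : K.IsConflictNet := by
  obtain ⟨π, hπ⟩ := h
  obtain ⟨a, s⟩ := IsPerm.of_iso hπ
  obtain ⟨f, e, p, -⟩ := s.symm
  have hs := p.sound π.sound
  refine ⟨⟨hs.contractible, hs.maximal⟩, ?_⟩
  have := π.vanishes K.toPrelinking p ∅ (by simp) (by simp)
  rwa [Set.empty_union] at this

end

end MALL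

theorem mainTheorem1 {𝒜 : Type*} [MALL.Literals 𝒜] (Γ : MALL.Sequent 𝒜) (K : MALL.Linking Γ) :
    K.IsConflictNet ↔ K.Sequentializable :=
  ⟨fun h => h.2.sequentializable, fun h => h.isConflictNet⟩
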